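/- Let $p,q\in\mathbb N$ with $1\le p<q$, put $k=\frac{p}{q-p}$, and let $a,z_0\in\mathbb C\setminus\{0\}$. Let $\varphi(z)=\frac{a}{z-z_0}+\tilde\varphi(z)$, where $\tilde\varphi$ is an entire function with $|\tilde\varphi(z)|\le C_1e^{C_2|z|^{q/(q-p)}}$ on $\mathbb C$ for some $C_1,C_2>0$. Consider the Cauchy problem $$\partial_t^pu=\partial_z^qu,\qquad u(0,z)=\varphi(z),\qquad \partial_t^ju(0,z)=0\quad(1\le j<p),$$ and let $\hat u$ be its formal power series solution in $t$, with coefficients holomorphic near $z=0$. *Notation.* $\tilde{\mathbb C}$ is the universal covering of $\mathbb C\setminus\{0\}$, $S(d,\alpha,r)=\{t\in\tilde{\mathbb C}:0<|t|<r,\ |\arg t-d|<\alpha/2\}$, $S(d,\alpha)=S(d,\alpha,\infty)$, and $D_\rho=\{|z|<\rho\}$. $W$ is the Riemann surface of $t\mapsto t^{p/q}$, that is, $\tilde{\mathbb C}$ with $\arg t$ taken modulo $\frac{2\pi q}{p}$, and $W_r=\{t\in W:0<|t|<r\}$. A sector in $W$ is the image of a sector of $\tilde{\mathbb C}$. $\mathcal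 L_\phi=\{\arg t=\phi\}$. For $\alpha>1$, $C_\alpha(\tau)=\sum_{n\ge0}\frac{(-\tau)^n}{n!\,\Gamma(1-\frac{n+1}{\alpha})}$. A series $\sum a_n(z)t^n$ is $k$-summable in the direction $d$ if, for some $\rho,A,B,\varepsilon>0$, $|a_n(z)|\le AB^n(n!)^{1/k}$ on $D_\rho$ and $\sum a_n(z)\frac{n!}{\Gamma(1+n(1+1/k))}t^n$ continues to a holomorphic function $g$ on $S(d,\varepsilon)\times D_\rho$ of exponential growth of order at most $k$ in $t$ on proper subsectors, uniformly in $z$. Its $k$-sum in the direction $d$ is then given, for small $t$ and $z$, by $t^{-k/(1+k)}\int_{e^{i\theta}\mathbb R_+}g(s,z)\,C_{(k+1)/k}\big((s/t)^{k/(1+k)}\big)\,ds^{k/(1+k)}$ with $|\theta-d|<\varepsilon/2$ and $|\arg t-\theta|<\frac{\pi}{2k}$; it lives on the angles $|\arg t-d|<\frac{\pi}{2k}+\frac{\varepsilon}{2}$. The series is $k$-summable if it is so in all directions except finitely many modulo $2\pi$. $\mathcal L_\phi$ is a Stokes line for $\hat u$ if $\hat u$ is not $k$-summable in the direction $\phi$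 but is so in all other directions close to $\phi$; its anti-Stokes lines are then $\mathcal L_{\phi\pm\pi/(2k)}$, and the jump across $\mathcal L_\phi$ is $u^{\phi^+}-u^{\phi^-}$, where $u^{\phi^\pm}$ are the $k$-sums of $\hat u$ in directions close to $\phi$ and greater, resp. less, than $\phi$. For a sector $V\subseteq W$ and a disc $D$ around $0$, an actual solution on $V\times D$ is a function holomorphic on $V\times D$ that satisfies the equation there and, for each $z\in D$, the initial conditions as limits for $t\to0$, $t\in V$. Set $\delta_l=\frac qp\arg z_0+\frac{2(l-1)\pi}{p}$. *Theorem.* $\hat u$ is $k$-summable. On $W$, its Stokes lines are exactly $\mathcal L_{\delta_l}$, $l=1,\dots,q$, and its anti-Stokes lines are exactly $\mathcal L_{\delta_l\pm\frac{\pi(q-p)}{2p}}$. There are functions $u_1,\dots,u_q$ on parts of $W\times\mathbb C$ such that, for each $l$ and each $\theta\in(\delta_l,\delta_{l+1})$ modulo $\frac{2\pi q}{p}$, $u_l$ is the $k$-sum $u^\theta$ of $\hat u$ in the direction $\theta$ and, for every $\alpha\in(0,\frac\pi k)$, $$u_l(t,z)=\frac{1}{q\,t^{p/q}}\int_{e^{i\theta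 p/q}\mathbb R_+}\sum_{j=0}^{q-1}\varphi\big(z+e^{2j\pi i/q}s\big)\,C_{q/p}\big(s/t^{p/q}\big)\,ds$$ for $t\in S(\theta,\alpha,r')$ and $z\in D_{\rho'}$, with some $r',\rho'>0$ depending on $\theta$ and $\alpha$. For every $\varepsilon$ with $0<\varepsilon<\min\big(\frac{2\pi}p,\frac{\pi(q-p)}p\big)$ there are $r,\rho>0$ such that, with $D=D_\rho$ and $$V_l=S\Big(\delta_l+\frac\pi p,\ \frac{2\pi}p+\frac{\pi(q-p)}p-\varepsilon,\ r\Big)\subset W ,$$ $\{u_1,\dots,u_q\}$ is a maximal family of solutions on $W_r\times D$, that is: 1. each $V_l$ is a sector with an opening greater than $\pi/k$, and the $V_l$ cover $W_r$; 2. each $u_l$ is an actual solution on $V_l\times D$ (in particular holomorphic there); 3. if $i\ne j$ and $V_i\cap V_j\neq\emptyset$, then $u_i\not\equiv u_j$ on $(V_i\cap V_j)\times D$; 4. if $\tilde V\subseteq W_r$ is a sector and $\tilde u$ is an actual solution on $\tilde V\times D$ that is the $k$-sum of $\hat u$ on $\tilde V$ in a nonsingular direction $d$ belonging to $\tilde V$,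 then for some $i$ one has $\tilde V\cap V_i\ne\emptyset$ and $\tilde u\equiv u_i$ on $(\tilde V\cap V_i)\times D$. The jump across $\mathcal L_{\delta_l}$, $l=1,\dots,q$, is given, with $u_0:=u_q$, by $$u_l(t,z)-u_{l-1}(t,z)=u^{\delta_l^+}(t,z)-u^{\delta_l^-}(t,z)=-\frac{2\pi i}{q\,t^{p/q}}\,e^{\frac{2(l-1)\pi i}{q}}\,a\,C_{q/p}\!\left(\frac{(z_0-z)\,e^{\frac{2(l-1)\pi i}{q}}}{t^{p/q}}\right),$$ where the formula for $u_l-u_{l-1}$ holds for all $(t,z)\in S\big(\delta_l,\frac{\pi(q-p)}p-\varepsilon,r\big)\times D$. -/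

import Mathlib

open Filter Topology

noncomputable section

/-! ### The universal covering of `ℂ \ {0}` and the Riemann surface of `t ^ (1 / σ)`

A point `t` of the universal covering of `ℂ \ {0}` is given by its logarithm `w : ℂ`, so
`|t| = exp w.re`, `arg t = w.im ∈ ℝ`, `t ^ s = exp (s * w)`, and `t → 0` means `w.re → -∞`. -/

/-- The sector `S(d, α, R)`: `0 < |t| < R` and `|arg t - d| < α / 2`. -/
def sector (d α R : ℝ) : Set ℂ := {w | Real.exp w.re < R ∧ |w.im - d| < α / 2}

/-- The unbounded sector `S(d, α)`. -/
def sectorInf (d α : ℝ) : Set ℂ := {w | |w.im - d| < α / 2}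

/-- The Riemann surface of `t ^ (1 / σ)`, for real `σ > 0`: the universal covering with `arg t` taken
modulo `2πσ`. -/
abbrev RSurf (σ : ℝ) : Type :=
  ℂ ⧸ AddSubgroup.zmultiples (((2 * Real.pi * σ : ℝ) : ℂ) * Complex.I)

/-- The projection of the universal covering onto the Riemann surface of `t ^ (1 / σ)`. -/
def proj (σ : ℝ) (w : ℂ) : RSurf σ := QuotientAddGroup.mk w

/-- The punctured disc `0 < |t| < r` of the Riemann surface. -/
def surfDisc (σ r : ℝ) : Set (RSurf σ) := proj σ '' {w | Real.exp w.re < r}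

/-- The line `arg t = φ` on the Riemann surface. -/
def argLine (σ φ : ℝ) : Set (RSurf σ) := proj σ '' {w | w.im = φ}

/-- A function of a point of the Riemann surface and of `z`, pulled back to the universal covering. -/
def pull {σ : ℝ} (u : RSurf σ → ℂ → ℂ) : ℂ → ℂ → ℂ := fun w z => u (proj σ w) z

/-- `f ∈ 𝒪(S × D)`. -/
def HoloOn (S D : Set ℂ) (f : ℂ → ℂ → ℂ) : Prop :=
  DifferentiableOn ℂ (fun x : ℂ × ℂ => f x.1 x.2) (S ×ˢ D)

/-- The derivative `∂_t`, in the coordinate `w = log t`. -/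
def dt (f : ℂ → ℂ → ℂ) : ℂ → ℂ → ℂ :=
  fun w z => Complex.exp (-w) * deriv (fun w' => f w' z) w

/-- Entire functions of exponential growth of order at most `s`. -/
def EntireExpGrowth (s : ℝ) (f : ℂ → ℂ) : Prop :=
  Differentiable ℂ f ∧
    ∃ C₁ > 0, ∃ C₂ > 0, ∀ z, ‖f z‖ ≤ C₁ * Real.exp (C₂ * ‖z‖ ^ s)

/-! ### Formal series and `k`-summability

A formal series `∑ aₙ(z) tⁿ` is the sequence `uh` of its coefficients. As usual for series with
coefficients in `𝒪(D)`, the radius of the disc `D` around `0` may shrink. -/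

/-- Gevrey series of order `s`, uniformly on some disc. -/
def IsGevrey (s : ℝ) (uh : ℕ → ℂ → ℂ) : Prop :=
  ∃ ρ > 0, ∃ A > 0, ∃ B > 0, ∀ n : ℕ, ∀ z ∈ Metric.ball (0 : ℂ) ρ,
    ‖uh n z‖ ≤ A * B ^ n * (n.factorial : ℝ) ^ s

/-- `g` is an element of `𝒪ᵏ(S(d, ε) × D_ρ)` which continues the sum of the modified Borel transform
`∑ aₙ(z) tⁿ n! / Γ(1 + n(1 + 1/k))`. -/
structure IsBorelCont (k : ℝ) (uh : ℕ → ℂ → ℂ) (d ε ρ : ℝ) (g : ℂ → ℂ → ℂ) : Prop where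
  holo : HoloOn (sectorInf d ε) (Metric.ball 0 ρ) g
  eq_borel : ∃ r > 0, ∀ w ∈ sector d ε r, ∀ z ∈ Metric.ball (0 : ℂ) ρ,
    HasSum (fun n : ℕ => uh n z * Complex.exp w ^ n *
      ((n.factorial : ℝ) / Real.Gamma (1 + n * (1 + 1 / k)) : ℝ)) (g w z)
  growth : ∀ η, 0 < η → η < ε → ∃ C₁ > 0, ∃ C₂ > 0,
    ∀ w ∈ sectorInf d η, ∀ z ∈ Metric.ball (0 : ℂ) ρ,
      ‖g w z‖ ≤ C₁ * Real.exp (C₂ * Real.exp w.re ^ k)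

/-- `uh` is `k`-summable in the direction `d`. -/
def IsSummableIn (k : ℝ) (uh : ℕ → ℂ → ℂ) (d : ℝ) : Prop :=
  IsGevrey (1 / k) uh ∧ ∃ ε > 0, ∃ ρ > 0, ∃ g, IsBorelCont k uh d ε ρ g

/-- `uh` is `k`-summable: in all directions but finitely many modulo `2π`. -/
def IsKSummable (k : ℝ) (uh : ℕ → ℂ → ℂ) : Prop :=
  ∃ F : Finset ℝ, ∀ d : ℝ, (∀ x ∈ F, ∀ m : ℤ, d ≠ x + 2 * Real.pi * m) → IsSummableIn k uh d

/-- `C_α(τ) = ∑ (-τ)ⁿ / (n! Γ(1 - (n + 1)/α))`. At the poles of `Γ` the value of `Complex.Gamma` is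
`0`, so that its inverse is `0` too, which is the value of the entire function `1/Γ` there. -/
def kernelC (α : ℝ) (τ : ℂ) : ℂ :=
  ∑' n : ℕ, (-τ) ^ n / (n.factorial : ℂ) * (Complex.Gamma (1 - ((n : ℂ) + 1) / (α : ℂ)))⁻¹

/-- The integrand of the Ecalle operator of order `k` at `t = e^w`, on the ray `s = x e^{iθ}`, `x > 0`,
where `d s^κ = κ x^{κ-1} e^{iκθ} dx` with `κ = k/(1+k)`. -/
def ecalleIntegrand (k θ : ℝ) (g : ℂ → ℂ → ℂ) (w z : ℂ) (x : ℝ) : ℂ :=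
  g (Real.log x + θ * Complex.I) z *
    kernelC ((k + 1) / k)
      (Complex.exp (((k / (1 + k) : ℝ) : ℂ) * (Real.log x + θ * Complex.I - w))) *
    (((k / (1 + k) * x ^ (k / (1 + k) - 1) : ℝ) : ℂ) *
      Complex.exp (((k / (1 + k) * θ : ℝ) : ℂ) * Complex.I))

/-- The Ecalle operator, with integration along the ray of direction `θ`. -/
def ecalle (k θ : ℝ) (g : ℂ → ℂ → ℂ) (w z : ℂ) : ℂ :=
  Complex.exp (-(((k / (1 + k) : ℝ) : ℂ) * w)) *
    ∫ x in Set.Ioi (0 : ℝ), ecalleIntegrand k θ g w z x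

/-- On the part of `S` near `t = 0` (and for `z` near `0`), `f` is the `k`-sum of `uh` in the direction
`d`. The `k`-sum is obtained from the rays of directions `θ ∈ (d - ε/2, d + ε/2)`, and it lives on
the angles `(d - π/(2k) - ε/2, d + π/(2k) + ε/2)`, in which `S` has to be contained. -/
def IsKSum (k : ℝ) (uh : ℕ → ℂ → ℂ) (d : ℝ) (S : Set ℂ) (f : ℂ → ℂ → ℂ) : Prop :=
  IsGevrey (1 / k) uh ∧ ∃ ε > 0, ∃ ρ > 0, ∃ g, IsBorelCont k uh d ε ρ g ∧
    S ⊆ sectorInf d (Real.pi / k + ε) ∧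
    ∀ θ, |θ - d| < ε / 2 → ∀ α, 0 < α → α < Real.pi / k → ∃ r > 0, ∃ ρ' > 0,
      ∀ w ∈ S ∩ sector θ α r, ∀ z ∈ Metric.ball (0 : ℂ) ρ',
        MeasureTheory.IntegrableOn (ecalleIntegrand k θ g w z) (Set.Ioi 0) ∧
        f w z = ecalle k θ g w z

/-! ### Stokes lines, anti-Stokes lines and jumps -/

/-- `arg t = φ` is a Stokes line for `uh`. -/
def IsStokesDirection (k : ℝ) (uh : ℕ → ℂ → ℂ) (φ : ℝ) : Prop :=
  ¬ IsSummableIn k uh φ ∧ ∃ ε > 0, ∀ d, d ≠ φ → |d - φ| < ε → IsSummableIn k uh d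

/-- The Stokes lines for `uh` on the Riemann surface of `t ^ (1 / σ)`. -/
def stokesLines (k σ : ℝ) (uh : ℕ → ℂ → ℂ) : Set (Set (RSurf σ)) :=
  {L | ∃ φ, IsStokesDirection k uh φ ∧ L = argLine σ φ}

/-- The anti-Stokes lines `arg t = φ ± π/(2k)`, for the Stokes lines `arg t = φ`. -/
def antiStokesLines (k σ : ℝ) (uh : ℕ → ℂ → ℂ) : Set (Set (RSurf σ)) :=
  {L | ∃ φ, IsStokesDirection k uh φ ∧
    (L = argLine σ (φ + Real.pi / (2 * k)) ∨ L = argLine σ (φ - Real.pi / (2 * k)))}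

/-- `J` is the jump `u^{φ⁺} - u^{φ⁻}` for `uh` across the line `arg t = φ`, near this line. -/
def IsJump (k : ℝ) (uh : ℕ → ℂ → ℂ) (φ : ℝ) (J : ℂ → ℂ → ℂ) : Prop :=
  ∃ ε > 0, ∀ d₁ ∈ Set.Ioo φ (φ + ε), ∀ d₂ ∈ Set.Ioo (φ - ε) φ, ∃ f₁ f₂,
    IsKSum k uh d₁ (sectorInf d₁ (Real.pi / k)) f₁ ∧
    IsKSum k uh d₂ (sectorInf d₂ (Real.pi / k)) f₂ ∧
    ∃ α > 0, sectorInf φ α ⊆ sectorInf d₁ (Real.pi / k) ∩ sectorInf d₂ (Real.pi / k) ∧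
    ∃ r > 0, ∃ ρ > 0, ∀ w ∈ sector φ α r, ∀ z ∈ Metric.ball (0 : ℂ) ρ,
      f₁ w z - f₂ w z = J w z

/-! ### The Cauchy problem `∂_t^p u = ∂_z^q u`, `u(0,z) = φ(z)`, `∂_t^j u(0,z) = 0` for `1 ≤ j < p` -/

/-- The series with coefficients `uh n ∈ 𝒪(D)` is a formal solution. -/
structure IsFormalSolution (p q : ℕ) (φ : ℂ → ℂ) (D : Set ℂ) (uh : ℕ → ℂ → ℂ) : Prop where
  holo : ∀ n, DifferentiableOn ℂ (uh n) D
  eqn : ∀ n, ∀ z ∈ D,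
    ((n + p).factorial / n.factorial : ℂ) * uh (n + p) z = iteratedDeriv q (uh n) z
  init : ∀ z ∈ D, uh 0 z = φ z
  init_deriv : ∀ j, 1 ≤ j → j < p → ∀ z ∈ D, uh j z = 0

/-- `u ∈ 𝒪(V × D)` is an actual solution, for a subset `V` of the Riemann surface. -/
structure IsActualSolution (p q : ℕ) (φ : ℂ → ℂ) {σ : ℝ} (V : Set (RSurf σ)) (D : Set ℂ)
    (u : RSurf σ → ℂ → ℂ) : Prop where
  holo : HoloOn (proj σ ⁻¹' V) D (pull u)
  eqn : ∀ w ∈ proj σ ⁻¹' V, ∀ z ∈ D, dt^[p] (pull u) w z = iteratedDeriv q (pull u w) z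
  init : ∀ j < p, ∀ z ∈ D,
    Tendsto (fun w => dt^[j] (pull u) w z)
      (comap Complex.re atBot ⊓ 𝓟 (proj σ ⁻¹' V)) (𝓝 (if j = 0 then φ z else 0))

/-- `V` is a sector on the Riemann surface with an opening greater than `β`. -/
def IsSectorGT (σ β : ℝ) (V : Set (RSurf σ)) : Prop :=
  ∃ d α R, β < α ∧ 0 < R ∧ V = proj σ '' sector d α R

/-- `(u i)`, `i ∈ I`, with `u i ∈ 𝒪(V i × D)`, is a maximal family of solutions on `V₀ × D`; here `uh`
is the formal solution. -/
structure IsMaximalFamily (p q : ℕ) (φ : ℂ → ℂ) (uh : ℕ → ℂ → ℂ) (k : ℝ) {σ : ℝ}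
    (V₀ : Set (RSurf σ)) (D : Set ℂ) {ι : Type} (I : Finset ι) (V : ι → Set (RSurf σ))
    (u : ι → RSurf σ → ℂ → ℂ) : Prop where
  summable : IsKSummable k uh
  sector_base : IsSectorGT σ (Real.pi / k) V₀
  sector : ∀ i ∈ I, V i ⊆ V₀ ∧ IsSectorGT σ (Real.pi / k) (V i)
  cover : V₀ ⊆ ⋃ i ∈ I, V i
  solution : ∀ i ∈ I, IsActualSolution p q φ (V i) D (u i)
  distinct : ∀ i ∈ I, ∀ j ∈ I, i ≠ j → (V i ∩ V j).Nonempty →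
    ∃ x ∈ V i ∩ V j, ∃ z ∈ D, u i x z ≠ u j x z
  maximal : ∀ d' α R : ℝ, 0 < α → 0 < R → proj σ '' _root_.sector d' α R ⊆ V₀ →
    ∀ v : RSurf σ → ℂ → ℂ, IsActualSolution p q φ (proj σ '' _root_.sector d' α R) D v →
    ∀ d : ℝ, |d - d'| < α / 2 → IsSummableIn k uh d →
    IsKSum k uh d (_root_.sector d' α R) (pull v) →
    ∃ i ∈ I, (proj σ '' _root_.sector d' α R ∩ V i).Nonempty ∧
      ∀ x ∈ proj σ '' _root_.sector d' α R ∩ V i, ∀ z ∈ D, v x z = u i x z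

/-- `t ^ (p/q)`. -/
def tpow (p q : ℕ) (w : ℂ) : ℂ := Complex.exp ((p / q : ℂ) * w)

/-- The integrand of `solInt`, on the ray `s = x e^{iθp/q}`, `x > 0`. -/
def solIntegrand (p q : ℕ) (φ : ℂ → ℂ) (θ : ℝ) (w z : ℂ) (x : ℝ) : ℂ :=
  (∑ j ∈ Finset.range q, φ (z + Complex.exp (2 * j * Real.pi * Complex.I / q) *
      (x * Complex.exp (θ * p / q * Complex.I)))) *
    kernelC (q / p) (x * Complex.exp (θ * p / q * Complex.I) / tpow p q w) *
    Complex.exp (θ * p / q * Complex.I)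

/-- The function
`(1 / (q t^{p/q})) ∫ (φ(z+s) + ⋯ + φ(z + e^{2(q-1)πi/q} s)) C_{q/p}(s / t^{p/q}) ds`, with the
integral along the ray `arg s = θp/q`. -/
def solInt (p q : ℕ) (φ : ℂ → ℂ) (θ : ℝ) (w z : ℂ) : ℂ :=
  1 / (q * tpow p q w) * ∫ x in Set.Ioi (0 : ℝ), solIntegrand p q φ θ w z x

/-- The directions `δ_l = (q/p) arg z₀ + 2(l-1)π/p`. -/
def stokesDelta (p q : ℕ) (z₀ : ℂ) (l : ℕ) : ℝ :=
  q / p * Complex.arg z₀ + 2 * ((l : ℝ) - 1) * Real.pi / p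

/-- `-(2πi / (q t^{p/q})) e^{2(l-1)πi/q} a C_{q/p}((z₀ - z) e^{2(l-1)πi/q} / t^{p/q})`. -/
def stokesJump (p q : ℕ) (a z₀ : ℂ) (l : ℕ) (w z : ℂ) : ℂ :=
  -(2 * Real.pi * Complex.I / (q * tpow p q w)) *
    Complex.exp (2 * ((l : ℂ) - 1) * Real.pi * Complex.I / q) * a *
    kernelC (q / p)
      ((z₀ - z) * Complex.exp (2 * ((l : ℂ) - 1) * Real.pi * Complex.I / q) / tpow p q w)

end

noncomputable section

open MeasureTheory Set

/-! The problem is linear and the initial value is a pole plus an entire function. Write σ = q/p.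
For the entire part, Cauchy's estimates and the growth of order q/(q-p) make the formal solution
converge near t = 0 (`entirePart`), so it contributes the same function to all k-sums. Every Stokes
phenomenon comes from the pole.

The modified Borel transform of the formal solution is the average of φ(z + e^{2jπi/q} t^{p/q}) over
j (`borelSum`). It continues with growth of order k along every direction that misses its poles, and
for z near 0 those have arguments near the δ_l. This gives summability off the δ_l
(`isBorelCont_borelSum`). At δ_l the pole, whose residue is nonzero because a ≠ 0, prevents a
continuation (`not_isSummableIn_poleDir`).

The k-sums are computed explicitly. The kernel C_σ(τ) is σ/(2πi) times the integral of exp(y^σ - τy)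
from ∞e^{-πi/σ} to ∞e^{πi/σ} (`kernelC_eq`), and it decays in a sector (`kernelC_decay`). With τ =
e^{-ω/σ}, τ C_σ(τ) is, up to a constant factor, the difference of one entire function `laplaceE` at
ω and ω + 2πi. An integral of C_σ against a function that is 2πi-periodic in ω is therefore an
integral around a strip of height 2π. For monomials it gives the moments (qm)!/(pm)!
(`integral_kernelC_mul_pow`), which undo the Borel transform of the entire part. For the pole the
residue theorem (`integral_laplaceE_sub_div`) gives p residues. Each is an elementary solution
`rayTerm`, a Laplace superposition of the exponentials exp(-y(z₀ - z) + c y^σ t) with c^p = 1.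

Hence all k-sums with direction between δ_l and δ_{l+1} are one function `solBranch` = `entirePart`
+ `poleSum` (`solInt_eq_solBranch`, `ecalle_eq_solInt`). It satisfies the equation for every arg t.
The initial conditions follow from the asymptotics of the rays (`momentInt_asymptotic`), which hold
on the angles of V_l. Raising l by one moves the window of p consecutive rays by one step. The two
rays at its ends differ by a value of the kernel, and this is the jump (`poleSum_sub`). The branches
depend on l modulo q and on arg t modulo 2πq/p, so there are q of them on W. They are distinct
because a sum of fewer than q consecutive jumps has a nonzero leading coefficient at t = ∞
(`poleSum_ne`). Maximality holds because any k-sum in a nonsingular direction agrees with a branch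
near t = 0 (`IsKSum.eq_solBranch`), and the identity theorem extends the equality. -/

/-! ### The integrals `momentInt`: holomorphy, rotation of the ray, asymptotics. -/

/-- `∫₀^∞ x ^ s exp (-x A - x ^ σ B) dx`. -/
def momentInt (σ s : ℝ) (A B : ℂ) : ℂ :=
  ∫ x in Ioi (0 : ℝ), ((x ^ s : ℝ) : ℂ) * Complex.exp (-(x * A) - ((x ^ σ : ℝ) : ℂ) * B)

theorem linear_le_rpow {σ : ℝ} (hσ : 1 < σ) (a : ℝ) {b : ℝ} (hb : 0 < b) :
    ∃ K, ∀ x : ℝ, 0 < x → a * x ≤ b * x ^ σ + K := by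
  -- T is the threshold beyond which |a| ≤ b x^{σ-1}; below it the constant |a| T suffices.
  set T : ℝ := (|a| / b) ^ (1 / (σ - 1)) with hT
  have hT0 : 0 ≤ T := by positivity
  refine ⟨|a| * T, fun x hx => ?_⟩
  have h1 : a * x ≤ |a| * x := mul_le_mul_of_nonneg_right (le_abs_self a) hx.le
  rcases le_total x T with h | h
  · have : |a| * x ≤ |a| * T := mul_le_mul_of_nonneg_left h (abs_nonneg a)
    have : 0 ≤ b * x ^ σ := by positivity
    linarith
  · have h2 : |a| / b ≤ x ^ (σ - 1) := by
      have : T ^ (σ - 1) = |a| / b := by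
        rw [hT, ← Real.rpow_mul (by positivity), one_div, inv_mul_cancel₀ (by linarith),
          Real.rpow_one]
      rw [← this]
      exact Real.rpow_le_rpow hT0 h (by linarith)
    have h3 : x ^ σ = x ^ (σ - 1) * x := by
      rw [← Real.rpow_add_one hx.ne']; ring_nf
    have h4 : |a| ≤ b * x ^ (σ - 1) := by
      rw [div_le_iff₀ hb] at h2; linarith
    have : |a| * x ≤ b * x ^ (σ - 1) * x := mul_le_mul_of_nonneg_right h4 hx.le
    have : 0 ≤ |a| * T := by positivity
    rw [h3]; linarith

theorem integrableOn_rpow_mul_exp {σ : ℝ} (hσ : 1 < σ) {s : ℝ} (hs : -1 < s) (a : ℝ) {b : ℝ}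
    (hb : 0 < b) : IntegrableOn (fun x : ℝ => x ^ s * Real.exp (a * x - b * x ^ σ)) (Ioi 0) := by
  obtain ⟨K, hK⟩ := linear_le_rpow hσ a (half_pos hb)
  have h := (integrableOn_rpow_mul_exp_neg_mul_rpow hs (by linarith : 0 < σ)
    (half_pos hb)).mul_const (Real.exp K)
  refine Integrable.mono' h (by fun_prop) ?_
  filter_upwards [ae_restrict_mem measurableSet_Ioi] with x hx
  have hx : 0 < x := hx
  rw [Real.norm_of_nonneg (by positivity), mul_assoc, ← Real.exp_add]
  gcongr
  have := hK x hx
  linarith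

theorem norm_momentInt_integrand (σ s : ℝ) (A B : ℂ) {x : ℝ} (hx : 0 < x) :
    ‖((x ^ s : ℝ) : ℂ) * Complex.exp (-(x * A) - ((x ^ σ : ℝ) : ℂ) * B)‖ =
      x ^ s * Real.exp (-A.re * x - B.re * x ^ σ) := by
  rw [norm_mul, Complex.norm_exp, Complex.norm_real, Real.norm_of_nonneg (by positivity)]
  congr 2
  simp
  ring

theorem integrableOn_momentInt {σ : ℝ} (hσ : 1 < σ) {s : ℝ} (hs : -1 < s) (A : ℂ) {B : ℂ}
    (hB : 0 < B.re) :
    IntegrableOn (fun x : ℝ => ((x ^ s : ℝ) : ℂ) *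
      Complex.exp (-(x * A) - ((x ^ σ : ℝ) : ℂ) * B)) (Ioi 0) := by
  refine Integrable.mono' (integrableOn_rpow_mul_exp hσ hs (-A.re) hB) (by fun_prop) ?_
  filter_upwards [ae_restrict_mem measurableSet_Ioi] with x hx
  rw [norm_momentInt_integrand σ s A B hx]

/-- A parameter integral of holomorphic functions is holomorphic. -/
theorem differentiableOn_integral_of_dominated {μ : Measure ℝ} {F : ℂ → ℝ → ℂ}
    {U : Set ℂ} (hU : IsOpen U) (hmeas : ∀ w ∈ U, AEStronglyMeasurable (F w) μ)
    (hdiff : ∀ᵐ x ∂μ, DifferentiableOn ℂ (fun w => F w x) U)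
    (hmeas' : ∀ w ∈ U, AEStronglyMeasurable (fun x => deriv (fun w => F w x) w) μ)
    (hbound : ∀ w₀ ∈ U, ∃ r > 0, ∃ b : ℝ → ℝ, Integrable b μ ∧
      ∀ᵐ x ∂μ, ∀ w ∈ Metric.ball w₀ r, ‖F w x‖ ≤ b x) :
    DifferentiableOn ℂ (fun w => ∫ x, F w x ∂μ) U := by
  intro w₀ hw₀
  obtain ⟨r₁, hr₁, b, hb, hle⟩ := hbound w₀ hw₀
  obtain ⟨r₂, hr₂, hsub⟩ := Metric.isOpen_iff.1 hU w₀ hw₀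
  -- Circles of radius r/2 about points of the ball of radius r stay inside both neighbourhoods, so
  -- Cauchy's estimate bounds the derivative of the integrand by b/(r/2).
  set r := min r₁ r₂ / 2 with hr
  have hm : 0 < min r₁ r₂ := lt_min hr₁ hr₂
  have hr0 : 0 < r := by positivity
  have hin : ∀ w ∈ Metric.ball w₀ r, ∀ v ∈ Metric.closedBall w (r / 2),
      v ∈ Metric.ball w₀ r₁ ∧ v ∈ U := by
    intro w hw v hv
    have h1 : dist v w₀ < r + r / 2 :=
      (dist_triangle v w w₀).trans_lt (by
        have := Metric.mem_ball.1 hw; have := Metric.mem_closedBall.1 hv; linarith)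
    have h2 : r + r / 2 < min r₁ r₂ := by rw [hr]; linarith
    exact ⟨Metric.mem_ball.2 (h1.trans (h2.trans_le (min_le_left _ _))),
      hsub (Metric.mem_ball.2 (h1.trans (h2.trans_le (min_le_right _ _))))⟩
  have hself : ∀ w ∈ Metric.ball w₀ r, w ∈ U := fun w hw =>
    (hin w hw w (Metric.mem_closedBall_self (by positivity))).2
  have hball : Metric.ball w₀ r ∈ 𝓝 w₀ := Metric.ball_mem_nhds _ hr0
  refine (hasDerivAt_integral_of_dominated_loc_of_deriv_le (F := F)
    (F' := fun w x => deriv (fun w => F w x) w) (bound := fun x => b x / (r / 2)) hball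
    ?_ ?_ (hmeas' w₀ hw₀) ?_ (hb.div_const _) ?_).2.differentiableAt.differentiableWithinAt
  · filter_upwards [hball] with w hw using hmeas w (hself w hw)
  · refine Integrable.mono' hb (hmeas w₀ hw₀) ?_
    filter_upwards [hle] with x hx using hx w₀ (Metric.mem_ball_self hr₁)
  · filter_upwards [hle, hdiff] with x hx hd w hw
    refine Complex.norm_deriv_le_of_forall_mem_sphere_norm_le (by positivity) ?_ ?_
    · refine DifferentiableOn.diffContOnCl ?_
      refine hd.mono fun v hv => (hin w hw v ?_).2
      exact Metric.closure_ball_subset_closedBall hv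
    · intro v hv
      exact hx v (hin w hw v (Metric.sphere_subset_closedBall hv)).1
  · filter_upwards [hdiff] with x hd w hw
    exact (hd.differentiableAt (hU.mem_nhds (hself w hw))).hasDerivAt

theorem hasDerivAt_momentInt {σ : ℝ} (hσ : 1 < σ) {s : ℝ} (hs : -1 < s) (A : ℂ) {B : ℂ}
    (hB : 0 < B.re) :
    HasDerivAt (fun A => momentInt σ s A B) (-momentInt σ (s + 1) A B) A := by
  have key := hasDerivAt_integral_of_dominated_loc_of_deriv_le (μ := volume.restrict (Ioi (0 : ℝ)))
    (F := fun (A : ℂ) (x : ℝ) => ((x ^ s : ℝ) : ℂ) *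
      Complex.exp (-(x * A) - ((x ^ σ : ℝ) : ℂ) * B))
    (F' := fun (A : ℂ) (x : ℝ) => -(((x ^ (s + 1) : ℝ) : ℂ) *
      Complex.exp (-(x * A) - ((x ^ σ : ℝ) : ℂ) * B))) (x₀ := A)
    (bound := fun x => x ^ (s + 1) * Real.exp ((|A.re| + 1) * x - B.re * x ^ σ))
    (Metric.ball_mem_nhds A one_pos) ?_ (integrableOn_momentInt hσ hs A hB) (by fun_prop) ?_
    (integrableOn_rpow_mul_exp hσ (by linarith) _ hB) ?_
  · have h := key.2
    rw [integral_neg] at h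
    exact h
  · exact Eventually.of_forall fun w => by fun_prop
  · filter_upwards [ae_restrict_mem measurableSet_Ioi] with x hx w hw
    have hx : 0 < x := hx
    rw [norm_neg, norm_momentInt_integrand σ (s + 1) w B hx]
    have h1 : |w.re - A.re| ≤ 1 := by
      rw [← Complex.sub_re]
      exact (Complex.abs_re_le_norm _).trans (by
        have := Metric.mem_ball.1 hw; rw [dist_eq_norm] at this; exact this.le)
    have h2 : -w.re ≤ |A.re| + 1 := by
      have := neg_abs_le A.re; have := (abs_le.1 h1).1; linarith
    gcongr
  · filter_upwards [ae_restrict_mem measurableSet_Ioi] with x hx w hw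
    have hx : 0 < x := hx
    have h1 : HasDerivAt (fun w : ℂ => -(x * w) - ((x ^ σ : ℝ) : ℂ) * B) (-(x * 1)) w :=
      ((hasDerivAt_id w).const_mul (x : ℂ)).neg.sub_const _
    convert! (h1.cexp.const_mul ((x ^ s : ℝ) : ℂ)) using 1
    rw [Real.rpow_add_one hx.ne']
    push_cast
    ring

/-- Substitution x ↦ e^g x. This real case determines the complex one in `momentInt_rotate` by the
identity theorem. -/
theorem momentInt_real_scale (σ s : ℝ) (A B : ℂ) (g : ℝ) :
    momentInt σ s A B = Complex.exp ((s + 1) * g) *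
      momentInt σ s (Complex.exp g * A) (Complex.exp (σ * g) * B) := by
  unfold momentInt
  have h := integral_comp_mul_left_Ioi (fun x : ℝ => ((x ^ s : ℝ) : ℂ) *
      Complex.exp (-(x * A) - ((x ^ σ : ℝ) : ℂ) * B)) 0 (Real.exp_pos g)
  rw [mul_zero] at h
  have h2 := congrArg (fun v => Real.exp g • v) h
  simp only [smul_smul, mul_inv_cancel₀ (Real.exp_pos g).ne', one_smul] at h2
  rw [← h2, ← integral_const_mul, Complex.real_smul, ← integral_const_mul]
  refine setIntegral_congr_fun measurableSet_Ioi fun x hx => ?_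
  have hx : 0 < x := hx
  rw [Real.mul_rpow (Real.exp_pos g).le hx.le, Real.mul_rpow (Real.exp_pos g).le hx.le,
    ← Real.exp_mul, ← Real.exp_mul, add_mul, Complex.exp_add, one_mul]
  push_cast
  ring_nf

theorem differentiableOn_momentInt_rotated {σ : ℝ} (hσ : 1 < σ) {s : ℝ} (hs : -1 < s) (A : ℂ) :
    DifferentiableOn ℂ (fun g : ℂ => momentInt σ s (Complex.exp g * A) (Complex.exp (σ * g)))
      {g | 0 < (Complex.exp (σ * g)).re} := by
  have hcB : Continuous fun g : ℂ => (Complex.exp (σ * g)).re := by fun_prop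
  have hcA : Continuous fun g : ℂ => (Complex.exp g * A).re := by fun_prop
  refine differentiableOn_integral_of_dominated (isOpen_lt continuous_const hcB) ?_ ?_ ?_ ?_
  · exact fun w _ => by fun_prop
  · exact Eventually.of_forall fun x => by fun_prop
  · intro w _
    have : (fun x : ℝ => deriv (fun w : ℂ => ((x ^ s : ℝ) : ℂ) *
        Complex.exp (-(x * (Complex.exp w * A)) - ((x ^ σ : ℝ) : ℂ) * Complex.exp (σ * w))) w) =
        fun x : ℝ => ((x ^ s : ℝ) : ℂ) *
        (Complex.exp (-(x * (Complex.exp w * A)) - ((x ^ σ : ℝ) : ℂ) * Complex.exp (σ * w)) *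
        (-(x * (Complex.exp w * A)) - ((x ^ σ : ℝ) : ℂ) * (Complex.exp (σ * w) * σ))) := by
      funext x
      have h1 : HasDerivAt (fun w : ℂ => -(x * (Complex.exp w * A)) -
          ((x ^ σ : ℝ) : ℂ) * Complex.exp (σ * w)) (-(x * (Complex.exp w * A)) -
          ((x ^ σ : ℝ) : ℂ) * (Complex.exp (σ * w) * σ)) w := by
        have h2 : HasDerivAt (fun w : ℂ => (σ : ℂ) * w) σ w := by
          simpa using (hasDerivAt_id w).const_mul (σ : ℂ)
        exact ((((Complex.hasDerivAt_exp w).mul_const A).const_mul (x : ℂ)).neg).sub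
          (h2.cexp.const_mul _)
      exact (h1.cexp.const_mul _).deriv
    rw [this]
    fun_prop
  · intro g₀ hg₀
    have hg₀ : 0 < (Complex.exp (σ * g₀)).re := hg₀
    have h1 : ∀ᶠ g in 𝓝 g₀, (Complex.exp (σ * g₀)).re / 2 < (Complex.exp (σ * g)).re :=
      hcB.continuousAt.eventually (lt_mem_nhds (by linarith))
    have h2 : ∀ᶠ g in 𝓝 g₀, (Complex.exp g₀ * A).re - 1 < (Complex.exp g * A).re :=
      hcA.continuousAt.eventually (lt_mem_nhds (by linarith))
    obtain ⟨r, hr, hball⟩ := Metric.eventually_nhds_iff_ball.1 (h1.and h2)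
    refine ⟨r, hr, _, integrableOn_rpow_mul_exp hσ hs (-((Complex.exp g₀ * A).re - 1))
      (half_pos hg₀), ?_⟩
    filter_upwards [ae_restrict_mem measurableSet_Ioi] with x hx g hg
    have hx : 0 < x := hx
    rw [norm_momentInt_integrand σ s _ _ hx]
    have h3 := hball g hg
    have h4 := h3.1.le
    have h5 := h3.2.le
    gcongr

theorem eq_of_differentiableOn_strip {h : ℝ} (hh : 0 < h) {F : ℂ → ℂ} {c : ℂ}
    (hF : DifferentiableOn ℂ F {g | |g.im| < h}) (hreal : ∀ x : ℝ, F x = c) {g : ℂ}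
    (hg : |g.im| < h) : F g = c := by
  set U : Set ℂ := {g | |g.im| < h} with hUdef
  have hU : IsOpen U := isOpen_lt (by fun_prop) continuous_const
  have hconv : Convex ℝ U := by
    have : U = Complex.imLm ⁻¹' (Ioo (-h) h) := by
      ext g; simp [hUdef, abs_lt]
    rw [this]
    exact (convex_Ioo _ _).linear_preimage _
  have h0 : (0 : ℂ) ∈ U := by
    simp only [hUdef, mem_ofPred_eq, Complex.zero_im, abs_zero]; positivity
  refine AnalyticOnNhd.eqOn_of_preconnected_of_frequently_eq
    (hF.analyticOnNhd hU) (g := fun _ => c) analyticOnNhd_const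
    hconv.isPreconnected h0 ?_ hg
  have h1 : Tendsto (fun n : ℕ => (((1 / ((n : ℝ) + 1) : ℝ)) : ℂ)) atTop (𝓝[≠] 0) := by
    refine tendsto_nhdsWithin_iff.2 ⟨?_, Eventually.of_forall fun n => ?_⟩
    · have := (Complex.continuous_ofReal.tendsto 0).comp
        (tendsto_one_div_add_atTop_nhds_zero_nat (𝕜 := ℝ))
      simpa [Function.comp_def] using this
    · have : (0 : ℝ) < 1 / ((n : ℝ) + 1) := by positivity
      simp only [mem_compl_iff, mem_singleton_iff, Complex.ofReal_eq_zero]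
      exact this.ne'
  exact h1.frequently (Eventually.of_forall fun n => hreal _).frequently

theorem exp_re_pos {b : ℂ} (hb : |b.im| < Real.pi / 2) : 0 < (Complex.exp b).re := by
  rw [Complex.exp_re]
  exact mul_pos (Real.exp_pos _)
    (Real.cos_pos_of_mem_Ioo ⟨by linarith [(abs_lt.1 hb).1], (abs_lt.1 hb).2⟩)

/-- The right-hand side is holomorphic in g and constant on the real axis, hence constant on the
strip. This turns the ray of integration by Im g without a contour argument. Inside the strip
exp(-x^σ e^{σg}) still decays, and it beats the linear exponent because σ > 1. -/
theorem momentInt_rotate {σ : ℝ} (hσ : 1 < σ) {s : ℝ} (hs : -1 < s) (A : ℂ) {g : ℂ}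
    (hg : σ * |g.im| < Real.pi / 2) :
    momentInt σ s A 1 = Complex.exp ((s + 1) * g) *
      momentInt σ s (Complex.exp g * A) (Complex.exp (σ * g)) := by
  have hσ0 : 0 < σ := by linarith
  refine (eq_of_differentiableOn_strip (h := Real.pi / 2 / σ) (by positivity)
    (F := fun g : ℂ => Complex.exp ((s + 1) * g) *
      momentInt σ s (Complex.exp g * A) (Complex.exp (σ * g))) ?_ ?_ ?_).symm
  · refine (Differentiable.differentiableOn (by fun_prop)).mul
      ((differentiableOn_momentInt_rotated hσ hs A).mono fun g hg => exp_re_pos ?_)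
    have hg : |g.im| < Real.pi / 2 / σ := hg
    rw [lt_div_iff₀ hσ0] at hg
    rw [Complex.im_ofReal_mul, abs_mul, abs_of_pos hσ0]
    linarith
  · intro x
    have := momentInt_real_scale σ s A 1 x
    rw [mul_one] at this
    exact this.symm
  · rw [lt_div_iff₀ hσ0]; linarith

theorem norm_exp_sub_taylor_le (N : ℕ) : ∃ K > 0, ∀ u : ℂ, u.re ≤ 0 →
    ‖Complex.exp u - ∑ j ∈ Finset.range N, u ^ j / (j.factorial : ℂ)‖ ≤ K * ‖u‖ ^ N := by
  have hS : ∀ v : ℝ, 0 ≤ v → ∑ j ∈ Finset.range N, v ^ j / (j.factorial : ℝ) ≤ Real.exp v :=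
    fun v hv => Real.sum_le_exp_of_nonneg hv N
  -- The first two summands serve ‖u‖ ≥ 1, where the exponential is at most 1 and the Taylor
  -- polynomial at most e‖u‖^N; the last serves ‖u‖ ≤ 1.
  refine ⟨1 + Real.exp 1 + ((N.succ : ℝ) * ((N.factorial : ℝ) * N)⁻¹), by positivity, fun u hu => ?_⟩
  have hE : (0 : ℝ) ≤ (N.succ : ℝ) * ((N.factorial : ℝ) * N)⁻¹ := by positivity
  rcases le_total ‖u‖ 1 with h | h
  · rcases Nat.eq_zero_or_pos N with rfl | hN
    · simp only [Finset.range_zero, Finset.sum_empty, sub_zero, pow_zero, mul_one]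
      have : ‖Complex.exp u‖ ≤ 1 := by
        rw [Complex.norm_exp]; exact Real.exp_le_one_iff.2 hu
      have := Real.exp_pos 1
      linarith
    · refine (Complex.exp_bound h hN).trans ?_
      rw [mul_comm]
      have := Real.exp_pos 1
      gcongr
      linarith
  · have h1 : ‖Complex.exp u‖ ≤ 1 := by
      rw [Complex.norm_exp]; exact Real.exp_le_one_iff.2 hu
    have h2 : ‖∑ j ∈ Finset.range N, u ^ j / (j.factorial : ℂ)‖ ≤ Real.exp 1 * ‖u‖ ^ N := by
      refine (norm_sum_le _ _).trans (le_trans ?_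
        (mul_le_mul_of_nonneg_right (hS 1 zero_le_one) (by positivity)))
      rw [Finset.sum_mul]
      refine Finset.sum_le_sum fun j hj => ?_
      rw [norm_div, norm_pow, Complex.norm_natCast, one_pow, div_mul_eq_mul_div, one_mul]
      gcongr
      exact (Finset.mem_range.1 hj).le
    have h3 : 1 ≤ ‖u‖ ^ N := one_le_pow₀ h
    calc _ ≤ ‖Complex.exp u‖ + ‖∑ j ∈ Finset.range N, u ^ j / (j.factorial : ℂ)‖ := norm_sub_le _ _
      _ ≤ 1 * ‖u‖ ^ N + Real.exp 1 * ‖u‖ ^ N := by linarith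
      _ ≤ _ := by
        rw [← add_mul]
        exact mul_le_mul_of_nonneg_right (by linarith) (by positivity)

theorem integrableOn_rpow_mul_cexp {s : ℝ} (hs : -1 < s) {c : ℂ} (hc : 0 < c.re) :
    IntegrableOn (fun x : ℝ => ((x ^ s : ℝ) : ℂ) * Complex.exp (-(x * c))) (Ioi 0) := by
  have h := integrableOn_rpow_mul_exp_neg_mul_rpow hs one_pos hc
  refine Integrable.mono' h (by fun_prop) ?_
  filter_upwards [ae_restrict_mem measurableSet_Ioi] with x hx
  have hx : 0 < x := hx
  rw [norm_mul, Complex.norm_exp, Complex.norm_real, Real.norm_of_nonneg (by positivity)]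
  gcongr
  simp
  linarith

theorem differentiableOn_integral_rpow_mul_cexp {s : ℝ} (hs : -1 < s) :
    DifferentiableOn ℂ
      (fun b : ℂ => ∫ x in Ioi (0 : ℝ), ((x ^ s : ℝ) : ℂ) * Complex.exp (-(x * Complex.exp b)))
      {b | 0 < (Complex.exp b).re} := by
  have hcB : Continuous fun g : ℂ => (Complex.exp g).re := by fun_prop
  refine differentiableOn_integral_of_dominated (isOpen_lt continuous_const hcB) ?_ ?_ ?_ ?_
  · exact fun w _ => by fun_prop
  · exact Eventually.of_forall fun x => by fun_prop
  · intro w _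
    have : (fun x : ℝ => deriv (fun w : ℂ => ((x ^ s : ℝ) : ℂ) *
        Complex.exp (-(x * Complex.exp w))) w) =
        fun x : ℝ => ((x ^ s : ℝ) : ℂ) * (Complex.exp (-(x * Complex.exp w)) *
        (-(x * Complex.exp w))) := by
      funext x
      exact ((((Complex.hasDerivAt_exp w).const_mul (x : ℂ)).neg).cexp.const_mul _).deriv
    rw [this]
    fun_prop
  · intro g₀ hg₀
    have hg₀ : 0 < (Complex.exp g₀).re := hg₀
    have h1 : ∀ᶠ g in 𝓝 g₀, (Complex.exp g₀).re / 2 < (Complex.exp g).re :=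
      hcB.continuousAt.eventually (lt_mem_nhds (by linarith))
    obtain ⟨r, hr, hball⟩ := Metric.eventually_nhds_iff_ball.1 h1
    refine ⟨r, hr, _, integrableOn_rpow_mul_exp_neg_mul_rpow hs one_pos (half_pos hg₀), ?_⟩
    filter_upwards [ae_restrict_mem measurableSet_Ioi] with x hx g hg
    have hx : 0 < x := hx
    rw [norm_mul, Complex.norm_exp, Complex.norm_real, Real.norm_of_nonneg (by positivity),
      Complex.neg_re, Complex.re_ofReal_mul, Real.rpow_one, neg_mul, mul_comm x (Complex.re _)]
    have h4 := (hball g hg).le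
    gcongr

/-- Euler's integral on the real axis, extended to the strip where Re e^b > 0 by the identity
theorem. -/
theorem integral_rpow_mul_cexp {s : ℝ} (hs : -1 < s) {b : ℂ} (hb : |b.im| < Real.pi / 2) :
    ∫ x in Ioi (0 : ℝ), ((x ^ s : ℝ) : ℂ) * Complex.exp (-(x * Complex.exp b)) =
      Complex.exp (-(s + 1) * b) * Complex.Gamma (s + 1) := by
  have key := eq_of_differentiableOn_strip (h := Real.pi / 2) (by positivity)
    (F := fun b : ℂ => Complex.exp ((s + 1) * b) *
      ∫ x in Ioi (0 : ℝ), ((x ^ s : ℝ) : ℂ) * Complex.exp (-(x * Complex.exp b)))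
    (c := Complex.Gamma (s + 1)) ?_ ?_ hb
  · rw [← key, ← mul_assoc, ← Complex.exp_add, neg_mul, neg_add_cancel, Complex.exp_zero, one_mul]
  · exact (Differentiable.differentiableOn (by fun_prop)).mul
      ((differentiableOn_integral_rpow_mul_cexp hs).mono fun b hb => exp_re_pos hb)
  · intro t
    have h := Real.integral_rpow_mul_exp_neg_mul_Ioi (a := s + 1) (r := Real.exp t) (by linarith)
      (Real.exp_pos t)
    have h2 := congrArg (fun v : ℝ => (v : ℂ)) h
    simp only [← integral_complex_ofReal] at h2
    have h3 : ∫ x in Ioi (0 : ℝ), ((x ^ s : ℝ) : ℂ) * Complex.exp (-(x * Complex.exp t)) =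
        ∫ x in Ioi (0 : ℝ), ((x ^ (s + 1 - 1) * Real.exp (-(Real.exp t * x)) : ℝ) : ℂ) := by
      refine setIntegral_congr_fun measurableSet_Ioi fun x hx => ?_
      simp only [add_sub_cancel_right]
      push_cast
      rw [mul_comm (Complex.exp (t : ℂ))]
    rw [h3, h2, one_div, ← Real.exp_neg, ← Real.exp_mul]
    push_cast
    rw [← Complex.ofReal_one, ← Complex.ofReal_add, Complex.Gamma_ofReal, ← mul_assoc,
      ← Complex.exp_add]
    have : (((s + 1 : ℝ) : ℂ)) * t + -t * (((s + 1 : ℝ) : ℂ)) = 0 := by ring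
    rw [this, Complex.exp_zero, one_mul]

/-- The asymptotic expansion of `A ^ (s + 1) ∫₀^∞ x ^ s exp (-x A - x ^ σ) dx`, `A = e ^ a`, in the
sectors `|arg A| ≤ π / 2 (1 + 1 / σ) - η`. -/
theorem momentInt_asymptotic {σ : ℝ} (hσ : 1 < σ) {s : ℝ} (hs : -1 < s) (N : ℕ) {η : ℝ}
    (hη : 0 < η) : ∃ K > 0, ∀ a : ℂ, |a.im| ≤ Real.pi / 2 * (1 + 1 / σ) - η →
    ‖Complex.exp ((s + 1) * a) * momentInt σ s (Complex.exp a) 1 -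
      ∑ j ∈ Finset.range N, (-1) ^ j / (j.factorial : ℂ) * Complex.Gamma (s + σ * j + 1) *
        Complex.exp (-(σ * j * a))‖ ≤ K * Real.exp (-(σ * N * a.re)) := by
  obtain ⟨K₀, hK₀, hT⟩ := norm_exp_sub_taylor_le N
  have hσ0 : 0 < σ := by linarith
  have hσ1 : (0 : ℝ) < σ + 1 := by linarith
  set η' := min (η * σ / (σ + 1)) (Real.pi / 2) with hη'
  have hη'0 : 0 < η' := lt_min (by positivity) (by positivity)
  set c := Real.sin η' with hc
  have hc0 : 0 < c := Real.sin_pos_of_pos_of_lt_pi hη'0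
    ((min_le_right _ _).trans_lt (by linarith [Real.pi_pos]))
  have hsN : 0 < s + σ * N + 1 := by have : 0 ≤ σ * N := by positivity
                                     linarith
  refine ⟨K₀ * ((1 / c) ^ (s + σ * N + 1) * Real.Gamma (s + σ * N + 1)),
    mul_pos hK₀ (mul_pos (by positivity) (Real.Gamma_pos_of_pos hsN)), fun a ha => ?_⟩
  -- The angle of A is shared out so that exp(-x e^b) and exp(-x^σ e^{σg}) have the same angle up to
  -- sign, σ a.im/(σ+1). It is below π/2 exactly for |arg A| < π/2 (1 + 1/σ), which is the origin of
  -- this opening.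
  set g : ℂ := -((a.im / (σ + 1) : ℝ) : ℂ) * Complex.I with hg
  have hgim : g.im = -(a.im / (σ + 1)) := by
    rw [hg, Complex.mul_I_im, Complex.neg_re, Complex.ofReal_re]
  have hgre : g.re = 0 := by
    rw [hg, Complex.mul_I_re, Complex.neg_im, Complex.ofReal_im]; simp
  have ha' : |a.im| * σ / (σ + 1) ≤ Real.pi / 2 - η * σ / (σ + 1) := by
    rw [div_le_iff₀ hσ1]
    have : (Real.pi / 2 * (1 + 1 / σ) - η) * σ = (Real.pi / 2 - η * σ / (σ + 1)) * (σ + 1) := by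
      field_simp
    rw [← this]; gcongr
  have hησ : 0 < η * σ / (σ + 1) := by positivity
  have hrot : σ * |g.im| < Real.pi / 2 := by
    rw [hgim, abs_neg, abs_div, abs_of_pos hσ1]
    calc σ * (|a.im| / (σ + 1)) = |a.im| * σ / (σ + 1) := by ring
      _ < _ := by linarith
  set b : ℂ := g + a with hb
  have hbim : |b.im| ≤ Real.pi / 2 - η' := by
    have : b.im = a.im * σ / (σ + 1) := by
      simp only [hb, Complex.add_im, hgim]; field_simp; ring
    rw [this, abs_div, abs_mul, abs_of_pos hσ1, abs_of_pos hσ0]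
    exact ha'.trans (by linarith [min_le_left (η * σ / (σ + 1)) (Real.pi / 2)])
  have hbre : b.re = a.re := by simp [hb, hgre]
  have hB : 0 < (Complex.exp (σ * g)).re := by
    refine exp_re_pos ?_
    rwa [Complex.im_ofReal_mul, abs_mul, abs_of_pos hσ0]
  have hBn : ‖Complex.exp (σ * g)‖ = 1 := by
    rw [Complex.norm_exp]; simp [hgre]
  have hbc : c * Real.exp a.re ≤ (Complex.exp b).re := by
    rw [Complex.exp_re, hbre, mul_comm]
    gcongr
    rw [hc, ← Real.cos_pi_div_two_sub, ← Real.cos_abs b.im]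
    exact Real.cos_le_cos_of_nonneg_of_le_pi (abs_nonneg _) (by linarith [Real.pi_pos]) hbim
  have hexp0 := Real.exp_pos a.re
  have hbre0 : 0 < (Complex.exp b).re := lt_of_lt_of_le (by positivity) hbc
  have hbpi : |b.im| < Real.pi / 2 := by linarith
  -- rotation
  rw [momentInt_rotate hσ hs (Complex.exp a) hrot, ← Complex.exp_add, ← hb, ← mul_assoc,
    ← Complex.exp_add, ← mul_add, add_comm a g, ← hb]
  -- main terms
  have hmain : ∀ j : ℕ, (-1) ^ j / (j.factorial : ℂ) * Complex.Gamma (s + σ * j + 1) *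
        Complex.exp (-(σ * j * a)) = Complex.exp ((s + 1) * b) *
      ∫ x in Ioi (0 : ℝ), ((x ^ s : ℝ) : ℂ) * Complex.exp (-(x * Complex.exp b)) *
        ((-(((x ^ σ : ℝ) : ℂ) * Complex.exp (σ * g))) ^ j / (j.factorial : ℂ)) := by
    intro j
    have h1 := integral_rpow_mul_cexp (s := s + σ * j)
      (by have : 0 ≤ σ * j := by positivity
          linarith) hbpi
    have h2 : ∀ x ∈ Ioi (0 : ℝ), ((x ^ s : ℝ) : ℂ) * Complex.exp (-(x * Complex.exp b)) *
        ((-(((x ^ σ : ℝ) : ℂ) * Complex.exp (σ * g))) ^ j / (j.factorial : ℂ)) =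
        ((-1) ^ j / (j.factorial : ℂ) * Complex.exp (σ * j * g)) *
        (((x ^ (s + σ * j) : ℝ) : ℂ) * Complex.exp (-(x * Complex.exp b))) := by
      intro x hx
      have hx : 0 < x := hx
      rw [Real.rpow_add hx, Real.rpow_mul hx.le, Real.rpow_natCast, neg_pow, mul_pow,
        ← Complex.exp_nat_mul, mul_left_comm ((j : ℂ)), ← mul_assoc (σ : ℂ)]
      push_cast
      ring
    rw [setIntegral_congr_fun measurableSet_Ioi h2, integral_const_mul, h1]
    push_cast
    have h3 : Complex.exp (-(σ * j * a)) = Complex.exp ((s + 1) * b) *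
        (Complex.exp (σ * j * g) * Complex.exp (-((s : ℂ) + σ * j + 1) * b)) := by
      rw [← Complex.exp_add, ← Complex.exp_add]
      congr 1
      rw [hb]; ring
    rw [h3]; ring
  have hint : ∀ j : ℕ, IntegrableOn (fun x : ℝ => ((x ^ s : ℝ) : ℂ) *
      Complex.exp (-(x * Complex.exp b)) *
        ((-(((x ^ σ : ℝ) : ℂ) * Complex.exp (σ * g))) ^ j / (j.factorial : ℂ))) (Ioi 0) := by
    intro j
    have h1 := (integrableOn_rpow_mul_cexp (s := s + σ * j)
      (by have : 0 ≤ σ * j := by positivity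
          linarith) hbre0).const_mul ((-1) ^ j / (j.factorial : ℂ) * Complex.exp (σ * j * g))
    refine IntegrableOn.congr_fun h1 (fun x hx => ?_) measurableSet_Ioi
    have hx : 0 < x := hx
    rw [Real.rpow_add hx, Real.rpow_mul hx.le, Real.rpow_natCast, neg_pow (((x ^ σ : ℝ) : ℂ) * _), mul_pow,
      ← Complex.exp_nat_mul, mul_left_comm ((j : ℂ)), ← mul_assoc (σ : ℂ)]
    push_cast
    ring
  rw [Finset.sum_congr rfl fun j _ => hmain j, ← Finset.mul_sum, ← mul_sub,
    ← integral_finsetSum _ fun j _ => hint j, momentInt, ← integral_sub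
    (integrableOn_momentInt hσ hs _ hB) (integrable_finsetSum _ fun j _ => hint j), norm_mul]
  -- Only exp(-x^σ e^{σg}) is expanded: its exponent has nonpositive real part, so the Taylor
  -- remainder is bounded by a power without an exponential factor.
  have hbd : ∀ᵐ x ∂(volume.restrict (Ioi (0 : ℝ))),
      ‖((x ^ s : ℝ) : ℂ) * Complex.exp (-(x * Complex.exp b) - ((x ^ σ : ℝ) : ℂ) *
        Complex.exp (σ * g)) - ∑ j ∈ Finset.range N, ((x ^ s : ℝ) : ℂ) *
      Complex.exp (-(x * Complex.exp b)) *
        ((-(((x ^ σ : ℝ) : ℂ) * Complex.exp (σ * g))) ^ j / (j.factorial : ℂ))‖ ≤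
      K₀ * (x ^ (s + σ * N + 1 - 1) * Real.exp (-(c * Real.exp a.re * x))) := by
    filter_upwards [ae_restrict_mem measurableSet_Ioi] with x hx
    have hx : 0 < x := hx
    rw [← Finset.mul_sum, sub_eq_add_neg (-(_ * _)), Complex.exp_add, ← mul_assoc, ← mul_sub,
      norm_mul, norm_mul, Complex.norm_exp, Complex.norm_real, Real.norm_of_nonneg (by positivity)]
    have h1 := hT (-(((x ^ σ : ℝ) : ℂ) * Complex.exp (σ * g))) (by
      rw [Complex.neg_re, Complex.re_ofReal_mul]
      have : 0 ≤ x ^ σ * (Complex.exp (σ * g)).re := by positivity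
      linarith)
    rw [norm_neg, norm_mul, hBn, mul_one, Complex.norm_real,
      Real.norm_of_nonneg (by positivity)] at h1
    have h2 : (-(x * Complex.exp b)).re ≤ -(c * Real.exp a.re * x) := by
      rw [Complex.neg_re, Complex.re_ofReal_mul]
      nlinarith
    calc _ ≤ x ^ s * Real.exp (-(c * Real.exp a.re * x)) * (K₀ * (x ^ σ) ^ N) := by gcongr
      _ = _ := by
        rw [add_sub_cancel_right, Real.rpow_add hx, Real.rpow_mul hx.le, Real.rpow_natCast]; ring
  have hgam := Real.integral_rpow_mul_exp_neg_mul_Ioi hsN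
    (by positivity : 0 < c * Real.exp a.re)
  have hle := norm_integral_le_of_norm_le (((integrableOn_rpow_mul_exp_neg_mul_rpow
    (by linarith : -1 < s + σ * N + 1 - 1) one_pos (by positivity : 0 < c * Real.exp a.re)).congr_fun
      (fun x _ => by simp only [Real.rpow_one, neg_mul]) measurableSet_Ioi).const_mul K₀) hbd
  rw [integral_const_mul, hgam] at hle
  refine (mul_le_mul_of_nonneg_left hle (norm_nonneg _)).trans (le_of_eq ?_)
  rw [Complex.norm_exp]
  have h5 : (((s : ℂ) + 1) * b).re = (s + 1) * a.re := by
    rw [← hbre]; simp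
  have h6 : (1 / (c * Real.exp a.re)) ^ (s + σ * N + 1) =
      (1 / c) ^ (s + σ * N + 1) * Real.exp (-(s + σ * N + 1) * a.re) := by
    rw [one_div, mul_inv, ← one_div, Real.mul_rpow (by positivity) (by positivity),
      ← Real.exp_neg, ← Real.exp_mul]
    ring_nf
  have h7 : Real.exp (-(σ * N * a.re)) = Real.exp ((s + 1) * a.re) *
      Real.exp (-(s + σ * N + 1) * a.re) := by
    rw [← Real.exp_add]; ring_nf
  rw [h5, h6, h7]
  ring

/-- The derivative of x^{s+1} exp(-xA - x^σ) has integral zero. The identity is what closes the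
recursion for the time derivatives of `rayTerm`. -/
theorem momentInt_integration_by_parts {σ : ℝ} (hσ : 1 < σ) {s : ℝ} (hs : -1 < s) (A : ℂ) :
    (s + 1) * momentInt σ s A 1 = A * momentInt σ (s + 1) A 1 + σ * momentInt σ (s + σ) A 1 := by
  have hσ0 : 0 < σ := by linarith
  have h1 : (0 : ℝ) < (1 : ℂ).re := by simp
  have hI0 := (integrableOn_momentInt hσ hs A h1).const_mul ((s : ℂ) + 1)
  have hI1 := (integrableOn_momentInt hσ (by linarith : -1 < s + 1) A h1).const_mul A
  have hI2 := (integrableOn_momentInt hσ (by linarith : -1 < s + σ) A h1).const_mul (σ : ℂ)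
  set f : ℝ → ℂ := fun x => ((x ^ (s + 1) : ℝ) : ℂ) * Complex.exp (-(x * A) - ((x ^ σ : ℝ) : ℂ) * 1)
    with hf
  have hlim : Tendsto f atTop (𝓝 0) := by
    rw [tendsto_zero_iff_norm_tendsto_zero]
    obtain ⟨K, hK⟩ := linear_le_rpow hσ (-A.re + 1) one_pos
    have h2 : Tendsto (fun x : ℝ => Real.exp K * (x ^ (s + 1) * Real.exp (-1 * x))) atTop (𝓝 0) := by
      simpa using (tendsto_rpow_mul_exp_neg_mul_atTop_nhds_zero (s + 1) 1 one_pos).const_mul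
        (Real.exp K)
    refine squeeze_zero' (Eventually.of_forall fun _ => norm_nonneg _) ?_ h2
    filter_upwards [eventually_gt_atTop 0] with x hx
    rw [hf, norm_momentInt_integrand σ (s + 1) A 1 hx, mul_left_comm, ← Real.exp_add]
    gcongr
    have := hK x hx
    simp only [Complex.one_re]
    linarith
  have hcont : ContinuousWithinAt f (Ici 0) 0 := by
    have c1 : ContinuousAt (fun x : ℝ => x ^ (s + 1)) 0 :=
      Real.continuousAt_rpow_const _ _ (Or.inr (by linarith))
    have c2 : ContinuousAt (fun x : ℝ => x ^ σ) 0 :=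
      Real.continuousAt_rpow_const _ _ (Or.inr hσ0.le)
    have : ContinuousAt f 0 := by
      refine (Complex.continuous_ofReal.continuousAt.comp c1).mul ?_
      refine Complex.continuous_exp.continuousAt.comp ?_
      refine ContinuousAt.sub (by fun_prop) ?_
      exact (Complex.continuous_ofReal.continuousAt.comp c2).mul continuousAt_const
    exact this.continuousWithinAt
  have hder : ∀ x ∈ Ioi (0 : ℝ), HasDerivAt f
      (((s : ℂ) + 1) * (((x ^ s : ℝ) : ℂ) * Complex.exp (-(x * A) - ((x ^ σ : ℝ) : ℂ) * 1)) -
        A * (((x ^ (s + 1) : ℝ) : ℂ) * Complex.exp (-(x * A) - ((x ^ σ : ℝ) : ℂ) * 1)) -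
        σ * (((x ^ (s + σ) : ℝ) : ℂ) * Complex.exp (-(x * A) - ((x ^ σ : ℝ) : ℂ) * 1))) x := by
    intro x hx
    have hx : 0 < x := hx
    have d1 : HasDerivAt (fun x : ℝ => x ^ (s + 1)) ((s + 1) * x ^ s) x := by
      simpa using Real.hasDerivAt_rpow_const (p := s + 1) (Or.inl hx.ne')
    have d2 : HasDerivAt (fun x : ℝ => x ^ σ) (σ * x ^ (σ - 1)) x :=
      Real.hasDerivAt_rpow_const (Or.inl hx.ne')
    have d3 : HasDerivAt (fun x : ℝ => -((x : ℂ) * A) - ((x ^ σ : ℝ) : ℂ) * 1)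
        (-(((1 : ℝ) : ℂ) * A) - ((σ * x ^ (σ - 1) : ℝ) : ℂ) * 1) x :=
      (((hasDerivAt_id x).ofReal_comp.mul_const A).neg).sub (d2.ofReal_comp.mul_const 1)
    convert! d1.ofReal_comp.mul d3.cexp using 1
    have e1 : x ^ (s + 1) = x ^ s * x := Real.rpow_add_one hx.ne' s
    have e2 : x ^ (s + σ) = x ^ s * x * x ^ (σ - 1) := by
      rw [← Real.rpow_add_one hx.ne', ← Real.rpow_add hx]; ring_nf
    rw [e1, e2]
    push_cast
    ring
  have hfin := integral_Ioi_of_hasDerivAt_of_tendsto hcont hder ((hI0.sub hI1).sub hI2) hlim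
  have hf0 : f 0 = 0 := by
    simp [hf, Real.zero_rpow (by linarith : s + 1 ≠ 0)]
  have e1 := integral_sub (hI0.sub hI1) hI2
  have e2 := integral_sub hI0 hI1
  simp only [Pi.sub_apply] at e1 e2
  rw [hf0, sub_zero, e1, e2, integral_const_mul, integral_const_mul, integral_const_mul] at hfin
  unfold momentInt
  linear_combination hfin

/-- Expand exp(-xA) under the integral sign: the moments of exp(-x^σ) are values of Γ, and the
series with ‖A‖ in place of -A supplies the dominating function. -/
theorem hasSum_momentInt_zero {σ : ℝ} (hσ : 1 < σ) (A : ℂ) :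
    HasSum (fun n : ℕ => (-A) ^ n / (n.factorial : ℂ) *
      (1 / σ * Complex.Gamma (((n : ℂ) + 1) / σ))) (momentInt σ 0 A 1) := by
  have hσ0 : 0 < σ := by linarith
  have hmom : ∀ n : ℕ, ∫ x in Ioi (0 : ℝ), ((x ^ n * Real.exp (-x ^ σ) : ℝ) : ℂ) =
      1 / σ * Complex.Gamma (((n : ℂ) + 1) / σ) := by
    intro n
    have h := integral_rpow_mul_exp_neg_rpow hσ0 (q := n) (by linarith [n.cast_nonneg (α := ℝ)])
    rw [integral_complex_ofReal]
    simp only [Real.rpow_natCast] at h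
    rw [h]
    push_cast
    rw [← Complex.Gamma_ofReal]
    push_cast
    ring_nf
  have h := hasSum_integral_of_dominated_convergence (μ := volume.restrict (Ioi (0 : ℝ)))
    (F := fun (n : ℕ) (x : ℝ) => (-A) ^ n / (n.factorial : ℂ) *
      ((x ^ n * Real.exp (-x ^ σ) : ℝ) : ℂ))
    (f := fun x : ℝ => ((x ^ (0 : ℝ) : ℝ) : ℂ) *
      Complex.exp (-(x * A) - ((x ^ σ : ℝ) : ℂ) * 1))
    (fun (n : ℕ) (x : ℝ) => (‖A‖ * x) ^ n / (n.factorial : ℝ) * Real.exp (-x ^ σ)) ?_ ?_ ?_ ?_ ?_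
  · unfold momentInt
    convert! h using 2 with n
    rw [integral_const_mul, hmom]
  · exact fun n => by fun_prop
  · intro n
    filter_upwards [ae_restrict_mem measurableSet_Ioi] with x hx
    have hx : 0 < x := hx
    rw [norm_mul, norm_div, norm_pow, norm_neg, Complex.norm_natCast, Complex.norm_real,
      Real.norm_of_nonneg (by positivity)]
    apply le_of_eq; ring
  · filter_upwards with x
    exact (Real.summable_pow_div_factorial _).mul_right _
  · have h2 := integrableOn_rpow_mul_exp hσ (s := 0) (by norm_num) ‖A‖ one_pos
    refine IntegrableOn.congr_fun h2 (fun x hx => ?_) measurableSet_Ioi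
    have hx : 0 < x := hx
    rw [tsum_mul_right, Real.rpow_zero, one_mul, one_mul, sub_eq_add_neg, Real.exp_add]
    congr 1
    rw [Real.exp_eq_exp_ℝ, NormedSpace.exp_eq_tsum_div]
  · filter_upwards [ae_restrict_mem measurableSet_Ioi] with x hx
    have hx : 0 < x := hx
    have h1 : HasSum (fun n : ℕ => (-(x * A)) ^ n / (n.factorial : ℂ)) (Complex.exp (-(x * A))) := by
      rw [Complex.exp_eq_exp_ℂ]
      exact NormedSpace.expSeries_div_hasSum_exp _
    have h2 := h1.mul_right (Complex.exp (-((x ^ σ : ℝ) : ℂ)))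
    convert! h2 using 1
    · funext n
      push_cast
      rw [neg_mul_eq_mul_neg, mul_pow]
      ring
    · rw [Real.rpow_zero, Complex.ofReal_one, one_mul, mul_one, sub_eq_add_neg, Complex.exp_add]

theorem differentiable_momentInt {σ : ℝ} (hσ : 1 < σ) {s : ℝ} (hs : -1 < s) :
    Differentiable ℂ fun A => momentInt σ s A 1 := fun A =>
  (hasDerivAt_momentInt hσ hs A (by simp)).differentiableAt

/-! ### The kernel C_σ as an integral. -/

/-- The kernel `C_σ` as an integral over two rays. -/
theorem kernelC_eq {σ : ℝ} (hσ : 1 < σ) (τ : ℂ) :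
    kernelC σ τ = σ / (2 * Real.pi * Complex.I) *
      (Complex.exp (Real.pi / σ * Complex.I) *
          momentInt σ 0 (τ * Complex.exp (Real.pi / σ * Complex.I)) 1 -
        Complex.exp (-(Real.pi / σ * Complex.I)) *
          momentInt σ 0 (τ * Complex.exp (-(Real.pi / σ * Complex.I))) 1) := by
  have hσ0 : (σ : ℂ) ≠ 0 := by exact_mod_cast (by linarith : σ ≠ 0)
  have hπ : (Real.pi : ℂ) ≠ 0 := by exact_mod_cast Real.pi_ne_zero
  have h1 := (hasSum_momentInt_zero hσ
    (τ * Complex.exp (Real.pi / σ * Complex.I))).mul_left (Complex.exp (Real.pi / σ * Complex.I))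
  have h2 := (hasSum_momentInt_zero hσ (τ * Complex.exp (-(Real.pi / σ * Complex.I)))).mul_left
    (Complex.exp (-(Real.pi / σ * Complex.I)))
  have h3 := (h1.sub h2).mul_left (σ / (2 * Real.pi * Complex.I))
  rw [kernelC, ← h3.tsum_eq]
  refine tsum_congr fun n => ?_
  set s : ℂ := ((n : ℂ) + 1) / σ with hs
  have hrefl := Complex.Gamma_mul_Gamma_one_sub s
  -- Reflection formula. Where the sine vanishes, 1 - s is a pole of Γ; the conventional value 0 of
  -- Γ there makes both sides 0.
  have hinv : (Complex.Gamma (1 - s))⁻¹ = Complex.Gamma s * Complex.sin (Real.pi * s) / Real.pi := by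
    by_cases hsin : Complex.sin (Real.pi * s) = 0
    · have hG : Complex.Gamma (1 - s) = 0 := by
        rw [hsin, div_zero] at hrefl
        refine (mul_eq_zero.1 hrefl).resolve_left (Complex.Gamma_ne_zero_of_re_pos ?_)
        have : s = (((n : ℝ) + 1) / σ : ℝ) := by rw [hs]; push_cast; rfl
        rw [this, Complex.ofReal_re]
        have : 0 < σ := by linarith
        positivity
      rw [hG, hsin]; simp
    · have hne : Complex.Gamma (1 - s) ≠ 0 := by
        intro h0
        rw [h0, mul_zero] at hrefl
        exact (div_ne_zero hπ hsin) hrefl.symm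
      rw [eq_div_iff hsin] at hrefl
      rw [eq_div_iff hπ, inv_mul_eq_div, div_eq_iff hne]
      linear_combination -hrefl
  have e1 : ∀ u : ℂ, Complex.exp u * ((-(τ * Complex.exp u)) ^ n / (n.factorial : ℂ) *
      (1 / σ * Complex.Gamma s)) = Complex.exp ((n + 1) * u) *
      ((-τ) ^ n / (n.factorial : ℂ) * (1 / σ * Complex.Gamma s)) := by
    intro u
    rw [← neg_mul, mul_pow, ← Complex.exp_nat_mul, add_mul, one_mul, Complex.exp_add]
    ring
  rw [e1, e1, ← sub_mul, hinv]
  have e2 : Complex.exp ((n + 1) * (Real.pi / σ * Complex.I)) -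
      Complex.exp ((n + 1) * -(Real.pi / σ * Complex.I)) =
      2 * Complex.I * Complex.sin (Real.pi * s) := by
    rw [Complex.sin]
    have a1 : -(Real.pi * s) * Complex.I = (n + 1) * -(Real.pi / σ * Complex.I) := by
      rw [hs]; ring
    have a2 : (Real.pi * s) * Complex.I = (n + 1) * (Real.pi / σ * Complex.I) := by
      rw [hs]; ring
    rw [a1, a2]
    linear_combination (Complex.exp ((n + 1) * (Real.pi / σ * Complex.I)) -
      Complex.exp ((n + 1) * -(Real.pi / σ * Complex.I))) * Complex.I_sq
  rw [e2]
  have := Complex.I_ne_zero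
  field_simp

theorem differentiable_kernelC {σ : ℝ} (hσ : 1 < σ) : Differentiable ℂ (kernelC σ) := by
  have h0 := differentiable_momentInt hσ (s := 0) (by norm_num)
  have : kernelC σ = fun τ => σ / (2 * Real.pi * Complex.I) *
      (Complex.exp (Real.pi / σ * Complex.I) *
          momentInt σ 0 (τ * Complex.exp (Real.pi / σ * Complex.I)) 1 -
        Complex.exp (-(Real.pi / σ * Complex.I)) *
          momentInt σ 0 (τ * Complex.exp (-(Real.pi / σ * Complex.I))) 1) :=
    funext (kernelC_eq hσ)
  rw [this]
  exact (((h0.comp (differentiable_id.mul_const _)).const_mul _).sub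
    ((h0.comp (differentiable_id.mul_const _)).const_mul _)).const_mul _

/-! ### Logarithmic coordinates, contour deformation and decay of the kernel. -/

theorem image_exp_mul_univ {a : ℝ} (ha : a ≠ 0) :
    (fun t : ℝ => Real.exp (a * t)) '' univ = Ioi 0 := by
  ext x
  simp only [image_univ, mem_range, mem_Ioi]
  refine ⟨fun ⟨t, ht⟩ => ht ▸ Real.exp_pos _, fun hx => ⟨Real.log x / a, ?_⟩⟩
  rw [mul_div_cancel₀ _ ha, Real.exp_log hx]

theorem hasDerivAt_exp_mul (a t : ℝ) :
    HasDerivAt (fun t : ℝ => Real.exp (a * t)) (a * Real.exp (a * t)) t := by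
  have := ((hasDerivAt_id t).const_mul a).exp
  convert! this using 1
  simp only [id, mul_one]
  ring

theorem injective_exp_mul {a : ℝ} (ha : a ≠ 0) :
    Function.Injective fun t : ℝ => Real.exp (a * t) := fun _ _ h =>
  mul_left_cancel₀ ha (Real.exp_injective h)

/-- Substitution `x = e ^ (a t)` in an integral over the positive half-line. -/
theorem integral_Ioi_eq_integral_exp {a : ℝ} (ha : a ≠ 0) (f : ℝ → ℂ) :
    ∫ x in Ioi (0 : ℝ), f x = ∫ t : ℝ, (|a| * Real.exp (a * t)) • f (Real.exp (a * t)) := by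
  rw [← image_exp_mul_univ ha, integral_image_eq_integral_abs_deriv_smul MeasurableSet.univ
    (fun t _ => (hasDerivAt_exp_mul a t).hasDerivWithinAt) (injective_exp_mul ha).injOn,
    Measure.restrict_univ]
  simp only [abs_mul, Real.abs_exp]

theorem integrableOn_Ioi_iff_integrable_exp {a : ℝ} (ha : a ≠ 0) (f : ℝ → ℂ) :
    IntegrableOn f (Ioi (0 : ℝ)) ↔
      Integrable fun t : ℝ => (|a| * Real.exp (a * t)) • f (Real.exp (a * t)) := by
  rw [← image_exp_mul_univ ha, integrableOn_image_iff_integrableOn_abs_deriv_smul MeasurableSet.univ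
    (fun t _ => (hasDerivAt_exp_mul a t).hasDerivWithinAt) (injective_exp_mul ha).injOn,
    integrableOn_univ]
  simp only [abs_mul, Real.abs_exp]

/-- Half of the exponential decay absorbs a power; it removes the radius factor that the arc
contributes in `kernelC_decay`. -/
theorem one_add_rpow_mul_exp_le {σ : ℝ} (hσ : 1 < σ) :
    ∀ c > 0, ∃ K > 0, ∀ x > 0, (1 + x ^ (1 / (σ - 1))) * Real.exp (-(c * x ^ (σ / (σ - 1)))) ≤
      K * Real.exp (-(c / 2 * x ^ (σ / (σ - 1)))) := by
  intro c hc
  refine ⟨2 + 2 / c, by positivity, fun x hx => ?_⟩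
  set y := x ^ (σ / (σ - 1)) with hy
  have hy0 : 0 < y := by positivity
  have h1 : x ^ (1 / (σ - 1)) ≤ 1 + y := by
    rcases le_total x 1 with h | h
    · have := Real.rpow_le_one hx.le h (by
        have : 0 < σ - 1 := by linarith
        positivity : 0 ≤ 1 / (σ - 1))
      linarith
    · have : x ^ (1 / (σ - 1)) ≤ y := by
        refine Real.rpow_le_rpow_of_exponent_le h ?_
        have : 0 < σ - 1 := by linarith
        gcongr
      linarith
  have h2 : c / 2 * y + 1 ≤ Real.exp (c / 2 * y) := Real.add_one_le_exp _
  have h3 : (1 + x ^ (1 / (σ - 1))) ≤ (2 + 2 / c) * Real.exp (c / 2 * y) := by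
    have h4 : y ≤ 2 / c * Real.exp (c / 2 * y) := by
      rw [div_mul_eq_mul_div, le_div_iff₀ hc]; linarith
    have h5 : 1 ≤ Real.exp (c / 2 * y) := Real.one_le_exp (by positivity)
    rw [add_mul]; linarith
  calc _ ≤ (2 + 2 / c) * Real.exp (c / 2 * y) * Real.exp (-(c * y)) := by gcongr
    _ = _ := by rw [mul_assoc, ← Real.exp_add]; ring_nf

/-- Cauchy's theorem on a rectangle of the form `[L, b] × [y₀, y₁]`. -/
theorem rect_integral_eq_zero {F : ℂ → ℂ} {L b y₀ y₁ : ℝ}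
    (hF : DifferentiableOn ℂ F (uIcc L b ×ℂ uIcc y₀ y₁)) :
    (∫ t in L..b, F (t + y₀ * Complex.I)) - (∫ t in L..b, F (t + y₁ * Complex.I)) +
      Complex.I * (∫ y in y₀..y₁, F (b + y * Complex.I)) -
      Complex.I * (∫ y in y₀..y₁, F (L + y * Complex.I)) = 0 := by
  have h := Complex.integral_boundary_rect_eq_zero_of_differentiableOn F
    (L + y₀ * Complex.I) (b + y₁ * Complex.I) (by simpa using hF)
  simpa using h

theorem tendsto_vertical_integral {F : ℂ → ℂ} {l : Filter ℝ} {y₀ y₁ : ℝ} (h01 : y₀ ≤ y₁)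
    {B : ℝ → ℝ} (hB : Tendsto B l (𝓝 0))
    (hle : ∀ᶠ x : ℝ in l, ∀ y ∈ Icc y₀ y₁, ‖F (x + y * Complex.I)‖ ≤ B x) :
    Tendsto (fun x : ℝ => ∫ y in y₀..y₁, F (x + y * Complex.I)) l (𝓝 0) := by
  have h2 : Tendsto (fun x => B x * |y₁ - y₀|) l (𝓝 0) := by simpa using hB.mul_const |y₁ - y₀|
  refine squeeze_zero_norm' ?_ h2
  filter_upwards [hle] with x hx
  refine intervalIntegral.norm_integral_le_of_norm_le_const fun y hy => hx y ?_
  rw [uIoc_of_le h01] at hy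
  exact ⟨hy.1.le, hy.2⟩

/-- Deforming two horizontal lines into two half-lines and a vertical segment. -/
theorem integral_lines_sub_eq_cut {F : ℂ → ℂ} (hF : Differentiable ℂ F) {y₀ y₁ : ℝ} (h01 : y₀ ≤ y₁)
    (h0 : Integrable fun t : ℝ => F (t + y₀ * Complex.I))
    (h1 : Integrable fun t : ℝ => F (t + y₁ * Complex.I)) {B : ℝ → ℝ} (hB : Tendsto B atBot (𝓝 0))
    (hle : ∀ᶠ x : ℝ in atBot, ∀ y ∈ Icc y₀ y₁, ‖F (x + y * Complex.I)‖ ≤ B x) (b : ℝ) :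
    (∫ t : ℝ, F (t + y₁ * Complex.I)) - (∫ t : ℝ, F (t + y₀ * Complex.I)) =
      (∫ t in Ioi b, F (t + y₁ * Complex.I)) - (∫ t in Ioi b, F (t + y₀ * Complex.I)) +
      Complex.I * ∫ y in y₀..y₁, F (b + y * Complex.I) := by
  have t0 := intervalIntegral_tendsto_integral_Iic b h0.integrableOn tendsto_id
  have t1 := intervalIntegral_tendsto_integral_Iic b h1.integrableOn tendsto_id
  have tv := tendsto_vertical_integral h01 hB hle
  have hlim := ((t0.sub t1).add_const
    (Complex.I * ∫ y in y₀..y₁, F (b + y * Complex.I))).sub (tv.const_mul Complex.I)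
  have hz : ∀ L : ℝ, (∫ t in L..b, F (t + y₀ * Complex.I)) - (∫ t in L..b, F (t + y₁ * Complex.I)) +
      Complex.I * (∫ y in y₀..y₁, F (b + y * Complex.I)) -
      Complex.I * (∫ y in y₀..y₁, F (L + y * Complex.I)) = 0 := fun L =>
    rect_integral_eq_zero hF.differentiableOn
  simp only [id] at hlim
  simp only [hz] at hlim
  have heq := tendsto_nhds_unique hlim tendsto_const_nhds
  have s0 := integral_add_compl (measurableSet_Iic (a := b)) h0
  have s1 := integral_add_compl (measurableSet_Iic (a := b)) h1
  rw [compl_Iic] at s0 s1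
  rw [← s0, ← s1]
  linear_combination -heq

/-- The integrand of the kernel in logarithmic coordinates. -/
def kernelLog (σ : ℝ) (τ ξ : ℂ) : ℂ :=
  Complex.exp (Complex.exp (σ * ξ) - τ * Complex.exp ξ + ξ)

theorem norm_kernelLog (σ : ℝ) {x ψ t y : ℝ} :
    ‖kernelLog σ (x * Complex.exp (ψ * Complex.I)) (t + y * Complex.I)‖ =
      Real.exp (Real.exp (σ * t) * Real.cos (σ * y) - x * Real.exp t * Real.cos (ψ + y) + t) := by
  rw [kernelLog, Complex.norm_exp]
  congr 1
  have h1 : (Complex.exp (σ * (t + y * Complex.I))).re = Real.exp (σ * t) * Real.cos (σ * y) := by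
    rw [Complex.exp_re]; simp
  have h2 : ((x * Complex.exp (ψ * Complex.I)) * Complex.exp (t + y * Complex.I)).re =
      x * Real.exp t * Real.cos (ψ + y) := by
    rw [mul_assoc, ← Complex.exp_add, Complex.re_ofReal_mul, Complex.exp_re]
    simp [mul_assoc]
  rw [Complex.add_re, Complex.sub_re, h1, h2]
  simp

/-- On the ray y = x e^e one has y^σ = -x^σ, so the left side is the integral of exp(y^σ - τy) dy
along it; g then turns the ray to the angle ψ, and y = e^ξ. -/
theorem momentInt_eq_integral_kernelLog {σ : ℝ} (hσ : 1 < σ) (τ : ℂ) {ψ : ℝ} {g e : ℂ}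
    (hg : σ * |g.im| < Real.pi / 2) (he : Complex.exp (σ * e) = -1)
    (hge : e + g = ψ * Complex.I) :
    Integrable (fun t : ℝ => kernelLog σ τ (t + ψ * Complex.I)) ∧
    Complex.exp e * momentInt σ 0 (τ * Complex.exp e) 1 =
      ∫ t : ℝ, kernelLog σ τ (t + ψ * Complex.I) := by
  have hσ0 : 0 < σ := by linarith
  have hB : 0 < (Complex.exp (σ * g)).re := by
    refine exp_re_pos ?_
    rwa [Complex.im_ofReal_mul, abs_mul, abs_of_pos hσ0]
  have hσg : Complex.exp (σ * g) = -Complex.exp (σ * (ψ * Complex.I)) := by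
    rw [← hge, mul_add, Complex.exp_add, he]; ring
  have hfun : (fun t : ℝ => kernelLog σ τ (t + ψ * Complex.I)) = fun t : ℝ =>
      (|(1 : ℝ)| * Real.exp (1 * t)) • (Complex.exp (ψ * Complex.I) *
        ((((Real.exp (1 * t)) ^ (0 : ℝ) : ℝ) : ℂ) * Complex.exp (-((Real.exp (1 * t) : ℝ) *
          (Complex.exp g * (τ * Complex.exp e))) - (((Real.exp (1 * t)) ^ σ : ℝ) : ℂ) *
            Complex.exp (σ * g)))) := by
    funext t
    have h1 : Complex.exp g * (τ * Complex.exp e) = τ * Complex.exp (ψ * Complex.I) := by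
      rw [← hge, Complex.exp_add]; ring
    rw [h1, hσg, abs_one, Complex.real_smul, Real.rpow_zero, ← Real.exp_mul, kernelLog]
    push_cast
    rw [one_mul, one_mul, one_mul, ← mul_assoc, ← Complex.exp_add, ← Complex.exp_add]
    congr 1
    rw [mul_add, Complex.exp_add, Complex.exp_add, mul_comm (t : ℂ)]
    ring
  have hint := (integrableOn_momentInt hσ (s := 0) (by norm_num)
    (Complex.exp g * (τ * Complex.exp e)) hB).const_mul (Complex.exp (ψ * Complex.I))
  have h1 := (integrableOn_Ioi_iff_integrable_exp one_ne_zero _).1 hint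
  have h2 := integral_Ioi_eq_integral_exp one_ne_zero fun x : ℝ => Complex.exp (ψ * Complex.I) *
    (((x ^ (0 : ℝ) : ℝ) : ℂ) * Complex.exp (-(x *
      (Complex.exp g * (τ * Complex.exp e))) - ((x ^ σ : ℝ) : ℂ) * Complex.exp (σ * g)))
  refine ⟨by rw [hfun]; exact h1, ?_⟩
  rw [momentInt_rotate hσ (by norm_num) _ hg, hfun, ← h2, integral_const_mul, ← mul_assoc, ← hge, Complex.exp_add]
  simp [momentInt]

set_option maxHeartbeats 800000 in
/-- The kernel decays exponentially in the sectors `|arg τ| ≤ π / 2 (1 - 1 / σ) - η`. -/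
theorem kernelC_decay {σ : ℝ} (hσ : 1 < σ) {η : ℝ} (hη : 0 < η) : ∃ K > 0, ∃ c > 0, ∀ x : ℝ, 0 < x →
    ∀ ψ : ℝ, |ψ| ≤ Real.pi / 2 * (1 - 1 / σ) - η →
    ‖kernelC σ (x * Complex.exp (ψ * Complex.I))‖ ≤ K * Real.exp (-(c * x ^ (σ / (σ - 1)))) := by
  have hσ0 : 0 < σ := by linarith
  have hσ1 : 0 < σ - 1 := by linarith
  have hπ := Real.pi_pos
  set η' := min η (Real.pi / (2 * σ)) with hη'
  have hη'0 : 0 < η' := lt_min hη (by positivity)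
  have hη'1 : η' ≤ Real.pi / (2 * σ) := min_le_right _ _
  have hση : σ * η' ≤ Real.pi / 2 := by
    calc σ * η' ≤ σ * (Real.pi / (2 * σ)) := by gcongr
      _ = Real.pi / 2 := by field_simp
  have hη'2 : η' ≤ Real.pi / 2 := le_trans (by nlinarith) hση
  -- The rays are turned from ±π/σ to ±ψ₀, just beyond ±π/(2σ). There exp(y^σ) still decays, since
  -- cos(σψ₀) < 0, and |ψ ± ψ₀| ≤ π/2 - η'/2 makes exp(-τy) decay as well.
  set ψ₀ := Real.pi / (2 * σ) + η' / 2 with hψ₀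
  have hψ₀0 : 0 ≤ ψ₀ := by positivity
  have hσψ : σ * ψ₀ = Real.pi / 2 + σ * η' / 2 := by rw [hψ₀]; field_simp
  set c₁ := Real.sin (η' / 2) with hc₁
  have hc₁0 : 0 < c₁ := Real.sin_pos_of_pos_of_lt_pi (by positivity) (by linarith)
  set c₃ := Real.sin (σ * η' / 2) with hc₃
  have hc₃0 : 0 < c₃ := Real.sin_pos_of_pos_of_lt_pi (by positivity) (by linarith)
  have hcos3 : Real.cos (σ * ψ₀) = -c₃ := by
    rw [hσψ, add_comm, Real.cos_add_pi_div_two]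
  -- the constants
  have hI := (integrableOn_Ioi_iff_integrable_exp one_ne_zero _).1
    (integrableOn_rpow_mul_exp hσ (s := 0) (by norm_num) 0 hc₃0).ofReal
  have hI3 : Integrable fun t : ℝ => Real.exp (-c₃ * Real.exp (σ * t) + t) := by
    refine hI.norm.congr (Eventually.of_forall fun t => ?_)
    simp only
    simp only [norm_smul, Real.norm_eq_abs, RCLike.norm_ofReal, abs_one, one_mul, Real.rpow_zero,
      zero_mul, zero_sub, Real.abs_exp]
    rw [← Real.exp_add, ← Real.exp_mul, mul_comm t σ]
    ring_nf
  set I₃ := ∫ t : ℝ, Real.exp (-c₃ * Real.exp (σ * t) + t) with hI₃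
  have hI₃0 : 0 ≤ I₃ := integral_nonneg fun t => (Real.exp_pos _).le
  -- δ solves δ^σ = δ c₁/2. With this choice, on the arc |y| = R = δ x^{1/(σ-1)} the possible growth
  -- R^σ of the exponent is half of the decay c₁ x R.
  set δ := (c₁ / 2) ^ (1 / (σ - 1)) with hδ
  have hδ0 : 0 < δ := by positivity
  have hδσ : δ ^ σ = δ * (c₁ / 2) := by
    have h1 : δ ^ (σ - 1) = c₁ / 2 := by
      rw [hδ, ← Real.rpow_mul (by positivity), one_div_mul_cancel hσ1.ne', Real.rpow_one]
    rw [← h1, ← Real.rpow_one_add' hδ0.le (by linarith)]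
    ring_nf
  obtain ⟨K₁, hK₁, hcut⟩ := one_add_rpow_mul_exp_le hσ (δ * c₁ / 2) (by positivity)
  refine ⟨σ / (2 * Real.pi) * (2 * I₃ + 2 * ψ₀ * δ + 1) * K₁, by positivity, δ * c₁ / 2 / 2,
    by positivity, fun x hx ψ hψ => ?_⟩
  set N := x ^ (σ / (σ - 1)) with hN
  have hN0 : 0 < N := by positivity
  set R := δ * x ^ (1 / (σ - 1)) with hR
  have hR0 : 0 < R := by positivity
  have hxR : x * R = δ * N := by
    have : x ^ (σ / (σ - 1)) = x * x ^ (1 / (σ - 1)) := by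
      rw [← Real.rpow_one_add' hx.le (by positivity)]
      congr 1; field_simp; ring
    rw [hN, this, hR]; ring
  have hRσ : R ^ σ = δ * (c₁ / 2) * N := by
    rw [hR, Real.mul_rpow hδ0.le (by positivity), hδσ, ← Real.rpow_mul hx.le, hN]
    ring_nf
  set b := Real.log R with hb
  have hbR : Real.exp b = R := Real.exp_log hR0
  have hbσ : Real.exp (σ * b) = R ^ σ := by
    rw [mul_comm, Real.exp_mul, hbR]
  have hψ' : |ψ| ≤ Real.pi / 2 - Real.pi / (2 * σ) - η' := by
    have : Real.pi / 2 * (1 - 1 / σ) = Real.pi / 2 - Real.pi / (2 * σ) := by field_simp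
    rw [this] at hψ
    linarith [min_le_left η (Real.pi / (2 * σ))]
  have hcos1 : ∀ y ∈ Icc (-ψ₀) ψ₀, c₁ ≤ Real.cos (ψ + y) := by
    intro y hy
    have h1 : |ψ + y| ≤ Real.pi / 2 - η' / 2 := by
      refine (abs_add_le _ _).trans ?_
      have := abs_le.2 ⟨hy.1, hy.2⟩
      rw [hψ₀] at this
      linarith
    rw [hc₁, ← Real.cos_pi_div_two_sub, ← Real.cos_abs (ψ + y)]
    exact Real.cos_le_cos_of_nonneg_of_le_pi (abs_nonneg _) (by linarith) h1
  set τ : ℂ := x * Complex.exp (ψ * Complex.I) with hτ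
  have hσC : (σ : ℂ) ≠ 0 := by exact_mod_cast hσ0.ne'
  have hgim : σ * |ψ₀ - Real.pi / σ| < Real.pi / 2 := by
    rw [← abs_of_pos hσ0, ← abs_mul, abs_of_pos hσ0, mul_sub, mul_div_cancel₀ _ hσ0.ne', hσψ,
      abs_lt]
    constructor <;> nlinarith
  obtain ⟨hint₁, heq₁⟩ := momentInt_eq_integral_kernelLog hσ τ (ψ := ψ₀)
    (g := ((ψ₀ - Real.pi / σ : ℝ) : ℂ) * Complex.I) (e := Real.pi / σ * Complex.I)
    (by simpa only [Complex.mul_I_im, Complex.ofReal_re] using hgim)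
    (by rw [← mul_assoc, mul_div_cancel₀ _ hσC, Complex.exp_pi_mul_I]) (by push_cast; ring)
  obtain ⟨hint₀, heq₀⟩ := momentInt_eq_integral_kernelLog hσ τ (ψ := -ψ₀)
    (g := ((-(ψ₀ - Real.pi / σ) : ℝ) : ℂ) * Complex.I) (e := -(Real.pi / σ * Complex.I))
    (by simpa only [Complex.mul_I_im, Complex.ofReal_re, abs_neg] using hgim)
    (by rw [mul_neg, ← mul_assoc, mul_div_cancel₀ _ hσC, Complex.exp_neg, Complex.exp_pi_mul_I]
        norm_num) (by push_cast; ring)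
  have hbot : Tendsto (fun t : ℝ => Real.exp (1 + x + t)) atBot (𝓝 0) :=
    Real.tendsto_exp_atBot.comp (tendsto_atBot_add_const_left _ _ tendsto_id)
  -- The parts of the two rays with |y| < R are replaced by the arc |y| = R, a vertical segment in
  -- the variable ξ = log y.
  have hcutint := integral_lines_sub_eq_cut (F := kernelLog σ τ)
    (by unfold kernelLog; fun_prop) (by linarith : -ψ₀ ≤ ψ₀) hint₀ hint₁ hbot (by
      filter_upwards [eventually_le_atBot 0] with t ht y _
      rw [hτ, norm_kernelLog]
      have h1 : Real.exp (σ * t) ≤ 1 := Real.exp_le_one_iff.2 (by nlinarith)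
      have h2 : Real.exp t ≤ 1 := Real.exp_le_one_iff.2 ht
      have h3 := Real.exp_pos (σ * t)
      have h4 := Real.exp_pos t
      have h5 : Real.exp (σ * t) * Real.cos (σ * y) ≤ 1 * 1 :=
        mul_le_mul_of_nonneg h1 (Real.cos_le_one _) h3.le zero_le_one
      have h6 : x * Real.exp t * -Real.cos (ψ + y) ≤ x * 1 * 1 :=
        mul_le_mul_of_nonneg (by gcongr) (by linarith [Real.neg_one_le_cos (ψ + y)])
          (by positivity) zero_le_one
      gcongr
      linarith) b
  have hray : ∀ y ∈ Icc (-ψ₀) ψ₀, Real.cos (σ * y) = -c₃ →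
      ‖∫ t in Ioi b, kernelLog σ τ (t + y * Complex.I)‖ ≤ Real.exp (-(δ * c₁ / 2 * N)) * I₃ := by
    intro y hy hcy
    have hle := norm_integral_le_of_norm_le (μ := volume.restrict (Ioi b))
      (f := fun t : ℝ => kernelLog σ τ (t + y * Complex.I))
      ((hI3.const_mul (Real.exp (-(δ * c₁ / 2 * N)))).integrableOn) (by
        filter_upwards [ae_restrict_mem measurableSet_Ioi] with t ht
        have ht : b < t := ht
        rw [hτ, norm_kernelLog, hcy, ← Real.exp_add]
        have h1 : R ≤ Real.exp t := hbR ▸ Real.exp_le_exp.2 ht.le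
        have h2 : δ * N * c₁ ≤ x * Real.exp t * Real.cos (ψ + y) := by
          rw [← hxR]
          have := hcos1 y hy
          gcongr
        have h3 : 0 < δ * N * c₁ := by positivity
        refine Real.exp_le_exp.2 ?_
        linarith)
    refine hle.trans ?_
    rw [integral_const_mul]
    gcongr
    exact setIntegral_le_integral hI3 (Eventually.of_forall fun t => (Real.exp_pos _).le)
  have hvert : ‖∫ y in (-ψ₀)..ψ₀, kernelLog σ τ (b + y * Complex.I)‖ ≤
      R * Real.exp (-(δ * c₁ / 2 * N)) * (2 * ψ₀) := by
    have h := intervalIntegral.norm_integral_le_of_norm_le_const (a := -ψ₀) (b := ψ₀)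
      (f := fun y : ℝ => kernelLog σ τ (b + y * Complex.I))
      (C := R * Real.exp (-(δ * c₁ / 2 * N))) (fun y hy => by
        rw [uIoc_of_le (by linarith)] at hy
        have hc := hcos1 y ⟨hy.1.le, hy.2⟩
        rw [hτ, norm_kernelLog, hbσ, hRσ, hbR, hxR, Real.exp_add, hbR, mul_comm R]
        have h1 : δ * (c₁ / 2) * N * Real.cos (σ * y) ≤ δ * (c₁ / 2) * N * 1 := by
          have := Real.cos_le_one (σ * y)
          gcongr
        have h2 : δ * N * c₁ ≤ δ * N * Real.cos (ψ + y) := by gcongr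
        gcongr
        linarith)
    rwa [show ψ₀ - -ψ₀ = 2 * ψ₀ by ring, abs_of_nonneg (by linarith)] at h
  have hr1 := hray ψ₀ ⟨by linarith, le_rfl⟩ hcos3
  have hr0 := hray (-ψ₀) ⟨le_rfl, by linarith⟩ (by rw [mul_neg, Real.cos_neg, hcos3])
  rw [kernelC_eq hσ, heq₁, heq₀, hcutint, norm_mul]
  have hnorm : ‖(σ : ℂ) / (2 * Real.pi * Complex.I)‖ = σ / (2 * Real.pi) := by
    rw [norm_div, norm_mul, norm_mul, Complex.norm_I, Complex.norm_real, Complex.norm_real,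
      Complex.norm_ofNat, Real.norm_of_nonneg hσ0.le, Real.norm_of_nonneg hπ.le, mul_one]
  rw [hnorm, mul_assoc, mul_assoc]
  refine mul_le_mul_of_nonneg_left ?_ (by positivity)
  have hcutx := hcut x hx
  have hE := Real.exp_pos (-(δ * c₁ / 2 * N))
  have hxp : 0 < x ^ (1 / (σ - 1)) := by positivity
  calc _ ≤ Real.exp (-(δ * c₁ / 2 * N)) * I₃ + Real.exp (-(δ * c₁ / 2 * N)) * I₃ +
        R * Real.exp (-(δ * c₁ / 2 * N)) * (2 * ψ₀) := by
        refine (norm_add_le _ _).trans (add_le_add ((norm_sub_le _ _).trans (add_le_add hr1 hr0)) ?_)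
        rw [norm_mul, Complex.norm_I, one_mul]
        exact hvert
    _ ≤ (2 * I₃ + 2 * ψ₀ * δ + 1) * ((1 + x ^ (1 / (σ - 1))) * Real.exp (-(δ * c₁ / 2 * N))) := by
        rw [hR]
        have h1 : 0 ≤ 2 * I₃ * (x ^ (1 / (σ - 1)) * Real.exp (-(δ * c₁ / 2 * N))) := by positivity
        have h2 : 0 ≤ (2 * ψ₀ * δ) * Real.exp (-(δ * c₁ / 2 * N)) := by positivity
        have h3 : 0 ≤ 1 * ((1 + x ^ (1 / (σ - 1))) * Real.exp (-(δ * c₁ / 2 * N))) := by positivity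
        linarith
    _ ≤ _ := by
        refine mul_le_mul_of_nonneg_left hcutx (by positivity)

/-! ### Residue calculus for the kernel on horizontal strips. -/

/-- `A ∫₀^∞ exp (-x A - x ^ σ) dx` at `A = exp ((π i - ω) / σ)`; its differences under `ω ↦ ω + 2πi`
give the kernel `C_σ`. -/
def laplaceE (σ : ℝ) (ω : ℂ) : ℂ :=
  Complex.exp ((Real.pi * Complex.I - ω) / σ) *
    momentInt σ 0 (Complex.exp ((Real.pi * Complex.I - ω) / σ)) 1

theorem differentiable_laplaceE {σ : ℝ} (hσ : 1 < σ) : Differentiable ℂ (laplaceE σ) := by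
  have h0 := differentiable_momentInt hσ (s := 0) (by norm_num)
  have h1 : Differentiable ℂ fun ω : ℂ => Complex.exp ((Real.pi * Complex.I - ω) / σ) := by fun_prop
  exact h1.mul (h0.comp h1)

/-- The shift by 2πi turns e^{πi/σ} into e^{-πi/σ}, so the difference is that of the two rays in
`kernelC_eq`. -/
theorem laplaceE_sub {σ : ℝ} (hσ : 1 < σ) (ω : ℂ) :
    laplaceE σ ω - laplaceE σ (ω + 2 * Real.pi * Complex.I) =
      2 * Real.pi * Complex.I / σ * Complex.exp (-(ω / σ)) * kernelC σ (Complex.exp (-(ω / σ))) := by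
  have hσ0 : (σ : ℂ) ≠ 0 := by exact_mod_cast (by linarith : σ ≠ 0)
  have hπ : (Real.pi : ℂ) ≠ 0 := by exact_mod_cast Real.pi_ne_zero
  have hI := Complex.I_ne_zero
  have e1 : Complex.exp ((Real.pi * Complex.I - ω) / σ) =
      Complex.exp (-(ω / σ)) * Complex.exp (Real.pi / σ * Complex.I) := by
    rw [← Complex.exp_add]; congr 1; ring
  have e2 : Complex.exp ((Real.pi * Complex.I - (ω + 2 * Real.pi * Complex.I)) / σ) =
      Complex.exp (-(ω / σ)) * Complex.exp (-(Real.pi / σ * Complex.I)) := by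
    rw [← Complex.exp_add]; congr 1; ring
  rw [kernelC_eq hσ, laplaceE, laplaceE, e1, e2]
  field_simp

/-- `momentInt_asymptotic` at s = 0 and a = (πi - ω)/σ: the factor e^{-σja} = (-1)^j e^{jω} absorbs
the alternating sign. -/
theorem laplaceE_asymptotic {σ : ℝ} (hσ : 1 < σ) (N : ℕ) {η : ℝ} (hη : 0 < η) :
    ∃ K > 0, ∀ ω : ℂ, |ω.im - Real.pi| ≤ Real.pi / 2 * (σ + 1) - η →
    ‖laplaceE σ ω - ∑ j ∈ Finset.range N, Complex.Gamma (σ * j + 1) / (j.factorial : ℂ) *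
        Complex.exp (j * ω)‖ ≤ K * Real.exp (N * ω.re) := by
  have hσ0 : 0 < σ := by linarith
  have hσC : (σ : ℂ) ≠ 0 := by exact_mod_cast hσ0.ne'
  obtain ⟨K, hK, h⟩ := momentInt_asymptotic hσ (s := 0) (by norm_num) N (div_pos hη hσ0)
  refine ⟨K, hK, fun ω hω => ?_⟩
  set a : ℂ := (Real.pi * Complex.I - ω) / σ with ha
  have him : a.im = (Real.pi - ω.im) / σ := by rw [ha, Complex.div_ofReal_im]; simp
  have hre : a.re = -ω.re / σ := by rw [ha, Complex.div_ofReal_re]; simp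
  have h1 := h a (by
    rw [him, abs_div, abs_of_pos hσ0, abs_sub_comm, div_le_iff₀ hσ0]
    have : (Real.pi / 2 * (1 + 1 / σ) - η / σ) * σ = Real.pi / 2 * (σ + 1) - η := by field_simp
    rw [this]; exact hω)
  have h2 : -(σ * N * a.re) = N * ω.re := by rw [hre]; field_simp
  rw [h2] at h1
  have h3 : Complex.exp (((0 : ℝ) + 1) * a) * momentInt σ 0 (Complex.exp a) 1 = laplaceE σ ω := by
    rw [laplaceE, Complex.ofReal_zero, zero_add, one_mul]
  rw [h3] at h1
  convert! h1 using 4 with j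
  have h4 : -(σ * j * a) = -(j * (Real.pi * Complex.I)) + j * ω := by
    rw [ha]; field_simp; ring
  rw [h4, Complex.exp_add, Complex.exp_neg, Complex.exp_nat_mul (Real.pi * Complex.I), Complex.exp_pi_mul_I,
    Complex.ofReal_zero, zero_add]
  have h5 : ((-1 : ℂ) ^ j) ≠ 0 := by simp
  field_simp

theorem norm_laplaceE_le {σ : ℝ} (hσ : 1 < σ) {η : ℝ} (hη : 0 < η) :
    ∃ K > 0, ∀ ω : ℂ, |ω.im - Real.pi| ≤ Real.pi / 2 * (σ + 1) - η → ‖laplaceE σ ω‖ ≤ K := by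
  obtain ⟨K, hK, h⟩ := laplaceE_asymptotic hσ 0 hη
  refine ⟨K, hK, fun ω hω => ?_⟩
  simpa using h ω hω

/-- For Re ω ≥ 0 the argument A lies in the closed unit disc, where the integral is bounded by
compactness. The prefactor A gives the decay, whatever Im ω is. -/
theorem norm_laplaceE_le_exp {σ : ℝ} (hσ : 1 < σ) :
    ∃ K > 0, ∀ ω : ℂ, 0 ≤ ω.re → ‖laplaceE σ ω‖ ≤ K * Real.exp (-(ω.re / σ)) := by
  have hσ0 : 0 < σ := by linarith
  have hc : Continuous fun A => momentInt σ 0 A 1 :=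
    (differentiable_momentInt hσ (s := 0) (by norm_num)).continuous
  obtain ⟨K, hK⟩ := (isCompact_closedBall (0 : ℂ) 1).exists_bound_of_continuousOn hc.continuousOn
  refine ⟨|K| + 1, by positivity, fun ω hω => ?_⟩
  have hn : ‖Complex.exp ((Real.pi * Complex.I - ω) / σ)‖ = Real.exp (-(ω.re / σ)) := by
    rw [Complex.norm_exp, Complex.div_ofReal_re]; simp [neg_div]
  rw [laplaceE, norm_mul, hn, mul_comm]
  gcongr
  refine (hK _ ?_).trans (by linarith [le_abs_self K])
  rw [mem_closedBall_zero_iff, hn]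
  exact Real.exp_le_one_iff.2 (by have : 0 ≤ ω.re / σ := by positivity
                                  linarith)

/-- An integral with the kernel `C_σ` over a ray, in logarithmic coordinates. -/
theorem integral_kernelC_eq {σ : ℝ} (hσ : 1 < σ) (ψ : ℝ) (f : ℂ → ℂ)
    (hf : IntegrableOn (fun x : ℝ => Complex.exp (ψ * Complex.I) *
      kernelC σ (x * Complex.exp (ψ * Complex.I)) * f (x * Complex.exp (ψ * Complex.I))) (Ioi 0)) :
    Integrable (fun t : ℝ => (laplaceE σ (t + ((-(σ * ψ) : ℝ) : ℂ) * Complex.I) -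
      laplaceE σ (t + ((-(σ * ψ) : ℝ) : ℂ) * Complex.I + 2 * Real.pi * Complex.I)) *
      f (Complex.exp (-((t + ((-(σ * ψ) : ℝ) : ℂ) * Complex.I) / σ)))) ∧
    ∫ x in Ioi (0 : ℝ), Complex.exp (ψ * Complex.I) *
      kernelC σ (x * Complex.exp (ψ * Complex.I)) * f (x * Complex.exp (ψ * Complex.I)) =
    1 / (2 * Real.pi * Complex.I) * ∫ t : ℝ, (laplaceE σ (t + ((-(σ * ψ) : ℝ) : ℂ) * Complex.I) -
      laplaceE σ (t + ((-(σ * ψ) : ℝ) : ℂ) * Complex.I + 2 * Real.pi * Complex.I)) *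
      f (Complex.exp (-((t + ((-(σ * ψ) : ℝ) : ℂ) * Complex.I) / σ))) := by
  have hσ0 : 0 < σ := by linarith
  have hσC : (σ : ℂ) ≠ 0 := by exact_mod_cast hσ0.ne'
  have hπ : (Real.pi : ℂ) ≠ 0 := by exact_mod_cast Real.pi_ne_zero
  have hI := Complex.I_ne_zero
  have ha : -(1 / σ) ≠ 0 := by rw [neg_ne_zero]; positivity
  have hfun : (fun t : ℝ => (laplaceE σ (t + ((-(σ * ψ) : ℝ) : ℂ) * Complex.I) -
      laplaceE σ (t + ((-(σ * ψ) : ℝ) : ℂ) * Complex.I + 2 * Real.pi * Complex.I)) *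
      f (Complex.exp (-((t + ((-(σ * ψ) : ℝ) : ℂ) * Complex.I) / σ)))) = fun t : ℝ =>
      (2 * Real.pi * Complex.I) * ((|(-(1 / σ))| * Real.exp (-(1 / σ) * t)) •
        (Complex.exp (ψ * Complex.I) *
          kernelC σ ((Real.exp (-(1 / σ) * t) : ℝ) * Complex.exp (ψ * Complex.I)) *
          f ((Real.exp (-(1 / σ) * t) : ℝ) * Complex.exp (ψ * Complex.I)))) := by
    funext t
    have h1 : Complex.exp (-((t + ((-(σ * ψ) : ℝ) : ℂ) * Complex.I) / σ)) =
        (Real.exp (-(1 / σ) * t) : ℝ) * Complex.exp (ψ * Complex.I) := by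
      push_cast
      rw [← Complex.exp_add]
      congr 1
      field_simp
      ring
    rw [laplaceE_sub hσ, h1, abs_neg, abs_of_pos (by positivity), Complex.real_smul]
    push_cast
    field_simp
  have h1 := (integrableOn_Ioi_iff_integrable_exp ha _).1 hf
  refine ⟨by rw [hfun]; exact h1.const_mul _, ?_⟩
  rw [integral_Ioi_eq_integral_exp ha, hfun, integral_const_mul, ← mul_assoc,
    one_div_mul_cancel (by simp [hπ]), one_mul]

theorem tendsto_laplaceE_vertical {σ : ℝ} (hσ : 1 < σ) (k : ℕ) (c : ℝ) :
    Tendsto (fun T : ℝ => ∫ y in c..(c + 2 * Real.pi), laplaceE σ (T + y * Complex.I) *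
      Complex.exp (-(k * (T + y * Complex.I)))) atTop (𝓝 0) := by
  have hσ0 : 0 < σ := by linarith
  obtain ⟨K, hK, hle⟩ := norm_laplaceE_le_exp hσ
  refine tendsto_vertical_integral (F := fun ω => laplaceE σ ω * Complex.exp (-(k * ω)))
    (by linarith [Real.pi_pos]) (B := fun T => K * Real.exp (-(T / σ))) ?_ ?_
  · have : Tendsto (fun T : ℝ => Real.exp (-(T / σ))) atTop (𝓝 0) :=
      Real.tendsto_exp_neg_atTop_nhds_zero.comp (tendsto_id.atTop_div_const hσ0)
    simpa using this.const_mul K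
  · filter_upwards [eventually_ge_atTop 0] with T hT y _
    rw [norm_mul, Complex.norm_exp]
    have h1 := hle (T + y * Complex.I) (by simpa using hT)
    have h2 : (T + y * Complex.I : ℂ).re = T := by simp
    rw [h2] at h1
    have h3 : Real.exp (-(k * (T + y * Complex.I) : ℂ)).re ≤ 1 := by
      rw [Real.exp_le_one_iff]
      simp
      positivity
    calc _ ≤ K * Real.exp (-(T / σ)) * 1 := by gcongr
      _ = _ := mul_one _

theorem integral_exp_int_vertical {m : ℤ} (hm : m ≠ 0) (L c : ℝ) :
    ∫ y in c..(c + 2 * Real.pi), Complex.exp (m * (L + y * Complex.I)) = 0 := by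
  have hne : (m : ℂ) * Complex.I ≠ 0 := mul_ne_zero (by exact_mod_cast hm) Complex.I_ne_zero
  have h : ∀ y : ℝ, Complex.exp (m * (L + y * Complex.I)) =
      Complex.exp (m * L) * Complex.exp (m * Complex.I * y) := by
    intro y; rw [← Complex.exp_add]; congr 1; ring
  simp only [h]
  rw [intervalIntegral.integral_const_mul, integral_exp_mul_complex hne]
  have : Complex.exp (m * Complex.I * ((c + 2 * Real.pi : ℝ) : ℂ)) =
      Complex.exp (m * Complex.I * c) := by
    push_cast
    rw [mul_add, Complex.exp_add]
    have : (m : ℂ) * Complex.I * (2 * Real.pi) = m * (2 * Real.pi * Complex.I) := by ring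
    rw [this, Complex.exp_int_mul_two_pi_mul_I, mul_one]
  rw [this]; simp

/-- Over a segment of length 2π the expansion in powers of e^ω acts as a Fourier series: after
multiplication by e^{-kω} only j = k survives, and the remainder after k + 1 terms is O(e^{Re ω}).
The bound on c keeps the whole segment in the region where the expansion holds. -/
theorem tendsto_laplaceE_vertical_left {σ : ℝ} (hσ : 1 < σ) (k : ℕ) {c : ℝ} {η : ℝ} (hη : 0 < η)
    (hc : |c| ≤ Real.pi / 2 * (σ - 1) - η) :
    Tendsto (fun T : ℝ => ∫ y in c..(c + 2 * Real.pi), laplaceE σ (T + y * Complex.I) *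
      Complex.exp (-(k * (T + y * Complex.I)))) atBot
      (𝓝 (2 * Real.pi * (Complex.Gamma (σ * k + 1) / (k.factorial : ℂ)))) := by
  have hπ := Real.pi_pos
  obtain ⟨K, hK, hle⟩ := laplaceE_asymptotic hσ (k + 1) hη
  set S : ℂ → ℂ := fun ω => ∑ j ∈ Finset.range (k + 1),
    Complex.Gamma (σ * j + 1) / (j.factorial : ℂ) * Complex.exp (j * ω) with hS
  have hSint : ∀ T : ℝ, ∫ y in c..(c + 2 * Real.pi), S (T + y * Complex.I) *
      Complex.exp (-(k * (T + y * Complex.I))) =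
      2 * Real.pi * (Complex.Gamma (σ * k + 1) / (k.factorial : ℂ)) := by
    intro T
    have h1 : ∀ y : ℝ, S (T + y * Complex.I) * Complex.exp (-(k * (T + y * Complex.I))) =
        ∑ j ∈ Finset.range (k + 1), Complex.Gamma (σ * j + 1) / (j.factorial : ℂ) *
          Complex.exp ((((j : ℤ) - k : ℤ) : ℂ) * (T + y * Complex.I)) := by
      intro y
      rw [hS, Finset.sum_mul]
      refine Finset.sum_congr rfl fun j _ => ?_
      rw [mul_assoc, ← Complex.exp_add]
      push_cast
      ring_nf
    simp only [h1]
    rw [intervalIntegral.integral_finsetSum fun j _ => Continuous.intervalIntegrable (by fun_prop) _ _,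
      Finset.sum_eq_single_of_mem k (by simp)]
    · simp
      ring
    · intro j _ hj
      rw [intervalIntegral.integral_const_mul, integral_exp_int_vertical (by omega), mul_zero]
  have hdiff := tendsto_vertical_integral (l := atBot)
    (F := fun ω => (laplaceE σ ω - S ω) * Complex.exp (-(k * ω)))
    (by linarith : c ≤ c + 2 * Real.pi) (B := fun T => K * Real.exp T)
    (by simpa using Real.tendsto_exp_atBot.const_mul K) (by
      refine Eventually.of_forall fun T y hy => ?_
      have him : (T + y * Complex.I : ℂ).im = y := by simp
      have hre : (T + y * Complex.I : ℂ).re = T := by simp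
      have h1 := hle (T + y * Complex.I) (by
        rw [him, abs_le]
        have := abs_le.1 hc
        constructor <;> linarith [hy.1, hy.2])
      rw [hre] at h1
      rw [norm_mul, Complex.norm_exp]
      have h2 : (-(k * (T + y * Complex.I) : ℂ)).re = -(k * T) := by simp
      rw [h2]
      calc _ ≤ K * Real.exp ((k + 1 : ℕ) * T) * Real.exp (-(k * T)) := by gcongr
        _ = K * Real.exp T := by
          rw [mul_assoc, ← Real.exp_add]; push_cast; ring_nf)
  have h2 := hdiff.add_const (2 * Real.pi * (Complex.Gamma (σ * k + 1) / (k.factorial : ℂ)))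
  rw [zero_add] at h2
  refine h2.congr fun T => ?_
  have hcE : Continuous (laplaceE σ) := (differentiable_laplaceE hσ).continuous
  have hcS : Continuous S := by rw [hS]; fun_prop
  rw [← hSint T, ← intervalIntegral.integral_add]
  · refine intervalIntegral.integral_congr fun y _ => ?_
    ring
  · exact Continuous.intervalIntegrable (by fun_prop) _ _
  · exact Continuous.intervalIntegrable (by fun_prop) _ _

/-- The moments of the kernel. -/
theorem integral_kernelC_mul_pow {σ : ℝ} (hσ : 1 < σ) {ψ : ℝ}
    (hψ : |ψ| < Real.pi / 2 * (1 - 1 / σ)) {n k : ℕ} (hnk : (n : ℝ) = σ * k)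
    (hf : IntegrableOn (fun x : ℝ => Complex.exp (ψ * Complex.I) *
      kernelC σ (x * Complex.exp (ψ * Complex.I)) * (x * Complex.exp (ψ * Complex.I)) ^ n) (Ioi 0)) :
    ∫ x in Ioi (0 : ℝ), Complex.exp (ψ * Complex.I) *
      kernelC σ (x * Complex.exp (ψ * Complex.I)) * (x * Complex.exp (ψ * Complex.I)) ^ n =
      (n.factorial : ℂ) / (k.factorial : ℂ) := by
  have hσ0 : 0 < σ := by linarith
  have hσC : (σ : ℂ) ≠ 0 := by exact_mod_cast hσ0.ne'
  have hπC : (Real.pi : ℂ) ≠ 0 := by exact_mod_cast Real.pi_ne_zero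
  have hI := Complex.I_ne_zero
  obtain ⟨hint, heq⟩ := integral_kernelC_eq hσ ψ (fun X => X ^ n) hf
  set c : ℝ := -(σ * ψ) with hc
  rw [heq]
  have hnkC : (n : ℂ) = σ * k := by exact_mod_cast hnk
  have hpow : ∀ t : ℝ, Complex.exp (-((t + (c : ℂ) * Complex.I) / σ)) ^ n =
      Complex.exp (-(k * (t + c * Complex.I))) := by
    intro t
    rw [← Complex.exp_nat_mul, hnkC]
    congr 1
    field_simp
  -- Because n = σk, the power of τ is e^{-kω}, which is 2πi-periodic. The integrand is thus F on
  -- the lower side minus F on the upper side of a strip of height 2π, and Cauchy's theorem leaves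
  -- the two vertical ends.
  set F : ℂ → ℂ := fun ω => laplaceE σ ω * Complex.exp (-(k * ω)) with hF
  have hFd : Differentiable ℂ F := (differentiable_laplaceE hσ).mul (by fun_prop)
  have hfun : ∀ t : ℝ, (laplaceE σ (t + (c : ℂ) * Complex.I) -
      laplaceE σ (t + (c : ℂ) * Complex.I + 2 * Real.pi * Complex.I)) *
      Complex.exp (-((t + (c : ℂ) * Complex.I) / σ)) ^ n =
      F (t + c * Complex.I) - F (t + ((c + 2 * Real.pi : ℝ) : ℂ) * Complex.I) := by
    intro t
    rw [hpow]
    simp only [hF]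
    have h1 : (t : ℂ) + ((c + 2 * Real.pi : ℝ) : ℂ) * Complex.I =
        t + c * Complex.I + 2 * Real.pi * Complex.I := by push_cast; ring
    have h2 : Complex.exp (-(k * (t + c * Complex.I + 2 * Real.pi * Complex.I))) =
        Complex.exp (-(k * (t + c * Complex.I))) := by
      rw [mul_add, neg_add, Complex.exp_add, Complex.exp_neg (k * (2 * Real.pi * Complex.I)),
        Complex.exp_nat_mul_two_pi_mul_I, inv_one, mul_one]
    rw [h1, h2]; ring
  simp only [hfun] at hint ⊢
  have hlim := intervalIntegral_tendsto_integral hint tendsto_neg_atTop_atBot tendsto_id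
  have hη : 0 < Real.pi / 2 * (σ - 1) - |c| := by
    rw [hc, abs_neg, abs_mul, abs_of_pos hσ0]
    have : σ * (Real.pi / 2 * (1 - 1 / σ)) = Real.pi / 2 * (σ - 1) := by field_simp
    nlinarith
  have hL := (tendsto_laplaceE_vertical_left hσ k hη (by linarith : |c| ≤ _)).comp
    tendsto_neg_atTop_atBot
  have hR := tendsto_laplaceE_vertical hσ k c
  have hLR := (hL.sub hR).const_mul Complex.I
  have hval := tendsto_nhds_unique hlim (hLR.congr fun T => by
    have h1 := rect_integral_eq_zero (L := -T) (b := T) (y₀ := c) (y₁ := c + 2 * Real.pi)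
      hFd.differentiableOn
    have hcF := hFd.continuous
    simp only [Function.comp_def, id]
    rw [intervalIntegral.integral_sub (Continuous.intervalIntegrable (by fun_prop) _ _)
      (Continuous.intervalIntegrable (by fun_prop) _ _)]
    simp only [hF] at h1 ⊢
    linear_combination -h1)
  rw [hval, sub_zero, ← hnkC, Complex.Gamma_nat_eq_factorial]
  field_simp

theorem one_sub_exp_eq_zero_iff {p : ℕ} (hp : 1 ≤ p) (w ω : ℂ) :
    1 - Complex.exp (p * (w - ω)) = 0 ↔ ∃ n : ℤ, ω = w + 2 * Real.pi * n / p * Complex.I := by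
  have hp0 : (p : ℂ) ≠ 0 := by exact_mod_cast (by omega : p ≠ 0)
  rw [sub_eq_zero, eq_comm, Complex.exp_eq_one_iff]
  constructor
  · rintro ⟨n, hn⟩
    refine ⟨-n, ?_⟩
    field_simp
    push_cast
    linear_combination -hn
  · rintro ⟨n, rfl⟩
    refine ⟨-n, ?_⟩
    field_simp
    push_cast
    ring

/-- The zeros are spaced by 2πi/p, so a closed strip of height 2π/p with w in its interior contains
no other. -/
theorem one_sub_exp_ne_zero {p : ℕ} (hp : 1 ≤ p) {w ω : ℂ} {c : ℝ}
    (h1 : c < w.im) (h2 : w.im < c + 2 * Real.pi / p)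
    (hω : ω.im ∈ Icc c (c + 2 * Real.pi / p)) (hne : ω ≠ w) :
    1 - Complex.exp (p * (w - ω)) ≠ 0 := by
  have hp0 : (0 : ℝ) < p := by exact_mod_cast hp
  rw [Ne, one_sub_exp_eq_zero_iff hp]
  rintro ⟨n, hn⟩
  have him : ω.im = w.im + 2 * Real.pi / p * n := by
    rw [hn]
    have : (2 * Real.pi * n / p : ℂ) = ((2 * Real.pi * n / p : ℝ) : ℂ) := by push_cast; rfl
    rw [this]
    simp
    ring
  have hh : 0 < 2 * Real.pi / p := by positivity
  have hn0 : n = 0 := by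
    have a1 : 2 * Real.pi / p * (n : ℝ) < 2 * Real.pi / p * 1 := by linarith [hω.2]
    have a2 : 2 * Real.pi / p * (-1 : ℝ) < 2 * Real.pi / p * n := by linarith [hω.1]
    have b1 := lt_of_mul_lt_mul_left a1 hh.le
    have b2 := lt_of_mul_lt_mul_left a2 hh.le
    have b1' : n < 1 := by exact_mod_cast b1
    have b2' : -1 < n := by exact_mod_cast b2
    omega
  rw [hn0] at hn
  exact hne (by rw [hn]; simp)

/-- The residue theorem for `E(ω) / (1 - e ^ (p (w - ω)))` on a strip of height `2π / p`. -/
theorem tendsto_strip_integral {σ : ℝ} (hσ : 1 < σ) {p : ℕ} (hp : 1 ≤ p) {η : ℝ} (hη : 0 < η)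
    {w : ℂ} {c : ℝ} (h1 : c < w.im) (h2 : w.im < c + 2 * Real.pi / p)
    (hc1 : -(Real.pi / 2 * (σ - 1)) + η ≤ c)
    (hc2 : c + 2 * Real.pi / p ≤ 2 * Real.pi + Real.pi / 2 * (σ - 1) - η) :
    Tendsto (fun T : ℝ => ∫ t in (-T)..T, (laplaceE σ (t + c * Complex.I) -
      laplaceE σ (t + ((c + 2 * Real.pi / p : ℝ) : ℂ) * Complex.I)) /
        (1 - Complex.exp (p * (w - (t + c * Complex.I))))) atTop
      (𝓝 (2 * Real.pi * Complex.I / p * laplaceE σ w)) := by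
  have hp0 : (0 : ℝ) < p := by exact_mod_cast hp
  have hpC : (p : ℂ) ≠ 0 := by exact_mod_cast hp0.ne'
  have hσ0 : 0 < σ := by linarith
  have hπ := Real.pi_pos
  set h : ℝ := 2 * Real.pi / p with hh
  have hh0 : 0 < h := by positivity
  set D : ℂ → ℂ := fun ω => 1 - Complex.exp (p * (w - ω)) with hD
  have hDd : Differentiable ℂ D := by rw [hD]; fun_prop
  have hEd := differentiable_laplaceE hσ
  have hDw : D w = 0 := by simp [hD]
  have hslope : ∀ f : ℂ → ℂ, Differentiable ℂ f → Differentiable ℂ (dslope f w) := fun f hf =>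
    differentiableOn_univ.1 ((Complex.differentiableOn_dslope univ_mem).2 hf.differentiableOn)
  -- Subtracting the constant E(w) removes the pole: G = (E - E(w))/D with a removable singularity
  -- at w, so Cauchy's theorem applies in place of residues. The subtracted term E(w)/D cancels
  -- between the horizontal sides, since D has period 2πi/p. The residue reappears at the right end,
  -- where D → 1 and G → -E(w), while G → 0 at the left end.
  set G : ℂ → ℂ := fun ω => dslope (laplaceE σ) w ω / dslope D w ω with hG
  have hne : ∀ ω : ℂ, ω.im ∈ Icc c (c + h) → ω ≠ w → D ω ≠ 0 := fun ω hω hn =>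
    one_sub_exp_ne_zero hp h1 h2 hω hn
  have hslope_ne : ∀ ω : ℂ, ω.im ∈ Icc c (c + h) → dslope D w ω ≠ 0 := by
    intro ω hω
    rcases eq_or_ne ω w with rfl | hn
    · rw [dslope_same]
      have h3 : HasDerivAt D (-(Complex.exp (p * (ω - ω)) * (p * (-1)))) ω :=
        ((((hasDerivAt_id ω).const_sub ω).const_mul (p : ℂ)).cexp).const_sub 1
      rw [h3.deriv]
      simpa using hpC
    · rw [dslope_of_ne _ hn, slope_def_field, hDw, sub_zero]
      exact div_ne_zero (hne ω hω hn) (sub_ne_zero.2 hn)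
  have hGval : ∀ ω : ℂ, ω.im ∈ Icc c (c + h) → ω ≠ w →
      G ω = (laplaceE σ ω - laplaceE σ w) / D ω := by
    intro ω hω hn
    have := sub_ne_zero.2 hn
    simp only [hG]
    rw [dslope_of_ne _ hn, dslope_of_ne _ hn, slope_def_field, slope_def_field, hDw, sub_zero,
      div_div_div_cancel_right₀ this]
  have hGd : ∀ L b : ℝ, DifferentiableOn ℂ G (uIcc L b ×ℂ uIcc c (c + h)) := by
    intro L b ω hω
    refine DifferentiableAt.differentiableWithinAt ?_
    refine ((hslope _ hEd) ω).div ((hslope _ hDd) ω) (hslope_ne ω ?_)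
    have := (Complex.mem_reProdIm.1 hω).2
    rwa [uIcc_of_le (by linarith)] at this
  obtain ⟨K, hK, hKle⟩ := norm_laplaceE_le hσ hη
  obtain ⟨K', hK', hKle'⟩ := norm_laplaceE_le_exp hσ
  have him : ∀ T y : ℝ, (T + y * Complex.I : ℂ).im = y := fun T y => by simp
  have hre : ∀ T y : ℝ, (T + y * Complex.I : ℂ).re = T := fun T y => by simp
  have hnexp : ∀ T y : ℝ, ‖Complex.exp (p * (w - (T + y * Complex.I)))‖ =
      Real.exp (p * (w.re - T)) := by
    intro T y; rw [Complex.norm_exp]; simp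
  -- the left side
  have hleft : Tendsto (fun T : ℝ => ∫ y in c..(c + h), G (T + y * Complex.I)) atBot (𝓝 0) := by
    refine tendsto_vertical_integral (by linarith)
      (B := fun T => (K + ‖laplaceE σ w‖) / (Real.exp (p * (w.re - T)) - 1)) ?_ ?_
    · refine Tendsto.div_atTop tendsto_const_nhds (tendsto_atTop_add_const_right _ _ ?_)
      refine Real.tendsto_exp_atTop.comp (Tendsto.const_mul_atTop hp0 ?_)
      exact tendsto_atTop_add_const_left _ _ tendsto_neg_atBot_atTop
    · filter_upwards [eventually_lt_atBot w.re] with T hT y hy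
      have hyi : (T + y * Complex.I : ℂ).im ∈ Icc c (c + h) := by rw [him]; exact hy
      have hnw : (T + y * Complex.I : ℂ) ≠ w := fun he => by
        have := congrArg Complex.re he; rw [hre] at this; linarith
      rw [hGval _ hyi hnw, norm_div]
      have e1 : 1 < Real.exp (p * (w.re - T)) :=
        Real.one_lt_exp_iff.2 (mul_pos hp0 (by linarith))
      have e2 : Real.exp (p * (w.re - T)) - 1 ≤ ‖D (T + y * Complex.I)‖ := by
        rw [← hnexp T y, ← norm_one (α := ℂ), hD]
        simp only
        rw [norm_sub_rev]
        exact norm_sub_norm_le _ _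
      have e3 : ‖laplaceE σ (T + y * Complex.I)‖ ≤ K := hKle _ (by
        rw [him, abs_le]; constructor <;> linarith [hy.1, hy.2])
      refine div_le_div₀ (by positivity) ((norm_sub_le _ _).trans (by linarith)) (by linarith) e2
  -- the right side
  have hright : Tendsto (fun T : ℝ => ∫ y in c..(c + h), G (T + y * Complex.I)) atTop
      (𝓝 (-(laplaceE σ w) * h)) := by
    have h3 := tendsto_vertical_integral (l := atTop) (F := fun ω => G ω + laplaceE σ w)
      (by linarith : c ≤ c + h)
      (B := fun T => (K' * Real.exp (-(T / σ)) + ‖laplaceE σ w‖ * Real.exp (p * (w.re - T))) /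
        (1 - Real.exp (p * (w.re - T)))) ?_ ?_
    · have h4 := h3.add_const (-(laplaceE σ w) * h)
      rw [zero_add] at h4
      refine h4.congr fun T => ?_
      rw [intervalIntegral.integral_add, intervalIntegral.integral_const, Complex.real_smul]
      · push_cast; ring
      · refine ContinuousOn.intervalIntegrable ?_
        refine (hGd T T).continuousOn.comp (by fun_prop) fun y hy => ?_
        rw [Complex.mem_reProdIm, hre, him]
        exact ⟨left_mem_uIcc, hy⟩
      · exact intervalIntegrable_const
    · have t1 : Tendsto (fun T : ℝ => Real.exp (p * (w.re - T))) atTop (𝓝 0) := by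
        refine Real.tendsto_exp_atBot.comp (Tendsto.const_mul_atBot hp0 ?_)
        exact tendsto_atBot_add_const_left _ _ tendsto_neg_atTop_atBot
      have t2 : Tendsto (fun T : ℝ => Real.exp (-(T / σ))) atTop (𝓝 0) :=
        Real.tendsto_exp_neg_atTop_nhds_zero.comp (tendsto_id.atTop_div_const hσ0)
      have t3 := ((t2.const_mul K').add (t1.const_mul ‖laplaceE σ w‖)).div (t1.const_sub 1)
        (by norm_num)
      simpa [Pi.div_def] using t3
    · filter_upwards [eventually_gt_atTop w.re, eventually_ge_atTop 0] with T hT hT0 y hy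
      have hyi : (T + y * Complex.I : ℂ).im ∈ Icc c (c + h) := by rw [him]; exact hy
      have hnw : (T + y * Complex.I : ℂ) ≠ w := fun he => by
        have := congrArg Complex.re he; rw [hre] at this; linarith
      have hD0 := hne _ hyi hnw
      have e0 : G (T + y * Complex.I) + laplaceE σ w = (laplaceE σ (T + y * Complex.I) -
          laplaceE σ w * Complex.exp (p * (w - (T + y * Complex.I)))) / D (T + y * Complex.I) := by
        rw [hGval _ hyi hnw, eq_div_iff hD0, add_mul, div_mul_cancel₀ _ hD0]
        simp only [hD]
        ring
      rw [e0, norm_div]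
      have e1 : Real.exp (p * (w.re - T)) < 1 :=
        Real.exp_lt_one_iff.2 (mul_neg_of_pos_of_neg hp0 (by linarith))
      have e2 : 1 - Real.exp (p * (w.re - T)) ≤ ‖D (T + y * Complex.I)‖ := by
        rw [← hnexp T y, ← norm_one (α := ℂ)]
        exact norm_sub_norm_le _ _
      have e3 := hKle' (T + y * Complex.I) (by rw [hre]; exact hT0)
      rw [hre] at e3
      refine div_le_div₀ (by positivity) ((norm_sub_le _ _).trans ?_) (by linarith) e2
      rw [norm_mul, hnexp]
      linarith
  have hlim := ((hleft.comp tendsto_neg_atTop_atBot).sub hright).const_mul Complex.I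
  have hval : Complex.I * (0 - -(laplaceE σ w) * h) =
      2 * Real.pi * Complex.I / p * laplaceE σ w := by
    rw [hh]; push_cast; ring
  rw [hval] at hlim
  refine hlim.congr fun T => ?_
  have hrect := rect_integral_eq_zero (hGd (-T) T)
  have hGc : ∀ y ∈ Icc c (c + h), IntervalIntegrable (fun t : ℝ => G (t + y * Complex.I)) volume
      (-T) T := by
    intro y hy
    refine ContinuousOn.intervalIntegrable ?_
    refine (hGd (-T) T).continuousOn.comp (by fun_prop) fun t ht => ?_
    rw [Complex.mem_reProdIm, hre, him]
    exact ⟨ht, by rwa [uIcc_of_le (by linarith)]⟩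
  have hb : c ∈ Icc c (c + h) := ⟨le_rfl, by linarith⟩
  have ht : c + h ∈ Icc c (c + h) := ⟨by linarith, le_rfl⟩
  rw [← intervalIntegral.integral_sub (hGc c hb) (hGc (c + h) ht)] at hrect
  have hcong : ∫ t in (-T)..T, (G (t + c * Complex.I) - G (t + ((c + h : ℝ) : ℂ) * Complex.I)) =
      ∫ t in (-T)..T, (laplaceE σ (t + c * Complex.I) -
      laplaceE σ (t + ((c + h : ℝ) : ℂ) * Complex.I)) / D (t + c * Complex.I) := by
    refine intervalIntegral.integral_congr fun t _ => ?_
    rw [hGval _ (by rw [him]; exact hb) (fun he => by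
        have := congrArg Complex.im he; rw [him] at this; linarith),
      hGval _ (by rw [him]; exact ht) (fun he => by
        have := congrArg Complex.im he; rw [him] at this; linarith)]
    have hper : D (t + ((c + h : ℝ) : ℂ) * Complex.I) = D (t + c * Complex.I) := by
      simp only [hD]
      congr 1
      have : (p : ℂ) * (w - (t + ((c + h : ℝ) : ℂ) * Complex.I)) =
          p * (w - (t + c * Complex.I)) - 2 * Real.pi * Complex.I := by
        rw [hh]; push_cast; field_simp; ring
      rw [this, Complex.exp_sub, Complex.exp_two_pi_mul_I, div_one]
    rw [hper, ← sub_div]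
    congr 1
    ring
  rw [hcong] at hrect
  simp only [Function.comp_def]
  push_cast at hrect ⊢
  linear_combination -hrect

/-- The integral of the kernel against a simple pole. -/
theorem integral_laplaceE_sub_div {σ : ℝ} (hσ : 1 < σ) {p : ℕ} (hp : 1 ≤ p)
    {w : ℂ} {c : ℝ} (h1 : c < w.im) (h2 : w.im < c + 2 * Real.pi / p)
    (hc : |c| < Real.pi / 2 * (σ - 1))
    (hint : Integrable fun t : ℝ => (laplaceE σ (t + c * Complex.I) -
      laplaceE σ (t + c * Complex.I + 2 * Real.pi * Complex.I)) *
        (1 / (1 - Complex.exp (p * (w - (t + c * Complex.I)))))) :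
    ∫ t : ℝ, (laplaceE σ (t + c * Complex.I) -
      laplaceE σ (t + c * Complex.I + 2 * Real.pi * Complex.I)) *
        (1 / (1 - Complex.exp (p * (w - (t + c * Complex.I))))) =
    2 * Real.pi * Complex.I / p *
      ∑ j ∈ Finset.range p, laplaceE σ (w + 2 * Real.pi * j / p * Complex.I) := by
  have hp0 : (0 : ℝ) < p := by exact_mod_cast hp
  have hpC : (p : ℂ) ≠ 0 := by exact_mod_cast hp0.ne'
  have hπ := Real.pi_pos
  set h : ℝ := 2 * Real.pi / p with hh
  have hh0 : 0 < h := by positivity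
  have hph : p * h = 2 * Real.pi := by rw [hh]; field_simp
  have hlim := intervalIntegral_tendsto_integral hint tendsto_neg_atTop_atBot tendsto_id
  -- The strip of height 2π is cut into p strips of height 2π/p, the j-th containing the single pole
  -- w + 2πij/p. The denominator is the same on all dividing lines, so the differences telescope.
  have hstrip : ∀ j ∈ Finset.range p, _ := fun j hj =>
    tendsto_strip_integral hσ hp (η := Real.pi / 2 * (σ - 1) - |c|) (by linarith)
      (w := w + 2 * Real.pi * j / p * Complex.I) (c := c + j * h) (by
        have : (2 * Real.pi * j / p : ℂ) = ((j * h : ℝ) : ℂ) := by rw [hh]; push_cast; ring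
        rw [this]; simp; linarith) (by
        have : (2 * Real.pi * j / p : ℂ) = ((j * h : ℝ) : ℂ) := by rw [hh]; push_cast; ring
        rw [this]; simp; linarith) (by
        have : 0 ≤ (j : ℝ) * h := by positivity
        linarith [neg_abs_le c]) (by
        have : (j : ℝ) + 1 ≤ p := by exact_mod_cast Finset.mem_range.1 hj
        have h3 : ((j : ℝ) + 1) * h ≤ p * h := by gcongr
        linarith [le_abs_self c])
  have hsum := tendsto_finsetSum _ hstrip
  rw [← Finset.mul_sum] at hsum
  refine tendsto_nhds_unique hlim (hsum.congr fun T => ?_)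
  have hD0 : ∀ t : ℝ, 1 - Complex.exp (p * (w - (t + c * Complex.I))) ≠ 0 := fun t =>
    one_sub_exp_ne_zero hp h1 h2 (by simpa using hh0.le) (fun he => by
      have := congrArg Complex.im he; simp at this; linarith)
  have hD : ∀ (j : ℕ) (t : ℝ), 1 - Complex.exp (p * (w + 2 * Real.pi * j / p * Complex.I -
      (t + ((c + j * h : ℝ) : ℂ) * Complex.I))) =
      1 - Complex.exp (p * (w - (t + c * Complex.I))) := by
    intro j t
    congr 3
    rw [hh]; push_cast; ring
  simp only [hD]
  have hEc := (differentiable_laplaceE hσ).continuous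
  rw [← intervalIntegral.integral_finsetSum]
  · refine intervalIntegral.integral_congr fun t _ => ?_
    rw [← Finset.sum_div, mul_one_div]
    congr 1
    have htel := Finset.sum_range_sub' (fun j : ℕ =>
      laplaceE σ (t + ((c + j * h : ℝ) : ℂ) * Complex.I)) p
    have e1 : (t : ℂ) + ((c + p * h : ℝ) : ℂ) * Complex.I =
        t + c * Complex.I + 2 * Real.pi * Complex.I := by rw [hph]; push_cast; ring
    rw [e1] at htel
    simp only [Nat.cast_zero, zero_mul, add_zero] at htel
    rw [← htel]
    refine Finset.sum_congr rfl fun j _ => ?_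
    congr 3
    rw [hh]; push_cast; ring
  · intro j _
    refine Continuous.intervalIntegrable ?_ _ _
    exact Continuous.div (by fun_prop) (by fun_prop) hD0

/-! ### Elementary solutions and the contribution of the pole. -/

/-- An elementary solution with a pole of the initial value at `z₀`. -/
def rayTerm (σ : ℝ) (u z₀ w z : ℂ) : ℂ :=
  Complex.exp (u - w / σ) * momentInt σ 0 (Complex.exp (u - w / σ) * (z₀ - z)) 1

theorem differentiable_rayTerm {σ : ℝ} (hσ : 1 < σ) (u z₀ : ℂ) :
    Differentiable ℂ fun x : ℂ × ℂ => rayTerm σ u z₀ x.1 x.2 := by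
  have h0 := differentiable_momentInt hσ (s := 0) (by norm_num)
  have h1 : Differentiable ℂ fun x : ℂ × ℂ => Complex.exp (u - x.1 / σ) := by fun_prop
  have h2 : Differentiable ℂ fun x : ℂ × ℂ => Complex.exp (u - x.1 / σ) * (z₀ - x.2) := by fun_prop
  exact h1.mul (h0.comp h2)

/-- In the variable y = x exp(u - w/σ) the function is the integral of exp(-y(z₀ - z) - e^{-σu} y^σ
t) dy. Each ∂_t brings down -e^{-σu} y^σ = -x^σ/t. -/
theorem iterate_dt_rayTerm {σ : ℝ} (hσ : 1 < σ) (u z₀ : ℂ) (j : ℕ) :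
    dt^[j] (rayTerm σ u z₀) = fun w z => (-1) ^ j * Complex.exp (-(j * w)) *
      Complex.exp (u - w / σ) * momentInt σ (σ * j) (Complex.exp (u - w / σ) * (z₀ - z)) 1 := by
  have hσ0 : 0 < σ := by linarith
  have hσC : (σ : ℂ) ≠ 0 := by exact_mod_cast hσ0.ne'
  induction j with
  | zero => funext w z; simp [rayTerm]
  | succ j ih =>
    rw [Function.iterate_succ_apply', ih]
    funext w z
    have hs : -1 < σ * j := by
      have : 0 ≤ σ * j := by positivity
      linarith
    have hY : HasDerivAt (fun w : ℂ => Complex.exp (u - w / σ))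
        (Complex.exp (u - w / σ) * (-(1 / σ))) w :=
      (((hasDerivAt_id w).div_const (σ : ℂ)).const_sub u).cexp
    have hE : HasDerivAt (fun w : ℂ => Complex.exp (-(j * w)))
        (Complex.exp (-(j * w)) * (-(j * 1))) w :=
      (((hasDerivAt_id w).const_mul (j : ℂ)).neg).cexp
    have hM := (hasDerivAt_momentInt hσ hs (Complex.exp (u - w / σ) * (z₀ - z)) (B := 1)
      (by simp)).comp w (hY.mul_const (z₀ - z))
    have hall := ((hE.const_mul ((-1 : ℂ) ^ j)).mul hY).mul hM
    have hibp := momentInt_integration_by_parts hσ hs (Complex.exp (u - w / σ) * (z₀ - z))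
    rw [dt]
    have hd := hall.deriv
    simp only [Function.comp_def, Pi.mul_apply] at hd
    have hd' : deriv (fun w' : ℂ => (-1) ^ j * Complex.exp (-(j * w')) *
      Complex.exp (u - w' / σ) * momentInt σ (σ * j) (Complex.exp (u - w' / σ) * (z₀ - z)) 1) w = _ :=
      hd
    rw [hd']
    have hs2 : σ * ((j + 1 : ℕ) : ℝ) = σ * j + σ := by push_cast; ring
    have he : Complex.exp (-(((j + 1 : ℕ) : ℂ) * w)) = Complex.exp (-w) * Complex.exp (-(j * w)) := by
      rw [← Complex.exp_add]; congr 1; push_cast; ring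
    rw [hs2, he]
    push_cast at hibp
    set M := momentInt σ (σ * j) (Complex.exp (u - w / σ) * (z₀ - z)) 1
    set M1 := momentInt σ (σ * j + 1) (Complex.exp (u - w / σ) * (z₀ - z)) 1
    set M2 := momentInt σ (σ * j + σ) (Complex.exp (u - w / σ) * (z₀ - z)) 1
    set Y := Complex.exp (u - w / σ)
    -- Differentiating the kernel argument produces the moment M1; integration by parts eliminates
    -- it, the terms with M cancel and only M2 remains.
    have h2 : M2 = ((σ * j + 1) * M - Y * (z₀ - z) * M1) / σ := by
      rw [eq_div_iff hσC]; linear_combination -hibp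
    rw [h2]
    field_simp
    ring

theorem iteratedDeriv_rayTerm {σ : ℝ} (hσ : 1 < σ) (u z₀ w : ℂ) (n : ℕ) :
    iteratedDeriv n (rayTerm σ u z₀ w) = fun z => Complex.exp (u - w / σ) ^ (n + 1) *
      momentInt σ n (Complex.exp (u - w / σ) * (z₀ - z)) 1 := by
  induction n with
  | zero => funext z; simp [rayTerm]
  | succ n ih =>
    rw [iteratedDeriv_succ, ih]
    funext z
    have h1 : HasDerivAt (fun z : ℂ => Complex.exp (u - w / σ) * (z₀ - z))
        (Complex.exp (u - w / σ) * (-1)) z :=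
      ((hasDerivAt_id z).const_sub z₀).const_mul _
    have hM := (hasDerivAt_momentInt hσ (by linarith [n.cast_nonneg (α := ℝ)] : (-1 : ℝ) < n)
      (Complex.exp (u - w / σ) * (z₀ - z)) (B := 1) (by simp)).comp z h1
    have := (hM.const_mul (Complex.exp (u - w / σ) ^ (n + 1))).deriv
    simp only [Function.comp_def] at this
    rw [this]
    push_cast
    ring

/-- Both ∂_t^p and ∂_z^q multiply the exponential under the integral by y^q, because (-e^{-σu})^p =
1. -/
theorem rayTerm_pde {p q : ℕ} (hp : 1 ≤ p) (hpq : p < q) {u : ℂ}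
    (hu : Complex.exp (q * u) = (-1) ^ p) (z₀ w z : ℂ) :
    dt^[p] (rayTerm (q / p) u z₀) w z = iteratedDeriv q (rayTerm (q / p) u z₀ w) z := by
  have hp0 : (0 : ℝ) < p := by exact_mod_cast hp
  have hpC : (p : ℂ) ≠ 0 := by exact_mod_cast hp0.ne'
  have hqC : (q : ℂ) ≠ 0 := by exact_mod_cast (by omega : q ≠ 0)
  have hσ : 1 < (q / p : ℝ) := by rw [one_lt_div hp0]; exact_mod_cast hpq
  rw [iterate_dt_rayTerm hσ, iteratedDeriv_rayTerm hσ]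
  have h1 : (q / p : ℝ) * p = q := by field_simp
  have h2 : Complex.exp (u - w / ((q / p : ℝ) : ℂ)) ^ q = (-1) ^ p * Complex.exp (-(p * w)) := by
    rw [← hu, ← Complex.exp_nat_mul, ← Complex.exp_add]
    congr 1
    push_cast
    field_simp
    ring
  simp only
  rw [h1, pow_succ, h2]

/-- The behaviour of the derivatives of `rayTerm` as `t → 0`. -/
theorem rayTerm_limit {σ : ℝ} (hσ : 1 < σ) (u z₀ z L : ℂ) (hL : Complex.exp L = z₀ - z) (j : ℕ)
    {η : ℝ} (hη : 0 < η) : ∃ K > 0, ∀ w : ℂ,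
    |(u - w / σ + L).im| ≤ Real.pi / 2 * (1 + 1 / σ) - η →
    ‖dt^[j] (rayTerm σ u z₀) w z - (-1) ^ j * Complex.exp (-(σ * j * u) - (σ * j + 1) * L) *
      Complex.Gamma (σ * j + 1)‖ ≤ K * Real.exp w.re := by
  have hσ0 : 0 < σ := by linarith
  have hσC : (σ : ℂ) ≠ 0 := by exact_mod_cast hσ0.ne'
  have hs : -1 < σ * j := by
    have : 0 ≤ σ * j := by positivity
    linarith
  obtain ⟨K, hK, h⟩ := momentInt_asymptotic hσ hs 1 hη
  set C : ℂ := (-1) ^ j * Complex.exp (-(σ * j * u) - (σ * j + 1) * L) with hC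
  refine ⟨‖C‖ * (K * Real.exp (-(σ * (u + L).re))), ?_, fun w hw => ?_⟩
  · have : 0 < ‖C‖ := by rw [hC, norm_mul, norm_pow]; simp [Complex.norm_exp, Real.exp_pos]
    positivity
  · set a := u - w / σ + L with ha
    have h1 := h a hw
    rw [iterate_dt_rayTerm hσ]
    simp only
    have hA : Complex.exp (u - w / σ) * (z₀ - z) = Complex.exp a := by
      rw [← hL, ← Complex.exp_add]
    rw [hA]
    have h2 : (-1) ^ j * Complex.exp (-(j * w)) * Complex.exp (u - w / σ) =
        C * Complex.exp ((((σ * j : ℝ) : ℂ) + 1) * a) := by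
      rw [hC, mul_assoc, mul_assoc, ← Complex.exp_add, ← Complex.exp_add]
      congr 2
      rw [ha]; push_cast; field_simp; ring
    rw [h2, mul_assoc, ← mul_sub, norm_mul, mul_assoc]
    have h3 : -(σ * ((1 : ℕ) : ℝ) * a.re) = -(σ * (u + L).re) + w.re := by
      rw [ha]; simp [Complex.div_ofReal_re]; field_simp; ring
    rw [h3, Real.exp_add] at h1
    simp only [Finset.range_one, Finset.sum_singleton, pow_zero, Nat.factorial_zero, Nat.cast_one,
      div_one, one_mul, Nat.cast_zero, mul_zero, add_zero, zero_mul, neg_zero, Complex.exp_zero,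
      mul_one] at h1
    push_cast at h1 ⊢
    calc _ ≤ ‖C‖ * (K * (Real.exp (-(σ * (u + L).re)) * Real.exp w.re)) := by gcongr
      _ = _ := by ring

/-- The logarithms of the constants in the elementary solutions. -/
def poleAngle (p q : ℕ) (j : ℤ) : ℂ := ((Real.pi * p / q - 2 * Real.pi * j / q : ℝ) : ℂ) * Complex.I

/-- The part of the actual solution which comes from the pole. -/
def poleSum (p q : ℕ) (a z₀ : ℂ) (l : ℤ) (w z : ℂ) : ℂ :=
  -(a / p) * ∑ m ∈ Finset.range p, rayTerm (q / p) (poleAngle p q (m - (l - 1))) z₀ w z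

theorem exp_mul_poleAngle {p q : ℕ} (hq : 1 ≤ q) (j : ℤ) :
    Complex.exp (q * poleAngle p q j) = (-1) ^ p := by
  have hqC : (q : ℂ) ≠ 0 := by exact_mod_cast (by omega : q ≠ 0)
  have : (q : ℂ) * poleAngle p q j = p * (Real.pi * Complex.I) - j * (2 * Real.pi * Complex.I) := by
    rw [poleAngle]; push_cast; field_simp
  rw [this, Complex.exp_sub, Complex.exp_int_mul_two_pi_mul_I, Complex.exp_nat_mul,
    Complex.exp_pi_mul_I, div_one]

theorem differentiable_poleSum {p q : ℕ} (hp : 1 ≤ p) (hpq : p < q) (a z₀ : ℂ) (l : ℤ) :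
    Differentiable ℂ fun x : ℂ × ℂ => poleSum p q a z₀ l x.1 x.2 := by
  have hp0 : (0 : ℝ) < p := by exact_mod_cast hp
  have hσ : 1 < (q / p : ℝ) := by rw [one_lt_div hp0]; exact_mod_cast hpq
  exact (Differentiable.fun_sum fun m _ => differentiable_rayTerm hσ _ z₀).const_mul _

theorem rayTerm_poleAngle_add {p q : ℕ} (hq : 1 ≤ q) (z₀ w z : ℂ) (j : ℤ) :
    rayTerm (q / p) (poleAngle p q (j + q)) z₀ w z = rayTerm (q / p) (poleAngle p q j) z₀ w z := by
  have hqC : (q : ℂ) ≠ 0 := by exact_mod_cast (by omega : q ≠ 0)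
  have : Complex.exp (poleAngle p q (j + q) - w / ((q / p : ℝ) : ℂ)) =
      Complex.exp (poleAngle p q j - w / ((q / p : ℝ) : ℂ)) := by
    have h : poleAngle p q (j + q) = poleAngle p q j - 2 * Real.pi * Complex.I := by
      rw [poleAngle, poleAngle]; push_cast; field_simp; ring
    rw [h, sub_right_comm, Complex.exp_sub _ (2 * Real.pi * Complex.I), Complex.exp_two_pi_mul_I,
      div_one]
  rw [rayTerm, rayTerm, this]

/-- The rays depend on their index modulo q only, which limits the number of branches to q. -/
theorem poleSum_add {p q : ℕ} (hq : 1 ≤ q) (a z₀ : ℂ) (l n : ℤ) (w z : ℂ) :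
    poleSum p q a z₀ (l + q * n) w z = poleSum p q a z₀ l w z := by
  have hstep : ∀ l : ℤ, poleSum p q a z₀ (l + q) w z = poleSum p q a z₀ l w z := by
    intro l
    rw [poleSum, poleSum]
    congr 1
    refine Finset.sum_congr rfl fun m _ => ?_
    rw [← rayTerm_poleAngle_add hq]
    congr 2
    ring
  induction n using Int.induction_on with
  | zero => simp
  | succ n ih => rw [← ih, ← hstep (l + q * n)]; congr 1; ring
  | pred n ih => rw [← ih, ← hstep (l + q * (-n - 1))]; congr 1; ring

theorem poleSum_periodic {p q : ℕ} (hp : 1 ≤ p) (hq : 1 ≤ q) (a z₀ : ℂ) (l n : ℤ) (w z : ℂ) :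
    poleSum p q a z₀ l (w + n * (((2 * Real.pi * (q / p) : ℝ) : ℂ) * Complex.I)) z =
      poleSum p q a z₀ l w z := by
  have hpC : (p : ℂ) ≠ 0 := by exact_mod_cast (by omega : p ≠ 0)
  have hqC : (q : ℂ) ≠ 0 := by exact_mod_cast (by omega : q ≠ 0)
  rw [poleSum, poleSum]
  congr 1
  refine Finset.sum_congr rfl fun m _ => ?_
  have : ∀ u : ℂ, Complex.exp (u - (w + n * (((2 * Real.pi * (q / p) : ℝ) : ℂ) * Complex.I)) /
      ((q / p : ℝ) : ℂ)) = Complex.exp (u - w / ((q / p : ℝ) : ℂ)) := by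
    intro u
    have h : u - (w + n * (((2 * Real.pi * (q / p) : ℝ) : ℂ) * Complex.I)) / ((q / p : ℝ) : ℂ) =
        u - w / ((q / p : ℝ) : ℂ) - n * (2 * Real.pi * Complex.I) := by
      push_cast; field_simp; ring
    rw [h, Complex.exp_sub _ (n * _), Complex.exp_int_mul_two_pi_mul_I, div_one]
  rw [rayTerm, rayTerm, this]

/-- The jump of the solutions across a Stokes line, for an arbitrary integer index. -/
def poleJump (p q : ℕ) (a z₀ : ℂ) (l : ℤ) (w z : ℂ) : ℂ :=
  -(2 * Real.pi * Complex.I / (q * tpow p q w)) *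
    Complex.exp (2 * ((l : ℂ) - 1) * Real.pi * Complex.I / q) * a *
    kernelC (q / p)
      ((z₀ - z) * Complex.exp (2 * ((l : ℂ) - 1) * Real.pi * Complex.I / q) / tpow p q w)

/-- The two windows of p consecutive rays overlap except for one ray at each end. Those two lie at
angles ±π/σ from a common direction, so their difference is the kernel by `kernelC_eq`. -/
theorem poleSum_sub {p q : ℕ} (hp : 1 ≤ p) (hpq : p < q) (a z₀ : ℂ) (l : ℤ) (w z : ℂ) :
    poleSum p q a z₀ l w z - poleSum p q a z₀ (l - 1) w z = poleJump p q a z₀ l w z := by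
  have hp0 : (0 : ℝ) < p := by exact_mod_cast hp
  have hpC : (p : ℂ) ≠ 0 := by exact_mod_cast hp0.ne'
  have hqC : (q : ℂ) ≠ 0 := by exact_mod_cast (by omega : q ≠ 0)
  have hπC : (Real.pi : ℂ) ≠ 0 := by exact_mod_cast Real.pi_ne_zero
  have hI := Complex.I_ne_zero
  have hσ : 1 < (q / p : ℝ) := by rw [one_lt_div hp0]; exact_mod_cast hpq
  have htel := Finset.sum_range_sub' (fun m : ℕ =>
    rayTerm (q / p) (poleAngle p q (m - (l - 1))) z₀ w z) p
  rw [Finset.sum_sub_distrib] at htel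
  have h1 : ∀ m ∈ Finset.range p, rayTerm (q / p) (poleAngle p q (m - (l - 1 - 1))) z₀ w z =
      rayTerm (q / p) (poleAngle p q (((m + 1 : ℕ) : ℤ) - (l - 1))) z₀ w z := by
    intro m _; congr 2; push_cast; ring
  rw [poleSum, poleSum, Finset.sum_congr rfl h1, ← mul_sub, htel, poleJump, kernelC_eq hσ]
  set e := Complex.exp (2 * ((l : ℂ) - 1) * Real.pi * Complex.I / q) with he
  have ht0 : tpow p q w ≠ 0 := Complex.exp_ne_zero _
  have e1 : Complex.exp (poleAngle p q (((0 : ℕ) : ℤ) - (l - 1)) - w / ((q / p : ℝ) : ℂ)) =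
      e / tpow p q w * Complex.exp (Real.pi / ((q / p : ℝ) : ℂ) * Complex.I) := by
    rw [he, tpow, ← Complex.exp_sub, ← Complex.exp_add, poleAngle]
    congr 1
    push_cast
    field_simp
    ring
  have e2 : Complex.exp (poleAngle p q ((p : ℤ) - (l - 1)) - w / ((q / p : ℝ) : ℂ)) =
      e / tpow p q w * Complex.exp (-(Real.pi / ((q / p : ℝ) : ℂ) * Complex.I)) := by
    rw [he, tpow, ← Complex.exp_sub, ← Complex.exp_add, poleAngle]
    congr 1
    push_cast
    field_simp
    ring
  rw [rayTerm, rayTerm, e1, e2]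
  have e3 : ∀ x : ℂ, e / tpow p q w * x * (z₀ - z) = (z₀ - z) * e / tpow p q w * x := fun x => by
    ring
  rw [e3, e3]
  push_cast
  field_simp

/-! ### Calculus of ∂_t in the coordinate log t. -/

/-- `∂_t` for functions of `w = log t` only. -/
def dtOne (h : ℂ → ℂ) : ℂ → ℂ := fun w => Complex.exp (-w) * deriv h w

theorem iterate_dt_eq (f : ℂ → ℂ → ℂ) (j : ℕ) (w z : ℂ) :
    dt^[j] f w z = dtOne^[j] (fun w => f w z) w := by
  induction j generalizing w with
  | zero => rfl
  | succ j ih =>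
    rw [Function.iterate_succ_apply', Function.iterate_succ_apply', dt, dtOne]
    congr 2
    funext w'
    exact ih w'

theorem dtOne_eqOn {Ω : Set ℂ} (hΩ : IsOpen Ω) {f g : ℂ → ℂ} (h : EqOn f g Ω) :
    EqOn (dtOne f) (dtOne g) Ω := fun w hw => by
  rw [dtOne, dtOne, (h.eventuallyEq_of_mem (hΩ.mem_nhds hw)).deriv_eq]

theorem differentiableOn_iterate_dtOne {Ω : Set ℂ} (hΩ : IsOpen Ω) {f : ℂ → ℂ}
    (hf : DifferentiableOn ℂ f Ω) (j : ℕ) : DifferentiableOn ℂ (dtOne^[j] f) Ω := by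
  induction j with
  | zero => exact hf
  | succ j ih =>
    rw [Function.iterate_succ_apply']
    exact (Complex.differentiable_exp.comp differentiable_neg).differentiableOn.mul (ih.deriv hΩ)

theorem iterate_dtOne_add {Ω : Set ℂ} (hΩ : IsOpen Ω) {f g : ℂ → ℂ}
    (hf : DifferentiableOn ℂ f Ω) (hg : DifferentiableOn ℂ g Ω) (j : ℕ) :
    EqOn (dtOne^[j] fun w => f w + g w) (fun w => dtOne^[j] f w + dtOne^[j] g w) Ω := by
  induction j with
  | zero => exact fun _ _ => rfl
  | succ j ih =>
    intro w hw
    rw [Function.iterate_succ_apply', Function.iterate_succ_apply', Function.iterate_succ_apply',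
      dtOne_eqOn hΩ ih hw]
    simp only [dtOne]
    rw [deriv_fun_add ((differentiableOn_iterate_dtOne hΩ hf j).differentiableAt (hΩ.mem_nhds hw))
        ((differentiableOn_iterate_dtOne hΩ hg j).differentiableAt (hΩ.mem_nhds hw)), mul_add]

theorem iterate_dtOne_const_mul (c : ℂ) (f : ℂ → ℂ) (j : ℕ) :
    dtOne^[j] (fun w => c * f w) = fun w => c * dtOne^[j] f w := by
  induction j with
  | zero => rfl
  | succ j ih =>
    rw [Function.iterate_succ_apply', Function.iterate_succ_apply', ih]
    funext w
    simp only [dtOne, deriv_const_mul_field]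
    ring

theorem iterate_dtOne_sum {ι : Type*} (s : Finset ι) {f : ι → ℂ → ℂ}
    (hf : ∀ i, Differentiable ℂ (f i)) (j : ℕ) (w : ℂ) :
    dtOne^[j] (fun w => ∑ i ∈ s, f i w) w = ∑ i ∈ s, dtOne^[j] (f i) w := by
  classical
  induction s using Finset.induction_on with
  | empty =>
    simp only [Finset.sum_empty]
    have := iterate_dtOne_const_mul 0 (fun _ => 0) j
    simp only [zero_mul] at this
    rw [this]
  | insert i s hi ih =>
    simp only [Finset.sum_insert hi]
    rw [← ih]
    exact iterate_dtOne_add isOpen_univ (hf i).differentiableOn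
      (Differentiable.fun_sum fun i _ => hf i).differentiableOn j (mem_univ w)

/-- By the chain rule e^{-w} d/dw is d/dt at t = e^w; this transfers the single-valued entire part
to the covering. -/
theorem iterate_dtOne_comp_exp {U : Set ℂ} (hU : IsOpen U) {G : ℂ → ℂ} (hG : DifferentiableOn ℂ G U)
    (j : ℕ) : EqOn (dtOne^[j] fun w => G (Complex.exp w)) (fun w => iteratedDeriv j G (Complex.exp w))
      (Complex.exp ⁻¹' U) := by
  have hΩ : IsOpen (Complex.exp ⁻¹' U) := hU.preimage Complex.continuous_exp
  have hdiff : ∀ j, DifferentiableOn ℂ (iteratedDeriv j G) U := by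
    intro j
    induction j with
    | zero => simpa using hG
    | succ j ih => rw [iteratedDeriv_succ]; exact ih.deriv hU
  induction j with
  | zero => intro w _; simp
  | succ j ih =>
    intro w hw
    rw [Function.iterate_succ_apply', dtOne_eqOn hΩ ih hw, dtOne]
    have h := ((hdiff j).differentiableAt (hU.mem_nhds hw)).hasDerivAt.comp w
      (Complex.hasDerivAt_exp w)
    have h' := h.deriv
    simp only [Function.comp_def] at h'
    rw [h', iteratedDeriv_succ, mul_comm, mul_assoc, ← Complex.exp_add]
    simp

/-! ### The convergent solution for the entire part of the initial value. -/

theorem differentiableOn_tsum_of_norm_le {E : Type*} [NormedAddCommGroup E] [NormedSpace ℂ E]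
    {F : ℕ → E → ℂ} {U : Set E} (hU : IsOpen U) {u : ℕ → ℝ} (hu : Summable u)
    (hF : ∀ n, DifferentiableOn ℂ (F n) U) (hb : ∀ n, ∀ x ∈ U, ‖F n x‖ ≤ u n) :
    DifferentiableOn ℂ (fun x => ∑' n, F n x) U := by
  intro x hx
  obtain ⟨r, hr, hrU⟩ := Metric.isOpen_iff.1 hU x hx
  have hsub : ∀ y ∈ Metric.ball x (r / 2), Metric.ball y (r / 2) ⊆ U := fun y hy =>
    (Metric.ball_subset_ball' (by have := Metric.mem_ball.1 hy; linarith)).trans hrU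
  have hyU : ∀ y ∈ Metric.ball x (r / 2), y ∈ U := fun y hy =>
    hsub y hy (Metric.mem_ball_self (by positivity))
  -- On a ball of radius r/2 about y the term stays within 2 u n of its value at y, so Schwarz's
  -- lemma bounds its derivative by 2 u n / (r/2).
  refine (hasFDerivAt_tsum_of_isPreconnected (u := fun n => 2 * u n / (r / 2))
    ((hu.mul_left 2).div_const _) Metric.isOpen_ball (convex_ball x (r / 2)).isPreconnected
    (fun n y hy => ((hF n).differentiableAt (hU.mem_nhds (hyU y hy))).hasFDerivAt)
    (fun n y hy => ?_) (Metric.mem_ball_self (by positivity))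
    (Summable.of_norm_bounded hu fun n => hb n x hx)
    (Metric.mem_ball_self (by positivity))).differentiableAt.differentiableWithinAt
  refine Complex.norm_fderiv_le_div_of_mapsTo_ball ((hF n).mono (hsub y hy)) (fun y' hy' => ?_)
    (by positivity)
  rw [mem_closedBall_iff_norm]
  refine (norm_sub_le _ _).trans ?_
  have h1 := hb n y' (hsub y hy hy')
  have h2 := hb n y (hyU y hy)
  linarith

theorem iteratedDeriv_tendsto_of_tendstoUniformlyOn {F : ℕ → ℂ → ℂ} {f : ℂ → ℂ} {U : Set ℂ}
    (hU : IsOpen U) (h : TendstoUniformlyOn F f atTop U) (hF : ∀ n, DifferentiableOn ℂ (F n) U)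
    (j : ℕ) : ∀ x ∈ U, Tendsto (fun n => iteratedDeriv j (F n) x) atTop (𝓝 (iteratedDeriv j f x)) := by
  have key : (∀ n, DifferentiableOn ℂ (iteratedDeriv j (F n)) U) ∧
      TendstoLocallyUniformlyOn (fun n => iteratedDeriv j (F n)) (iteratedDeriv j f) atTop U := by
    induction j with
    | zero => simpa using ⟨hF, h.tendstoLocallyUniformlyOn⟩
    | succ j ih =>
      simp only [iteratedDeriv_succ]
      exact ⟨fun n => (ih.1 n).deriv hU,
        ih.2.deriv (Eventually.of_forall ih.1) hU⟩
  exact fun x hx => key.2.tendsto_at hx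

/-- The part of the solutions which comes from the entire part of the initial value. -/
def entirePart (p q : ℕ) (f : ℂ → ℂ) (t z : ℂ) : ℂ :=
  ∑' m : ℕ, iteratedDeriv (q * m) f z / ((p * m).factorial : ℂ) * t ^ (p * m)

theorem factorial_le_pow_mul_factorial {a b : ℕ} (h : a ≤ b) :
    b.factorial ≤ b ^ (b - a) * a.factorial := by
  obtain ⟨k, rfl⟩ := Nat.exists_eq_add_of_le h
  rw [← Nat.factorial_mul_ascFactorial, mul_comm, Nat.add_sub_cancel_left]
  exact Nat.mul_le_mul_right _ (Nat.ascFactorial_le_pow_add a k)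

/-- Cauchy estimates for the derivatives of an entire function of exponential growth. -/
theorem norm_iteratedDeriv_le_of_expGrowth {p q : ℕ} (hp : 1 ≤ p) (hpq : p < q) {f : ℂ → ℂ}
    (hf : EntireExpGrowth (q / (q - p)) f) {R : ℝ} (hR : 0 ≤ R) :
    ∃ A > 0, ∃ B > 0, ∀ m : ℕ, ∀ z ∈ Metric.ball (0 : ℂ) R,
      ‖iteratedDeriv (q * m) f z‖ ≤ A * B ^ m * (p * m).factorial := by
  obtain ⟨hd, C₁, hC₁, C₂, hC₂, hb⟩ := hf
  set s : ℝ := q / (q - p) with hs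
  have hqp : (0 : ℝ) < q - p := by
    have : (p : ℝ) < q := by exact_mod_cast hpq
    linarith
  have hq0 : (0 : ℝ) < q := by exact_mod_cast (by omega : 0 < q)
  have hp0 : (0 : ℝ) < p := by exact_mod_cast hp
  have hs0 : 0 < s := by positivity
  have hs1 : 1 ≤ s := by rw [hs, one_le_div hqp]; linarith
  refine ⟨C₁ * Real.exp (C₂ * (2 * R) ^ s), by positivity, Real.exp (C₂ * 2 ^ s * q), by positivity,
    fun m z hz => ?_⟩
  have hzR : ‖z‖ ≤ R := by simpa using (mem_ball_zero_iff.1 hz).le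
  rcases Nat.eq_zero_or_pos m with rfl | hm
  · simp only [mul_zero, iteratedDeriv_zero, pow_zero, mul_one, Nat.factorial_zero, Nat.cast_one]
    refine (hb z).trans ?_
    gcongr
    linarith
  have hqm : (0 : ℝ) < (q * m : ℕ) := by
    have : 0 < q * m := Nat.mul_pos (by omega) hm
    exact_mod_cast this
  -- Radius balancing the two factors in Cauchy's estimate: r^s = qm keeps the growth exp(C₂(2r)^s)
  -- geometric in m, and r^{qm} = (qm)^{(q-p)m} reduces (qm)! to (pm)!.
  set r : ℝ := ((q * m : ℕ) : ℝ) ^ (1 / s) with hr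
  have hr0 : 0 < r := by positivity
  have hrs : r ^ s = (q * m : ℕ) := by rw [hr, ← Real.rpow_mul hqm.le]; simp [hs0.ne']
  have hrq : r ^ (q * m) = ((q * m : ℕ) : ℝ) ^ (q * m - p * m) := by
    rw [hr, ← Real.rpow_natCast, ← Real.rpow_natCast, ← Real.rpow_mul hqm.le]
    congr 1
    rw [hs, Nat.cast_sub (Nat.mul_le_mul_right m hpq.le)]
    push_cast
    field_simp
  have hC := Complex.norm_iteratedDeriv_le_of_forall_mem_sphere_norm_le (q * m) hr0
    (hd.diffContOnCl (s := Metric.ball z r))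
    (C := C₁ * Real.exp (C₂ * (2 * R) ^ s) * Real.exp (C₂ * 2 ^ s * q) ^ m) (fun y hy => by
      refine (hb y).trans ?_
      rw [mul_assoc, ← Real.exp_nat_mul, ← Real.exp_add]
      gcongr
      have hy1 : ‖y‖ ≤ R + r := by
        have : ‖y - z‖ = r := by simpa [dist_eq_norm] using hy
        have h2 := norm_add_le z (y - z)
        simp only [add_sub_cancel] at h2
        linarith
      have h3 : ‖y‖ ^ s ≤ (2 * R) ^ s + (2 * r) ^ s := by
        rcases le_total R r with h | h
        · calc ‖y‖ ^ s ≤ (2 * r) ^ s := by gcongr; linarith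
            _ ≤ _ := by have : 0 ≤ (2 * R) ^ s := by positivity
                        linarith
        · calc ‖y‖ ^ s ≤ (2 * R) ^ s := by gcongr; linarith
            _ ≤ _ := by have : 0 ≤ (2 * r) ^ s := by positivity
                        linarith
      rw [Real.mul_rpow (by norm_num) hr0.le, hrs] at h3
      push_cast at h3
      calc C₂ * ‖y‖ ^ s ≤ C₂ * ((2 * R) ^ s + 2 ^ s * (q * m)) := by gcongr
        _ = _ := by ring)
  refine hC.trans ?_
  rw [hrq, div_le_iff₀ (by positivity)]
  have hfac : ((q * m).factorial : ℝ) ≤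
      ((q * m : ℕ) : ℝ) ^ (q * m - p * m) * (p * m).factorial := by
    exact_mod_cast factorial_le_pow_mul_factorial (Nat.mul_le_mul_right m hpq.le)
  set A := C₁ * Real.exp (C₂ * (2 * R) ^ s) * Real.exp (C₂ * 2 ^ s * q) ^ m with hA
  have hA0 : 0 ≤ A := by positivity
  calc ((q * m).factorial : ℝ) * A
      ≤ (((q * m : ℕ) : ℝ) ^ (q * m - p * m) * (p * m).factorial) * A := by gcongr
    _ = _ := by ring

/-- The series is dominated by a geometric one near the origin, so it may be differentiated
termwise; the equation is then a shift of the summation index by one. -/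
theorem entirePart_spec {p q : ℕ} (hp : 1 ≤ p) (hpq : p < q) {f : ℂ → ℂ}
    (hf : EntireExpGrowth (q / (q - p)) f) :
    ∃ r > 0, (∀ t ∈ Metric.ball (0 : ℂ) r, ∀ z ∈ Metric.ball (0 : ℂ) 1,
        HasSum (fun m : ℕ => iteratedDeriv (q * m) f z / ((p * m).factorial : ℂ) * t ^ (p * m))
          (entirePart p q f t z)) ∧
      DifferentiableOn ℂ (fun x : ℂ × ℂ => entirePart p q f x.1 x.2)
        (Metric.ball 0 r ×ˢ Metric.ball 0 1) ∧
      (∀ t ∈ Metric.ball (0 : ℂ) r, ∀ z ∈ Metric.ball (0 : ℂ) 1,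
        iteratedDeriv p (fun t => entirePart p q f t z) t = iteratedDeriv q (entirePart p q f t) z) ∧
      ∀ j < p, ∀ z ∈ Metric.ball (0 : ℂ) 1,
        iteratedDeriv j (fun t => entirePart p q f t z) 0 = if j = 0 then f z else 0 := by
  obtain ⟨A, hA, B, hB, hb⟩ := norm_iteratedDeriv_le_of_expGrowth hp hpq hf (R := 1) (by norm_num)
  have hdiff : ∀ n, Differentiable ℂ (iteratedDeriv n f) := fun n =>
    (hf.1.contDiff (n := ⊤)).differentiable_iteratedDeriv n (by simp)
  -- Since r ≤ 1, also r^p ≤ r, and the ratio B r^p is at most 1/2.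
  set r : ℝ := min 1 (1 / (2 * B)) with hr
  have hr0 : 0 < r := by positivity
  have hBr : B * r ^ p ≤ 1 / 2 := by
    have h1 : r ^ p ≤ r := by
      calc r ^ p ≤ r ^ 1 := pow_le_pow_of_le_one hr0.le (min_le_left _ _) hp
        _ = r := pow_one r
    have h2 : r ≤ 1 / (2 * B) := min_le_right _ _
    calc B * r ^ p ≤ B * (1 / (2 * B)) := by gcongr; exact h1.trans h2
      _ = 1 / 2 := by field_simp
  set F : ℕ → ℂ → ℂ → ℂ := fun m t z =>
    iteratedDeriv (q * m) f z / ((p * m).factorial : ℂ) * t ^ (p * m) with hF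
  have hsum : Summable fun m : ℕ => A * (1 / 2 : ℝ) ^ m :=
    (summable_geometric_of_lt_one (by norm_num) (by norm_num)).mul_left A
  have hbd : ∀ m, ∀ t ∈ Metric.ball (0 : ℂ) r, ∀ z ∈ Metric.ball (0 : ℂ) 1,
      ‖F m t z‖ ≤ A * (1 / 2 : ℝ) ^ m := by
    intro m t ht z hz
    have ht' : ‖t‖ ≤ r := by simpa using (mem_ball_zero_iff.1 ht).le
    have hfac : (0 : ℝ) < (p * m).factorial := by exact_mod_cast Nat.factorial_pos _
    rw [hF]
    simp only
    rw [norm_mul, norm_div, norm_pow, Complex.norm_natCast]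
    calc ‖iteratedDeriv (q * m) f z‖ / (p * m).factorial * ‖t‖ ^ (p * m)
        ≤ A * B ^ m * (p * m).factorial / (p * m).factorial * r ^ (p * m) := by
          gcongr; exact hb m z hz
      _ = A * (B * r ^ p) ^ m := by rw [mul_pow, pow_mul]; field_simp
      _ ≤ A * (1 / 2 : ℝ) ^ m := by gcongr
  have hFt : ∀ m z, Differentiable ℂ fun t => F m t z := fun m z => by rw [hF]; fun_prop
  have hFz : ∀ m t, Differentiable ℂ (F m t) := fun m t =>
    ((hdiff (q * m)).div_const _).mul_const _
  have hut : ∀ z ∈ Metric.ball (0 : ℂ) 1, TendstoUniformlyOn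
      (fun N t => ∑ m ∈ Finset.range N, F m t z) (fun t => entirePart p q f t z) atTop
      (Metric.ball 0 r) := fun z hz =>
    tendstoUniformlyOn_tsum_nat hsum fun m t ht => hbd m t ht z hz
  have huz : ∀ t ∈ Metric.ball (0 : ℂ) r, TendstoUniformlyOn
      (fun N z => ∑ m ∈ Finset.range N, F m t z) (entirePart p q f t) atTop
      (Metric.ball 0 1) := fun t ht =>
    tendstoUniformlyOn_tsum_nat hsum fun m z hz => hbd m t ht z hz
  have hdt : ∀ m j t z, iteratedDeriv j (fun t => F m t z) t =
      iteratedDeriv (q * m) f z / ((p * m).factorial : ℂ) *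
        ((p * m).descFactorial j * t ^ (p * m - j)) := by
    intro m j t z
    rw [hF]
    simp only
    rw [iteratedDeriv_const_mul_field, iteratedDeriv_pow]
  have hSt : ∀ N j t z, iteratedDeriv j (fun t => ∑ m ∈ Finset.range N, F m t z) t =
      ∑ m ∈ Finset.range N, iteratedDeriv (q * m) f z / ((p * m).factorial : ℂ) *
        ((p * m).descFactorial j * t ^ (p * m - j)) := by
    intro N j t z
    rw [iteratedDeriv_fun_sum fun m _ => (hFt m z).contDiff.contDiffAt]
    exact Finset.sum_congr rfl fun m _ => hdt m j t z
  have hSz : ∀ N j t z, iteratedDeriv j (fun z => ∑ m ∈ Finset.range N, F m t z) z =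
      ∑ m ∈ Finset.range N, iteratedDeriv (q * m + j) f z / ((p * m).factorial : ℂ) *
        t ^ (p * m) := by
    intro N j t z
    rw [iteratedDeriv_fun_sum fun m _ => (hFz m t).contDiff.contDiffAt]
    refine Finset.sum_congr rfl fun m _ => ?_
    have : F m t = fun z => (((p * m).factorial : ℂ)⁻¹ * t ^ (p * m)) * iteratedDeriv (q * m) f z := by
      funext z; rw [hF]; simp only; ring
    rw [this, iteratedDeriv_const_mul_field, iteratedDeriv_eq_iterate,
      iteratedDeriv_eq_iterate, ← Function.iterate_add_apply, ← iteratedDeriv_eq_iterate, add_comm j]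
    ring
  refine ⟨r, hr0, fun t ht z hz => (Summable.of_norm_bounded hsum fun m => hbd m t ht z hz).hasSum,
    ?_, ?_, ?_⟩
  · exact differentiableOn_tsum_of_norm_le (Metric.isOpen_ball.prod Metric.isOpen_ball) hsum
      (F := fun m (x : ℂ × ℂ) => F m x.1 x.2)
      (fun m => by
        have h1 : Differentiable ℂ fun x : ℂ × ℂ => iteratedDeriv (q * m) f x.2 :=
          (hdiff (q * m)).comp differentiable_snd
        have h2 : Differentiable ℂ fun x : ℂ × ℂ => x.1 ^ (p * m) := by fun_prop
        have h3 : Differentiable ℂ fun x : ℂ × ℂ =>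
            iteratedDeriv (q * m) f x.2 * ((p * m).factorial : ℂ)⁻¹ * x.1 ^ (p * m) :=
          (h1.mul_const _).mul h2
        simpa only [hF, div_eq_mul_inv] using h3.differentiableOn)
      fun m x hx => hbd m x.1 hx.1 x.2 hx.2
  · intro t ht z hz
    have h1 := (iteratedDeriv_tendsto_of_tendstoUniformlyOn Metric.isOpen_ball (hut z hz)
      (fun N => (Differentiable.fun_sum fun m _ => hFt m z).differentiableOn) p t ht)
    have h2 := (iteratedDeriv_tendsto_of_tendstoUniformlyOn Metric.isOpen_ball (huz t ht)
      (fun N => (Differentiable.fun_sum fun m _ => hFz m t).differentiableOn) q z hz)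
    -- N + 1 terms on the side of ∂_t^p are compared with N terms on the side of ∂_z^q, because
    -- ∂_t^p kills the term m = 0.
    refine tendsto_nhds_unique (h1.comp (tendsto_add_atTop_nat 1)) (h2.congr fun N => ?_)
    rw [Function.comp_apply, hSt, hSz, Finset.sum_range_succ']
    have h0 : (p * 0).descFactorial p = 0 := Nat.descFactorial_eq_zero_iff_lt.2 (by omega)
    rw [h0]
    simp only [Nat.cast_zero, zero_mul, mul_zero, add_zero]
    refine Finset.sum_congr rfl fun m _ => ?_
    have h3 : p * (m + 1) - p = p * m := by rw [mul_add]; omega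
    have h4 : ((p * (m + 1)).descFactorial p : ℂ) * (p * m).factorial = (p * (m + 1)).factorial := by
      have := Nat.factorial_mul_descFactorial (n := p * (m + 1)) (k := p) (by nlinarith)
      rw [h3] at this
      rw [mul_comm]
      exact_mod_cast this
    have h5 : ((p * m).factorial : ℂ) ≠ 0 := by exact_mod_cast Nat.factorial_ne_zero _
    have h6 : ((p * (m + 1)).factorial : ℂ) ≠ 0 := by exact_mod_cast Nat.factorial_ne_zero _
    rw [h3, mul_add, mul_one]
    field_simp
    rw [← h4]
    ring
  · intro j hj z hz
    have h1 := (iteratedDeriv_tendsto_of_tendstoUniformlyOn Metric.isOpen_ball (hut z hz)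
      (fun N => (Differentiable.fun_sum fun m _ => hFt m z).differentiableOn) j 0
      (Metric.mem_ball_self hr0))
    refine tendsto_nhds_unique (h1.comp (tendsto_add_atTop_nat 1))
      (tendsto_const_nhds.congr fun N => ?_)
    rw [Function.comp_apply, hSt, Finset.sum_range_succ', Finset.sum_eq_zero]
    · rcases Nat.eq_zero_or_pos j with rfl | h
      · simp
      · have : (p * 0).descFactorial j = 0 := Nat.descFactorial_eq_zero_iff_lt.2 (by omega)
        rw [this]
        simp [h.ne']
    · intro m _
      rw [zero_pow (by have : p ≤ p * (m + 1) := by nlinarith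
                       omega)]
      ring

/-! ### Integrals of the kernel against the entire part and against the pole. -/

theorem sum_range_root_pow {q : ℕ} {ω : ℂ} (hω : IsPrimitiveRoot ω q) (n : ℕ) :
    ∑ j ∈ Finset.range q, (ω ^ j) ^ n = if q ∣ n then (q : ℂ) else 0 := by
  have h1 : ∀ j ∈ Finset.range q, (ω ^ j) ^ n = (ω ^ n) ^ j := fun j _ => by
    rw [← pow_mul, ← pow_mul, mul_comm]
  rw [Finset.sum_congr rfl h1]
  split_ifs with h
  · rw [(hω.pow_eq_one_iff_dvd n).2 h]; simp
  · have hne : ω ^ n ≠ 1 := fun h' => h ((hω.pow_eq_one_iff_dvd n).1 h')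
    rw [geom_sum_eq hne, ← pow_mul, mul_comm, pow_mul, hω.pow_eq_one, one_pow, sub_self, zero_div]

theorem exp_two_mul_pi_eq_pow (q j : ℕ) : Complex.exp (2 * j * Real.pi * Complex.I / q) =
    Complex.exp (2 * Real.pi * Complex.I / q) ^ j := by
  rw [← Complex.exp_nat_mul]; congr 1; ring

theorem norm_exp_two_mul_pi (q j : ℕ) : ‖Complex.exp (2 * j * Real.pi * Complex.I / q)‖ = 1 := by
  rw [Complex.norm_exp]
  have : (2 * j * Real.pi * Complex.I / q : ℂ) = ((2 * j * Real.pi / q : ℝ) : ℂ) * Complex.I := by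
    push_cast; ring
  rw [this]; simp

/-- Summing the Taylor series over the q-th roots of unity keeps only the exponents divisible by q,
each with weight q. -/
theorem hasSum_sum_roots {q : ℕ} (hq : q ≠ 0) {f : ℂ → ℂ} {z y : ℂ} {R : ℝ}
    (hf : DifferentiableOn ℂ f (Metric.ball z R)) (hy : ‖y‖ < R) :
    HasSum (fun m : ℕ => q * (iteratedDeriv (q * m) f z / ((q * m).factorial : ℂ) * y ^ (q * m)))
      (∑ j ∈ Finset.range q, f (z + Complex.exp (2 * j * Real.pi * Complex.I / q) * y)) := by
  have hω := Complex.isPrimitiveRoot_exp q hq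
  set ω := Complex.exp (2 * Real.pi * Complex.I / q) with hωd
  have h1 : ∀ j ∈ Finset.range q, HasSum (fun n : ℕ => ((n.factorial : ℂ)⁻¹ * iteratedDeriv n f z *
      y ^ n) * (ω ^ j) ^ n) (f (z + Complex.exp (2 * j * Real.pi * Complex.I / q) * y)) := by
    intro j _
    have hmem : z + Complex.exp (2 * j * Real.pi * Complex.I / q) * y ∈ Metric.ball z R := by
      rw [Metric.mem_ball, dist_eq_norm, add_sub_cancel_left, norm_mul, norm_exp_two_mul_pi, one_mul]
      exact hy
    convert! Complex.hasSum_taylorSeries_on_ball hf hmem using 2 with n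
    rw [add_sub_cancel_left, exp_two_mul_pi_eq_pow, mul_pow]
    simp only [smul_eq_mul]
    ring
  have h2 := hasSum_sum h1
  simp only [← Finset.mul_sum, sum_range_root_pow hω] at h2
  have hinj : Function.Injective fun m : ℕ => q * m := fun a b h => Nat.eq_of_mul_eq_mul_left
    (Nat.pos_of_ne_zero hq) h
  rw [← hinj.hasSum_iff] at h2
  · convert! h2 using 2 with m
    simp only [Function.comp_apply, dvd_mul_right, if_true]
    ring
  · intro n hn
    rw [if_neg, mul_zero]
    rintro ⟨m, rfl⟩
    exact hn ⟨m, rfl⟩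

/-- Each summand is a finite geometric sum over 1 - X^q, and summing over the roots of unity keeps
only its constant term. This merges the q poles of the integrand into one function of X^q. -/
theorem sum_one_div_one_sub_root {q : ℕ} (hq : q ≠ 0) {X : ℂ} (hX : X ^ q ≠ 1) :
    ∑ j ∈ Finset.range q, 1 / (1 - Complex.exp (2 * j * Real.pi * Complex.I / q) * X) =
      q / (1 - X ^ q) := by
  have hω := Complex.isPrimitiveRoot_exp q hq
  set ω := Complex.exp (2 * Real.pi * Complex.I / q) with hωd
  have h0 : 1 - X ^ q ≠ 0 := sub_ne_zero.2 hX.symm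
  have h1 : ∀ j ∈ Finset.range q, 1 / (1 - Complex.exp (2 * j * Real.pi * Complex.I / q) * X) =
      ∑ i ∈ Finset.range q, (X ^ i / (1 - X ^ q)) * (ω ^ j) ^ i := by
    intro j _
    rw [exp_two_mul_pi_eq_pow]
    have hpow : (ω ^ j * X) ^ q = X ^ q := by
      rw [mul_pow, ← pow_mul, mul_comm j, pow_mul, hω.pow_eq_one, one_pow, one_mul]
    have hne : 1 - ω ^ j * X ≠ 0 := by
      intro h
      apply h0
      rw [← hpow, ← sub_eq_zero.1 h, one_pow, sub_self]
    have hg := mul_neg_geom_sum (ω ^ j * X) q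
    rw [hpow] at hg
    have h2 : ∑ i ∈ Finset.range q, (X ^ i / (1 - X ^ q)) * (ω ^ j) ^ i =
        (∑ i ∈ Finset.range q, (ω ^ j * X) ^ i) / (1 - X ^ q) := by
      rw [Finset.sum_div]
      refine Finset.sum_congr rfl fun i _ => ?_
      rw [mul_pow]
      ring
    rw [h2, div_eq_div_iff hne h0, one_mul, ← hg, mul_comm]
  rw [Finset.sum_congr rfl h1, Finset.sum_comm]
  simp only [← Finset.mul_sum, sum_range_root_pow hω]
  rw [Finset.sum_eq_single 0]
  · simp; ring
  · intro i hi hi0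
    rw [if_neg, mul_zero]
    intro hd
    exact absurd (Nat.le_of_dvd (Nat.pos_of_ne_zero hi0) hd) (by simpa using hi)
  · intro h; simp at h; exact absurd h hq

/-- The norm is the distance from the conjugate of e to the real point X. That distance is at least
|Im e|, and if Im e = 0 then e = -1 and it is at least 1. -/
theorem exists_le_norm_one_sub_mul {e : ℂ} (he : ‖e‖ = 1) (h1 : e ≠ 1) :
    ∃ d > 0, ∀ X : ℝ, 0 ≤ X → d ≤ ‖1 - X * e‖ := by
  have key : ∀ X : ℝ, ‖1 - X * e‖ = ‖star e - X‖ := by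
    intro X
    have : 1 - X * e = e * (star e - X) := by
      have h : e * star e = 1 := by
        rw [Complex.star_def, Complex.mul_conj, Complex.normSq_eq_norm_sq, he]; simp
      rw [mul_sub, h]; ring
    rw [this, norm_mul, he, one_mul]
  by_cases him : e.im = 0
  · refine ⟨1, one_pos, fun X hX => ?_⟩
    have hre : e.re = -1 := by
      have h2 : e.re * e.re + e.im * e.im = 1 := by
        rw [← Complex.normSq_apply, Complex.normSq_eq_norm_sq, he]; norm_num
      rw [him] at h2
      have h3 : (e.re - 1) * (e.re + 1) = 0 := by linarith
      rcases mul_eq_zero.1 h3 with h | h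
      · exact absurd (Complex.ext (by simpa using sub_eq_zero.1 h) (by simpa using him)) h1
      · linarith
    rw [key]
    have h4 := Complex.abs_re_le_norm (star e - X)
    simp only [Complex.sub_re, Complex.star_def, Complex.conj_re, hre, Complex.ofReal_re] at h4
    rw [Complex.star_def]
    rw [abs_of_nonpos (by linarith)] at h4
    linarith
  · refine ⟨|e.im|, abs_pos.2 him, fun X _ => ?_⟩
    rw [key]
    have h4 := Complex.abs_im_le_norm (star e - X)
    simpa using h4

theorem integrableOn_kernelC_mul_of_bounded {σ : ℝ} (hσ : 1 < σ) {ψ : ℝ}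
    (hψ : |ψ| < Real.pi / 2 * (1 - 1 / σ)) {f : ℝ → ℂ} (hf : ContinuousOn f (Ioi 0)) {M : ℝ}
    (hM : ∀ x, 0 < x → ‖f x‖ ≤ M) :
    IntegrableOn (fun x : ℝ => Complex.exp (ψ * Complex.I) *
      kernelC σ (x * Complex.exp (ψ * Complex.I)) * f x) (Ioi 0) := by
  obtain ⟨K, hK, c, hc, h⟩ := kernelC_decay hσ (η := Real.pi / 2 * (1 - 1 / σ) - |ψ|) (by linarith)
  have hs : 0 < σ / (σ - 1) := div_pos (by linarith) (by linarith)
  have hint : IntegrableOn (fun x : ℝ => K * Real.exp (-(c * x ^ (σ / (σ - 1)))) * M) (Ioi 0) := by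
    have := integrableOn_rpow_mul_exp_neg_mul_rpow (p := σ / (σ - 1)) (s := 0) (b := c) (by norm_num)
      hs hc
    simp only [Real.rpow_zero, one_mul] at this
    refine (this.const_mul (K * M)).congr (Filter.Eventually.of_forall fun x => ?_)
    simp only [neg_mul]
    ring
  refine Integrable.mono' hint ?_ ?_
  · refine ContinuousOn.aestronglyMeasurable ?_ measurableSet_Ioi
    have : Continuous fun x : ℝ => Complex.exp (ψ * Complex.I) *
        kernelC σ (x * Complex.exp (ψ * Complex.I)) :=
      continuous_const.mul ((differentiable_kernelC hσ).continuous.comp (by fun_prop))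
    exact this.continuousOn.mul hf
  · refine (ae_restrict_iff' measurableSet_Ioi).2 (Eventually.of_forall fun x hx => ?_)
    rw [norm_mul, norm_mul, Complex.norm_exp_ofReal_mul_I, one_mul]
    have h1 := h x hx ψ (by linarith)
    have h2 := hM x hx
    have : 0 ≤ ‖f x‖ := norm_nonneg _
    gcongr

/-- With N = (q-p)m the product (pm)! N! is at most (qm)!, and x^{qm} is the N-th power of
x^{q/(q-p)}; one term of an exponential series bounds the rest. The exponent q/(q-p) is the order of
decay of the kernel. -/
theorem factorial_div_le {p q : ℕ} (hpq : p < q) {c : ℝ} (hc : 0 < c) {x : ℝ} (hx : 0 < x) (m : ℕ) :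
    ((p * m).factorial : ℝ) / (q * m).factorial * x ^ (q * m) ≤
      ((1 / c) ^ (q - p)) ^ m * Real.exp (c * x ^ ((q : ℝ) / (q - p))) := by
  have hqp : (0 : ℝ) < q - p := by
    have : (p : ℝ) < q := by exact_mod_cast hpq
    linarith
  set N := (q - p) * m with hN
  have hsum : p * m + N = q * m := by rw [hN, ← add_mul]; congr 1; omega
  have h1 : ((p * m).factorial : ℝ) * N.factorial ≤ (q * m).factorial := by
    have : (p * m).factorial * N.factorial ≤ (p * m + N).factorial :=
      Nat.le_of_dvd (Nat.factorial_pos _) (Nat.factorial_mul_factorial_dvd_factorial_add _ _)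
    rw [hsum] at this
    exact_mod_cast this
  set X := x ^ ((q : ℝ) / (q - p)) with hX
  have hX0 : 0 < X := by positivity
  have hxX : x ^ (q * m) = X ^ N := by
    rw [hX, ← Real.rpow_natCast, ← Real.rpow_natCast, ← Real.rpow_mul hx.le]
    congr 1
    rw [hN]; push_cast [Nat.cast_sub hpq.le]; field_simp
  have h2 := Real.pow_div_factorial_le_exp (c * X) (by positivity) N
  have f1 : (0 : ℝ) < (p * m).factorial := by exact_mod_cast Nat.factorial_pos _
  have f2 : (0 : ℝ) < (q * m).factorial := by exact_mod_cast Nat.factorial_pos _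
  have f3 : (0 : ℝ) < N.factorial := by exact_mod_cast Nat.factorial_pos _
  calc ((p * m).factorial : ℝ) / (q * m).factorial * x ^ (q * m)
      ≤ 1 / N.factorial * X ^ N := by
        rw [hxX]
        gcongr ?_ * _
        rw [div_le_div_iff₀ f2 f3, one_mul]
        exact h1
    _ = (1 / c) ^ N * ((c * X) ^ N / N.factorial) := by
        rw [mul_pow, one_div_pow]; field_simp
    _ ≤ (1 / c) ^ N * Real.exp (c * X) := by gcongr
    _ = _ := by rw [hN, pow_mul]

theorem tpow_pow {p q : ℕ} (hq : q ≠ 0) (w : ℂ) (m : ℕ) :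
    tpow p q w ^ (q * m) = Complex.exp w ^ (p * m) := by
  have hqC : (q : ℂ) ≠ 0 := by exact_mod_cast hq
  rw [tpow, ← Complex.exp_nat_mul, ← Complex.exp_nat_mul]
  congr 1
  push_cast
  field_simp

/-- Termwise integration against the kernel replaces 1/(qm)! by 1/(pm)!, which undoes the modified
Borel transform. For small t half of the kernel's decay pays for the Taylor terms and the other half
keeps the integral convergent. -/
theorem integral_kernelC_mul_entire {p q : ℕ} (hp : 1 ≤ p) (hpq : p < q) {f : ℂ → ℂ}
    (hf : EntireExpGrowth (q / (q - p)) f) {η : ℝ} (hη : 0 < η) :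
    ∃ r > 0, ∀ ψ : ℝ, |ψ| ≤ Real.pi / 2 * (1 - 1 / (q / p : ℝ)) - η → ∀ w : ℂ, Real.exp w.re < r →
      ∀ z ∈ Metric.ball (0 : ℂ) 1,
      IntegrableOn (fun x : ℝ => Complex.exp (ψ * Complex.I) *
        kernelC (q / p) (x * Complex.exp (ψ * Complex.I)) *
        ∑ j ∈ Finset.range q, f (z + Complex.exp (2 * j * Real.pi * Complex.I / q) *
          (x * Complex.exp (ψ * Complex.I) * tpow p q w))) (Ioi 0) ∧
      ∫ x in Ioi (0 : ℝ), Complex.exp (ψ * Complex.I) *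
        kernelC (q / p) (x * Complex.exp (ψ * Complex.I)) *
        ∑ j ∈ Finset.range q, f (z + Complex.exp (2 * j * Real.pi * Complex.I / q) *
          (x * Complex.exp (ψ * Complex.I) * tpow p q w)) = q * entirePart p q f (Complex.exp w) z := by
  have hp0 : (0 : ℝ) < p := by exact_mod_cast hp
  have hq0 : q ≠ 0 := by omega
  have hqp : (0 : ℝ) < q - p := by
    have : (p : ℝ) < q := by exact_mod_cast hpq
    linarith
  have hσ : 1 < (q / p : ℝ) := by rw [one_lt_div hp0]; exact_mod_cast hpq
  obtain ⟨K, hK, c, hc, hdec⟩ := kernelC_decay hσ hη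
  have hs : (q / p : ℝ) / (q / p - 1) = q / (q - p) := by
    have : (q / p : ℝ) - 1 = (q - p) / p := by field_simp
    rw [this]; field_simp
  rw [hs] at hdec
  have hs0 : (0 : ℝ) < q / (q - p) := by
    have : (0 : ℝ) < q := by exact_mod_cast (by omega : 0 < q)
    positivity
  obtain ⟨A, hA, B, hB, hb⟩ := norm_iteratedDeriv_le_of_expGrowth hp hpq hf (R := 1) (by norm_num)
  -- The geometric ratio that `factorial_div_le` produces when given half of the decay rate c.
  set H : ℝ := (1 / (c / 2)) ^ (q - p) with hH
  have hH0 : 0 < H := by positivity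
  set r : ℝ := min 1 (1 / (2 * (B * H))) with hr
  have hr0 : 0 < r := by positivity
  obtain ⟨r₁, hr₁, hsum1, -⟩ := entirePart_spec hp hpq hf
  refine ⟨min r r₁, by positivity, fun ψ hψ w hw z hz => ?_⟩
  have hwr : Real.exp w.re ≤ r := (hw.trans_le (min_le_left _ _)).le
  have hwr1 : Complex.exp w ∈ Metric.ball (0 : ℂ) r₁ := by
    rw [mem_ball_zero_iff, Complex.norm_exp]; exact hw.trans_le (min_le_right _ _)
  have hBr : B * H * Real.exp w.re ^ p ≤ 1 / 2 := by
    have h1 : Real.exp w.re ^ p ≤ r := by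
      calc Real.exp w.re ^ p ≤ r ^ p := by gcongr
        _ ≤ r ^ 1 := pow_le_pow_of_le_one hr0.le (min_le_left _ _) hp
        _ = r := pow_one r
    calc B * H * Real.exp w.re ^ p ≤ B * H * (1 / (2 * (B * H))) := by
          gcongr; exact h1.trans (min_le_right _ _)
      _ = 1 / 2 := by field_simp
  set T := tpow p q w with hT
  set e := Complex.exp (ψ * Complex.I) with he
  have hen : ‖e‖ = 1 := by rw [he, Complex.norm_exp_ofReal_mul_I]
  set F : ℕ → ℝ → ℂ := fun m x => e * kernelC (q / p) (x * e) *
    (q * (iteratedDeriv (q * m) f z / ((q * m).factorial : ℂ) * (x * e * T) ^ (q * m))) with hF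
  set bd : ℕ → ℝ → ℝ := fun m x => (1 / 2 : ℝ) ^ m *
    (K * q * A * Real.exp (-(c / 2 * x ^ ((q : ℝ) / (q - p))))) with hbd
  have hTn : ∀ m, ‖T ^ (q * m)‖ = (Real.exp w.re ^ p) ^ m := by
    intro m; rw [hT, tpow_pow hq0, norm_pow, Complex.norm_exp, pow_mul]
  have hFb : ∀ m x, 0 < x → ‖F m x‖ ≤ bd m x := by
    intro m x hx
    have h1 := hdec x hx ψ hψ
    rw [hF, hbd]
    simp only
    rw [norm_mul, norm_mul, hen, one_mul, norm_mul, norm_mul, norm_div, mul_pow, norm_mul, hTn, norm_pow,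
      norm_mul, hen, mul_one, Complex.norm_natCast, Complex.norm_natCast, Complex.norm_real,
      Real.norm_of_nonneg hx.le]
    have h2 := hb m z hz
    have h3 := factorial_div_le hpq (c := c / 2) (by positivity) hx m
    have f1 : (0 : ℝ) < (q * m).factorial := by exact_mod_cast Nat.factorial_pos _
    calc ‖kernelC (q / p) (x * e)‖ * (q * (‖iteratedDeriv (q * m) f z‖ / (q * m).factorial *
          (x ^ (q * m) * (Real.exp w.re ^ p) ^ m)))
        ≤ K * Real.exp (-(c * x ^ ((q : ℝ) / (q - p)))) *
          (q * (A * B ^ m * (p * m).factorial / (q * m).factorial *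
          (x ^ (q * m) * (Real.exp w.re ^ p) ^ m))) := by gcongr
      _ = K * Real.exp (-(c * x ^ ((q : ℝ) / (q - p)))) * q * A * B ^ m * (Real.exp w.re ^ p) ^ m *
          ((p * m).factorial / (q * m).factorial * x ^ (q * m)) := by ring
      _ ≤ K * Real.exp (-(c * x ^ ((q : ℝ) / (q - p)))) * q * A * B ^ m * (Real.exp w.re ^ p) ^ m *
          (H ^ m * Real.exp (c / 2 * x ^ ((q : ℝ) / (q - p)))) := by gcongr
      _ = (B * H * Real.exp w.re ^ p) ^ m * (K * q * A *
          (Real.exp (-(c * x ^ ((q : ℝ) / (q - p)))) *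
            Real.exp (c / 2 * x ^ ((q : ℝ) / (q - p))))) := by
          rw [mul_pow, mul_pow]; ring
      _ = (B * H * Real.exp w.re ^ p) ^ m *
          (K * q * A * Real.exp (-(c / 2 * x ^ ((q : ℝ) / (q - p))))) := by
          rw [← Real.exp_add]; congr 3; ring
      _ ≤ _ := by gcongr
  have hgeo : Summable fun m : ℕ => (1 / 2 : ℝ) ^ m :=
    summable_geometric_of_lt_one (by norm_num) (by norm_num)
  have hFx : ∀ x : ℝ, HasSum (fun m => F m x) (e * kernelC (q / p) (x * e) *
      ∑ j ∈ Finset.range q, f (z + Complex.exp (2 * j * Real.pi * Complex.I / q) *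
        (x * e * T))) := fun x =>
    (hasSum_sum_roots hq0 (hf.1.differentiableOn (s := Metric.ball z (‖x * e * T‖ + 1)))
      (by linarith)).mul_left _
  have hbsum : ∀ x, ∑' m, bd m x = 2 * (K * q * A * Real.exp (-(c / 2 * x ^ ((q : ℝ) / (q - p))))) := by
    intro x
    rw [hbd]
    simp only
    rw [tsum_mul_right, tsum_geometric_of_lt_one (by norm_num) (by norm_num)]
    norm_num
  have hbint : IntegrableOn (fun x => ∑' m, bd m x) (Ioi 0) := by
    have := integrableOn_rpow_mul_exp_neg_mul_rpow (p := (q : ℝ) / (q - p)) (s := 0) (b := c / 2)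
      (by norm_num) hs0 (by positivity)
    simp only [Real.rpow_zero, one_mul] at this
    refine (this.const_mul (2 * (K * q * A))).congr (Filter.Eventually.of_forall fun x => ?_)
    simp only [hbsum, neg_mul]
    ring
  have hcF : ∀ m, Continuous (F m) := by
    intro m
    have h1 : Continuous fun x : ℝ => kernelC (q / p) (x * e) :=
      (differentiable_kernelC hσ).continuous.comp (by fun_prop)
    rw [hF]
    fun_prop
  have hmain := hasSum_integral_of_dominated_convergence (μ := volume.restrict (Ioi 0)) (F := F)
    bd (fun m => (hcF m).aestronglyMeasurable)
    (fun m => (ae_restrict_iff' measurableSet_Ioi).2 (Eventually.of_forall fun x hx => hFb m x hx))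
    (Eventually.of_forall fun x => hgeo.mul_right _) hbint
    (Eventually.of_forall fun x => hFx x)
  refine ⟨?_, hmain.unique ?_⟩
  · refine Integrable.mono' hbint ?_ ((ae_restrict_iff' measurableSet_Ioi).2
      (Eventually.of_forall fun x hx => ?_))
    · have h1 : Continuous fun x : ℝ => kernelC (q / p) (x * e) :=
        (differentiable_kernelC hσ).continuous.comp (by fun_prop)
      have h2 := hf.1.continuous
      refine Continuous.aestronglyMeasurable ?_
      fun_prop
    · rw [← (hFx x).tsum_eq]
      exact tsum_of_norm_bounded (hgeo.mul_right _).hasSum fun m => hFb m x hx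
  · have h3 := (hsum1 _ hwr1 z hz).mul_left (q : ℂ)
    convert! h3 using 2 with m
    have hnk : ((q * m : ℕ) : ℝ) = q / p * (p * m : ℕ) := by push_cast; field_simp
    have hψ' : |ψ| < Real.pi / 2 * (1 - 1 / (q / p : ℝ)) := by linarith
    have hint : IntegrableOn (fun x : ℝ => e * kernelC (q / p) (x * e) * (x * e) ^ (q * m)) (Ioi 0) := by
      have := integrableOn_rpow_mul_exp_neg_mul_rpow (p := (q : ℝ) / (q - p)) (s := (q * m : ℕ))
        (b := c) (by linarith [(q * m).cast_nonneg (α := ℝ)]) hs0 hc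
      refine Integrable.mono' (this.const_mul K) ?_ ((ae_restrict_iff' measurableSet_Ioi).2
        (Eventually.of_forall fun x hx => ?_))
      · have h1 : Continuous fun x : ℝ => kernelC (q / p) (x * e) :=
          (differentiable_kernelC hσ).continuous.comp (by fun_prop)
        refine Continuous.aestronglyMeasurable ?_
        fun_prop
      · have h1 := hdec x hx ψ hψ
        rw [norm_mul, norm_mul, hen, one_mul, norm_pow, norm_mul, hen, mul_one, Complex.norm_real,
          Real.norm_of_nonneg (le_of_lt hx), Real.rpow_natCast, neg_mul]
        calc _ ≤ K * Real.exp (-(c * x ^ ((q : ℝ) / (q - p)))) * x ^ (q * m) := by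
              have : 0 ≤ x := le_of_lt hx
              gcongr
          _ = _ := by ring
    have hmom := integral_kernelC_mul_pow hσ hψ' hnk hint
    rw [hF]
    have h4 : ∀ x : ℝ, e * kernelC (q / p) (x * e) *
        (q * (iteratedDeriv (q * m) f z / ((q * m).factorial : ℂ) * (x * e * T) ^ (q * m))) =
        q * (iteratedDeriv (q * m) f z / ((q * m).factorial : ℂ) * T ^ (q * m)) *
          (e * kernelC (q / p) (x * e) * (x * e) ^ (q * m)) := fun x => by
      rw [mul_pow]; ring
    simp only [h4]
    rw [integral_const_mul, hmom, hT, tpow_pow hq0]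
    have f1 : ((q * m).factorial : ℂ) ≠ 0 := by exact_mod_cast Nat.factorial_ne_zero _
    field_simp

/-- The logarithm log z₀ + log(1 - z/z₀) stays close to log z₀ even when z₀ lies on the negative
real axis, where the principal logarithm of z₀ - z jumps. -/
theorem exists_exp_eq_sub {z₀ : ℂ} (hz₀ : z₀ ≠ 0) {κ : ℝ} (hκ : 0 < κ) :
    ∃ ρ > 0, ∀ z ∈ Metric.ball (0 : ℂ) ρ, ∃ L : ℂ, Complex.exp L = z₀ - z ∧
      |L.im - Complex.arg z₀| < κ := by
  have hc : ContinuousAt (fun z : ℂ => Complex.arg (1 - z / z₀)) 0 := by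
    refine ContinuousAt.comp (g := Complex.arg) (Complex.continuousAt_arg (by simp)) ?_
    fun_prop
  have h1 : ∀ᶠ z in 𝓝 (0 : ℂ), |Complex.arg (1 - z / z₀)| < κ := by
    have := hc.abs.tendsto
    simp only [zero_div, sub_zero, Complex.arg_one, abs_zero] at this
    exact this.eventually (gt_mem_nhds hκ)
  have h2 : ∀ᶠ z in 𝓝 (0 : ℂ), 1 - z / z₀ ≠ 0 := by
    have : ContinuousAt (fun z : ℂ => 1 - z / z₀) 0 := by fun_prop
    exact this.eventually_ne (by simp)
  obtain ⟨ρ, hρ, h⟩ := Metric.eventually_nhds_iff_ball.1 (h1.and h2)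
  refine ⟨ρ, hρ, fun z hz => ⟨Complex.log z₀ + Complex.log (1 - z / z₀), ?_, ?_⟩⟩
  · rw [Complex.exp_add, Complex.exp_log hz₀, Complex.exp_log (h z hz).2]
    field_simp
  · simpa [Complex.log_im] using (h z hz).1

theorem exp_mul_I_ne_one {β : ℝ} {l : ℤ} (h1 : 2 * Real.pi * (l - 1) < β) (h2 : β < 2 * Real.pi * l) :
    Complex.exp (β * Complex.I) ≠ 1 := by
  intro h
  obtain ⟨n, hn⟩ := Complex.exp_eq_one_iff.1 h
  have h3 : β = n * (2 * Real.pi) := by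
    have := congrArg Complex.im hn
    simpa using this
  have hπ := Real.pi_pos
  rw [h3] at h1 h2
  have h4 : (l : ℝ) - 1 < n := by nlinarith
  have h5 : (n : ℝ) < l := by nlinarith
  have h6 : l - 1 < n := by exact_mod_cast h4
  have h7 : n < l := by exact_mod_cast h5
  omega

/-- At this ω the quantity A of `laplaceE` equals (z₀ - z) exp(poleAngle - w/σ); the residues of the
kernel integral are therefore elementary solutions. -/
theorem laplaceE_eq_rayTerm {p q : ℕ} (hp : 1 ≤ p) (hq : q ≠ 0) {L z₀ z : ℂ}
    (hL : Complex.exp L = z₀ - z) (l : ℤ) (j : ℕ) (w : ℂ) :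
    laplaceE (q / p) (w - q / p * L - 2 * Real.pi * (l - 1) / p * Complex.I +
      2 * Real.pi * j / p * Complex.I) =
    (z₀ - z) * rayTerm (q / p) (poleAngle p q (j - (l - 1))) z₀ w z := by
  have hpC : (p : ℂ) ≠ 0 := by exact_mod_cast (by omega : p ≠ 0)
  have hqC : (q : ℂ) ≠ 0 := by exact_mod_cast hq
  have h : Complex.exp ((Real.pi * Complex.I - (w - q / p * L - 2 * Real.pi * (l - 1) / p * Complex.I +
      2 * Real.pi * j / p * Complex.I)) / ((q / p : ℝ) : ℂ)) =
      Complex.exp (poleAngle p q (j - (l - 1)) - w / ((q / p : ℝ) : ℂ)) * (z₀ - z) := by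
    rw [← hL, ← Complex.exp_add, poleAngle]
    congr 1
    push_cast
    field_simp
    ring
  rw [laplaceE, h, rayTerm]
  ring

/-- The q poles combine into -(qa/ζ)/(1 - X^q) with X = s/ζ and ζ = z₀ - z. In the logarithmic
variable X^q is e^{p(w₀ - ω)}, so `integral_laplaceE_sub_div` evaluates the integral as a sum over p
poles. -/
theorem integral_kernelC_mul_pole {p q : ℕ} (hp : 1 ≤ p) (hpq : p < q) {a z₀ z L : ℂ}
    (hL : Complex.exp L = z₀ - z) {l : ℤ} {θ ψ : ℝ} {w : ℂ} (hψd : ψ = p / q * (θ - w.im))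
    (hψ : |ψ| < Real.pi / 2 * (1 - 1 / (q / p : ℝ)))
    (h1 : q / p * L.im + 2 * Real.pi * (l - 1) / p < θ) (h2 : θ < q / p * L.im + 2 * Real.pi * l / p) :
    (∀ x : ℝ, 0 < x → ∀ j : ℕ, z + Complex.exp (2 * j * Real.pi * Complex.I / q) *
      (x * Complex.exp (ψ * Complex.I) * tpow p q w) ≠ z₀) ∧
    IntegrableOn (fun x : ℝ => Complex.exp (ψ * Complex.I) *
      kernelC (q / p) (x * Complex.exp (ψ * Complex.I)) *
      ∑ j ∈ Finset.range q, a / (z + Complex.exp (2 * j * Real.pi * Complex.I / q) *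
        (x * Complex.exp (ψ * Complex.I) * tpow p q w) - z₀)) (Ioi 0) ∧
    ∫ x in Ioi (0 : ℝ), Complex.exp (ψ * Complex.I) *
      kernelC (q / p) (x * Complex.exp (ψ * Complex.I)) *
      ∑ j ∈ Finset.range q, a / (z + Complex.exp (2 * j * Real.pi * Complex.I / q) *
        (x * Complex.exp (ψ * Complex.I) * tpow p q w) - z₀) = q * poleSum p q a z₀ l w z := by
  have hπ := Real.pi_pos
  have hp0 : (0 : ℝ) < p := by exact_mod_cast hp
  have hpC : (p : ℂ) ≠ 0 := by exact_mod_cast hp0.ne'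
  have hq0 : q ≠ 0 := by omega
  have hqR : (0 : ℝ) < q := by exact_mod_cast Nat.pos_of_ne_zero hq0
  have hqC : (q : ℂ) ≠ 0 := by exact_mod_cast hq0
  have hσ : 1 < (q / p : ℝ) := by rw [one_lt_div hp0]; exact_mod_cast hpq
  set e := Complex.exp (ψ * Complex.I) with he
  set T := tpow p q w with hT
  set ζ := z₀ - z with hζ
  have hζ0 : ζ ≠ 0 := by rw [← hL]; exact Complex.exp_ne_zero _
  -- β is the argument of X^q along the ray. The hypotheses on θ place it strictly between 2π(l-1)
  -- and 2πl, so the ray meets no pole.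
  set β : ℝ := p * θ - q * L.im with hβ
  have hE : Complex.exp (β * Complex.I) ≠ 1 := by
    refine exp_mul_I_ne_one (l := l) ?_ ?_
    · have := mul_lt_mul_of_pos_left h1 hp0
      have h3 : (p : ℝ) * (q / p * L.im + 2 * Real.pi * (l - 1) / p) =
        q * L.im + 2 * Real.pi * (l - 1) := by field_simp
      rw [hβ]; linarith
    · have := mul_lt_mul_of_pos_left h2 hp0
      have h3 : (p : ℝ) * (q / p * L.im + 2 * Real.pi * l / p) =
        q * L.im + 2 * Real.pi * l := by field_simp
      rw [hβ]; linarith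
  have hXq : ∀ x : ℝ, 0 < x → (x * e * T / ζ) ^ q =
      ((Real.exp (q * Real.log x + p * w.re - q * L.re) : ℝ) : ℂ) * Complex.exp (β * Complex.I) := by
    intro x hx
    rw [← hL, he, hT, tpow]
    nth_rewrite 1 [← Real.exp_log hx]
    rw [Complex.ofReal_exp, ← Complex.exp_add, ← Complex.exp_add, ← Complex.exp_sub,
      ← Complex.exp_nat_mul, Complex.ofReal_exp, ← Complex.exp_add]
    congr 1
    apply Complex.ext
    · simp [hψd]; field_simp
    · simp [hψd, hβ]; field_simp; ring
  obtain ⟨d, hd, hdX⟩ := exists_le_norm_one_sub_mul (Complex.norm_exp_ofReal_mul_I β) hE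
  have hXd : ∀ x : ℝ, 0 < x → d ≤ ‖1 - (x * e * T / ζ) ^ q‖ := fun x hx => by
    rw [hXq x hx]; exact hdX _ (Real.exp_pos _).le
  have hX1 : ∀ x : ℝ, 0 < x → (x * e * T / ζ) ^ q ≠ 1 := fun x hx h => by
    have := hXd x hx
    rw [h] at this; simp at this; linarith
  have hsub : ∀ (x : ℝ) (j : ℕ), z + Complex.exp (2 * j * Real.pi * Complex.I / q) * (x * e * T) - z₀ =
      -ζ * (1 - Complex.exp (2 * j * Real.pi * Complex.I / q) * (x * e * T / ζ)) := by
    intro x j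
    rw [hζ] at hζ0 ⊢
    field_simp
    ring
  have hfac : ∀ x : ℝ, 0 < x → ∑ j ∈ Finset.range q,
      a / (z + Complex.exp (2 * j * Real.pi * Complex.I / q) * (x * e * T) - z₀) =
      -(a / ζ) * q * (1 / (1 - (x * e * T / ζ) ^ q)) := by
    intro x hx
    have := sum_one_div_one_sub_root hq0 (hX1 x hx)
    have h3 : ∀ j ∈ Finset.range q,
        a / (z + Complex.exp (2 * j * Real.pi * Complex.I / q) * (x * e * T) - z₀) =
        -(a / ζ) * (1 / (1 - Complex.exp (2 * j * Real.pi * Complex.I / q) * (x * e * T / ζ))) := by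
      intro j _
      rw [hsub, ← neg_div_neg_eq a, neg_mul, neg_neg, ← neg_div, div_mul_div_comm, mul_one]
    rw [Finset.sum_congr rfl h3, ← Finset.mul_sum, this]
    ring
  have hintf : IntegrableOn (fun x : ℝ => e * kernelC (q / p) (x * e) *
      (1 / (1 - (x * e * T / ζ) ^ q))) (Ioi 0) := by
    refine integrableOn_kernelC_mul_of_bounded hσ hψ (M := 1 / d) ?_ fun x hx => ?_
    · refine ContinuousOn.div (by fun_prop) (by fun_prop) fun x hx => sub_ne_zero.2 (hX1 x hx).symm
    · rw [norm_div, norm_one]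
      exact one_div_le_one_div_of_le hd (hXd x hx)
  have hcongr : ∀ x ∈ Ioi (0 : ℝ), e * kernelC (q / p) (x * e) * ∑ j ∈ Finset.range q,
      a / (z + Complex.exp (2 * j * Real.pi * Complex.I / q) * (x * e * T) - z₀) =
      -(a / ζ) * q * (e * kernelC (q / p) (x * e) * (1 / (1 - (x * e * T / ζ) ^ q))) := by
    intro x hx
    rw [hfac x hx]; ring
  refine ⟨fun x hx j h => ?_, ?_, ?_⟩
  · have h3 := hsub x j
    rw [h, sub_self] at h3
    rcases mul_eq_zero.1 h3.symm with h4 | h4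
    · exact hζ0 (neg_eq_zero.1 h4)
    · apply hX1 x hx
      have h5 := congrArg (· ^ q) (sub_eq_zero.1 h4).symm
      simp only [mul_pow, one_pow] at h5
      rwa [← Complex.exp_nat_mul, mul_div_cancel₀ _ hqC,
        (by ring : (2 * j * Real.pi * Complex.I : ℂ) = j * (2 * Real.pi * Complex.I)),
        Complex.exp_nat_mul_two_pi_mul_I, one_mul] at h5
  · exact IntegrableOn.congr_fun (hintf.const_mul _) (fun x hx => (hcongr x hx).symm)
      measurableSet_Ioi
  · rw [setIntegral_congr_fun measurableSet_Ioi hcongr, integral_const_mul]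
    have hk := integral_kernelC_eq hσ ψ (fun y => 1 / (1 - (y * T / ζ) ^ q)) hintf
    set c : ℝ := -((q / p : ℝ) * ψ) with hc
    have hcw : c = w.im - θ := by rw [hc, hψd]; field_simp; ring
    -- Among the zeros of 1 - X^q, which are spaced by 2πi/p, this one lies in the lowest of the p
    -- strips. Its choice is where the index l enters the sum of rays.
    set w₀ : ℂ := w - q / p * L - 2 * Real.pi * (l - 1) / p * Complex.I with hw₀
    have hw₀im : w₀.im = w.im - q / p * L.im - 2 * Real.pi * (l - 1) / p := by
      have h3 : w₀ = w - ((q / p : ℝ) : ℂ) * L - ((2 * Real.pi * (l - 1) / p : ℝ) : ℂ) * Complex.I := by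
        rw [hw₀]; push_cast; ring
      rw [h3]; simp only [Complex.sub_im, Complex.im_ofReal_mul,
        Complex.I_im, mul_one]
    have hexp : ∀ t : ℝ, (Complex.exp (-((t + (c : ℂ) * Complex.I) / ((q / p : ℝ) : ℂ))) * T / ζ) ^ q =
        Complex.exp (p * (w₀ - (t + c * Complex.I))) := by
      intro t
      rw [← hL, hT, tpow, ← Complex.exp_add, ← Complex.exp_sub, ← Complex.exp_nat_mul]
      have h3 : (p : ℂ) * (w₀ - (t + c * Complex.I)) = q * (-((t + (c : ℂ) * Complex.I) /
          ((q / p : ℝ) : ℂ)) + p / q * w - L) + (1 - l : ℤ) * (2 * Real.pi * Complex.I) := by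
        rw [hw₀]; push_cast; field_simp; ring
      rw [h3, Complex.exp_add, Complex.exp_int_mul_two_pi_mul_I, mul_one]
    simp only [hexp] at hk
    have hcabs : |c| < Real.pi / 2 * ((q / p : ℝ) - 1) := by
      have h3 : |c| = q / p * |ψ| := by
        rw [hc, abs_neg, abs_mul, abs_of_pos (by positivity : (0 : ℝ) < q / p)]
      rw [h3]
      calc (q / p : ℝ) * |ψ| < q / p * (Real.pi / 2 * (1 - 1 / (q / p : ℝ))) := by gcongr
        _ = _ := by field_simp
    have hlap := integral_laplaceE_sub_div hσ hp (w := w₀) (c := c)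
      (by rw [hcw, hw₀im]; linarith)
      (by
        have : 2 * Real.pi * l / p = 2 * Real.pi * (l - 1) / p + 2 * Real.pi / p := by ring
        rw [hcw, hw₀im]; linarith) hcabs hk.1
    rw [hk.2, hlap]
    have hS : ∀ j ∈ Finset.range p, laplaceE (q / p) (w₀ + 2 * Real.pi * j / p * Complex.I) =
        ζ * rayTerm (q / p) (poleAngle p q (j - (l - 1))) z₀ w z := fun j _ =>
      laplaceE_eq_rayTerm hp hq0 hL l j w
    rw [Finset.sum_congr rfl hS, ← Finset.mul_sum, poleSum]
    have hπC : (Real.pi : ℂ) ≠ 0 := by exact_mod_cast Real.pi_ne_zero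
    have hI := Complex.I_ne_zero
    field_simp

/-! ### The solution integral and the Ecalle operator in terms of the branches. -/

/-- Substitution s = X t^{p/q}: the kernel no longer depends on t, and the ray arg s = θp/q becomes
arg X = ψ. -/
theorem solIntegrand_scale {p q : ℕ} (hq : q ≠ 0) (φ : ℂ → ℂ) (θ : ℝ) (w z : ℂ)
    {ψ : ℝ} (hψ : ψ = p / q * (θ - w.im)) (x : ℝ) :
    Complex.exp (ψ * Complex.I) * kernelC (q / p) (x * Complex.exp (ψ * Complex.I)) *
      ∑ j ∈ Finset.range q, φ (z + Complex.exp (2 * j * Real.pi * Complex.I / q) *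
        (x * Complex.exp (ψ * Complex.I) * tpow p q w)) =
    Real.exp (p / q * w.re) / tpow p q w * solIntegrand p q φ θ w z (Real.exp (p / q * w.re) * x) := by
  have hqC : (q : ℂ) ≠ 0 := by exact_mod_cast hq
  have hT0 : tpow p q w ≠ 0 := Complex.exp_ne_zero _
  have h1 : (Real.exp (p / q * w.re) : ℂ) * Complex.exp (θ * p / q * Complex.I) =
      Complex.exp (ψ * Complex.I) * tpow p q w := by
    rw [tpow, hψ, Complex.ofReal_exp, ← Complex.exp_add, ← Complex.exp_add]
    congr 1
    apply Complex.ext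
    · simp
    · simp; ring
  have h2 : ((Real.exp (p / q * w.re) * x : ℝ) : ℂ) * Complex.exp (θ * p / q * Complex.I) =
      x * Complex.exp (ψ * Complex.I) * tpow p q w := by
    push_cast at h1 ⊢
    linear_combination (x : ℂ) * h1
  rw [solIntegrand, h2, mul_div_assoc (x * Complex.exp (ψ * Complex.I)), div_self hT0, mul_one]
  have h3 : (Real.exp (p / q * w.re) : ℂ) / tpow p q w * Complex.exp (θ * p / q * Complex.I) =
      Complex.exp (ψ * Complex.I) := by
    rw [div_mul_eq_mul_div, h1, mul_div_assoc, div_self hT0, mul_one]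
  rw [← h3]
  ring

theorem solInt_eq_integral {p q : ℕ} (hq : q ≠ 0) (φ : ℂ → ℂ) (θ : ℝ) (w z : ℂ)
    {ψ : ℝ} (hψ : ψ = p / q * (θ - w.im))
    (hint : IntegrableOn (fun x : ℝ => Complex.exp (ψ * Complex.I) *
      kernelC (q / p) (x * Complex.exp (ψ * Complex.I)) *
      ∑ j ∈ Finset.range q, φ (z + Complex.exp (2 * j * Real.pi * Complex.I / q) *
        (x * Complex.exp (ψ * Complex.I) * tpow p q w))) (Ioi 0)) :
    IntegrableOn (solIntegrand p q φ θ w z) (Ioi 0) ∧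
    solInt p q φ θ w z = 1 / q * ∫ x in Ioi (0 : ℝ), Complex.exp (ψ * Complex.I) *
      kernelC (q / p) (x * Complex.exp (ψ * Complex.I)) *
      ∑ j ∈ Finset.range q, φ (z + Complex.exp (2 * j * Real.pi * Complex.I / q) *
        (x * Complex.exp (ψ * Complex.I) * tpow p q w)) := by
  have hqC : (q : ℂ) ≠ 0 := by exact_mod_cast hq
  have hT0 : tpow p q w ≠ 0 := Complex.exp_ne_zero _
  simp only [solIntegrand_scale hq φ θ w z hψ] at hint ⊢
  set lam := Real.exp (p / q * w.re) with hlam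
  have hl0 : 0 < lam := Real.exp_pos _
  have hlC : (lam : ℂ) ≠ 0 := by exact_mod_cast hl0.ne'
  have h1 : IntegrableOn (fun x => solIntegrand p q φ θ w z (lam * x)) (Ioi 0) := by
    refine (hint.const_mul (tpow p q w / lam)).congr (Eventually.of_forall fun x => ?_)
    simp only
    field_simp
  rw [integrableOn_Ioi_comp_mul_left_iff _ _ hl0, mul_zero] at h1
  refine ⟨h1, ?_⟩
  rw [integral_const_mul, integral_comp_mul_left_Ioi _ _ hl0, mul_zero, solInt, Complex.real_smul]
  push_cast
  field_simp

/-- The branches of the actual solutions, on the universal covering. -/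
def solBranch (p q : ℕ) (a z₀ : ℂ) (f : ℂ → ℂ) (l : ℤ) (w z : ℂ) : ℂ :=
  entirePart p q f (Complex.exp w) z + poleSum p q a z₀ l w z

/-- Split φ into pole and entire part and use the two evaluations. The direction θ has to avoid the
poles, while |arg t - θ| has to keep arg X in the sector where the kernel decays. -/
theorem solInt_eq_solBranch {p q : ℕ} (hp : 1 ≤ p) (hpq : p < q) {a z₀ : ℂ} (hz₀ : z₀ ≠ 0)
    {f φ : ℂ → ℂ} (hf : EntireExpGrowth (q / (q - p)) f)
    (hφ : ∀ z, z ≠ z₀ → φ z = a / (z - z₀) + f z) {l : ℤ} {θ : ℝ}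
    (h1 : q / p * Complex.arg z₀ + 2 * (l - 1) * Real.pi / p < θ)
    (h2 : θ < q / p * Complex.arg z₀ + 2 * l * Real.pi / p) {α : ℝ} (hα : α < Real.pi * (q - p) / p) :
    ∃ r > 0, ∃ ρ > 0, ∀ w ∈ sector θ α r, ∀ z ∈ Metric.ball (0 : ℂ) ρ,
      IntegrableOn (solIntegrand p q φ θ w z) (Ioi 0) ∧
      solInt p q φ θ w z = solBranch p q a z₀ f l w z := by
  have hp0 : (0 : ℝ) < p := by exact_mod_cast hp
  have hq0 : q ≠ 0 := by omega
  have hqR : (0 : ℝ) < q := by exact_mod_cast Nat.pos_of_ne_zero hq0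
  have hqC : (q : ℂ) ≠ 0 := by exact_mod_cast hq0
  -- How far arg(z₀ - z) may move from arg z₀ before θ leaves the gap between two pole directions;
  -- this fixes the radius in z.
  set κ : ℝ := p / q * min (θ - (q / p * Complex.arg z₀ + 2 * (l - 1) * Real.pi / p))
    (q / p * Complex.arg z₀ + 2 * l * Real.pi / p - θ) with hκ
  have hκ0 : 0 < κ := by
    have : 0 < min (θ - (q / p * Complex.arg z₀ + 2 * (l - 1) * Real.pi / p))
      (q / p * Complex.arg z₀ + 2 * l * Real.pi / p - θ) := lt_min (by linarith) (by linarith)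
    positivity
  set η : ℝ := Real.pi / 2 * (1 - 1 / (q / p : ℝ)) - p / q * (α / 2) with hη
  have hη0 : 0 < η := by
    have h3 : Real.pi / 2 * (1 - 1 / (q / p : ℝ)) = p / q * ((Real.pi * (q - p) / p) / 2) := by
      field_simp
    rw [hη, h3, ← mul_sub]
    have : 0 < Real.pi * (q - p) / p / 2 - α / 2 := by linarith
    positivity
  obtain ⟨r, hr, hent⟩ := integral_kernelC_mul_entire hp hpq hf hη0
  obtain ⟨ρ, hρ, hlog⟩ := exists_exp_eq_sub hz₀ hκ0
  refine ⟨r, hr, min ρ 1, by positivity, fun w hw z hz => ?_⟩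
  have hz1 : z ∈ Metric.ball (0 : ℂ) 1 := Metric.ball_subset_ball (min_le_right _ _) hz
  obtain ⟨L, hL, hLim⟩ := hlog z (Metric.ball_subset_ball (min_le_left _ _) hz)
  set ψ : ℝ := p / q * (θ - w.im) with hψd
  have hψ : |ψ| ≤ Real.pi / 2 * (1 - 1 / (q / p : ℝ)) - η := by
    rw [hη, sub_sub_cancel, hψd, abs_mul, abs_of_pos (by positivity : (0 : ℝ) < p / q), abs_sub_comm]
    have := hw.2
    gcongr
  have hLq : |(q / p : ℝ) * L.im - q / p * Complex.arg z₀| <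
      min (θ - (q / p * Complex.arg z₀ + 2 * (l - 1) * Real.pi / p))
      (q / p * Complex.arg z₀ + 2 * l * Real.pi / p - θ) := by
    rw [← mul_sub, abs_mul, abs_of_pos (by positivity : (0 : ℝ) < q / p)]
    calc (q / p : ℝ) * |L.im - Complex.arg z₀| < q / p * κ := by gcongr
      _ = _ := by rw [hκ]; field_simp
  have hL1 := lt_of_lt_of_le hLq (min_le_left _ _)
  have hL2 := lt_of_lt_of_le hLq (min_le_right _ _)
  rw [abs_lt] at hL1 hL2
  have e1 : 2 * ((l : ℝ) - 1) * Real.pi / p = 2 * Real.pi * (l - 1) / p := by ring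
  have e2 : 2 * (l : ℝ) * Real.pi / p = 2 * Real.pi * l / p := by ring
  obtain ⟨hne, hi1, hI1⟩ := integral_kernelC_mul_pole hp hpq (a := a) hL (l := l) hψd
    (lt_of_le_of_lt hψ (by linarith)) (by linarith) (by linarith)
  obtain ⟨hi2, hI2⟩ := hent ψ hψ w hw.1 z hz1
  set e := Complex.exp (ψ * Complex.I) with he
  have hcongr : ∀ x ∈ Ioi (0 : ℝ), e * kernelC (q / p) (x * e) * ∑ j ∈ Finset.range q,
      φ (z + Complex.exp (2 * j * Real.pi * Complex.I / q) * (x * e * tpow p q w)) =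
      e * kernelC (q / p) (x * e) * ∑ j ∈ Finset.range q,
        a / (z + Complex.exp (2 * j * Real.pi * Complex.I / q) * (x * e * tpow p q w) - z₀) +
      e * kernelC (q / p) (x * e) * ∑ j ∈ Finset.range q,
        f (z + Complex.exp (2 * j * Real.pi * Complex.I / q) * (x * e * tpow p q w)) := by
    intro x hx
    rw [← mul_add, ← Finset.sum_add_distrib]
    congr 1
    exact Finset.sum_congr rfl fun j _ => hφ _ (hne x hx j)
  have hint := IntegrableOn.congr_fun (hi1.add hi2) (fun x hx => (hcongr x hx).symm) measurableSet_Ioi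
  obtain ⟨h3, h4⟩ := solInt_eq_integral hq0 φ θ w z hψd hint
  refine ⟨h3, ?_⟩
  rw [h4, setIntegral_congr_fun measurableSet_Ioi hcongr, integral_add hi1 hi2, hI1, hI2, solBranch]
  field_simp
  ring

/-- The Ecalle operator, for the modified Borel transform of the formal solution, is `solInt`. -/
theorem ecalle_eq_solInt {p q : ℕ} (hp : 1 ≤ p) (hpq : p < q) {φ : ℂ → ℂ} {k θ : ℝ}
    (hk : k = p / (q - p)) {g : ℂ → ℂ → ℂ} {w z : ℂ}
    (hg : ∀ s : ℂ, s.im = θ → g s z = 1 / q * ∑ j ∈ Finset.range q,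
      φ (z + Complex.exp (2 * j * Real.pi * Complex.I / q) * tpow p q s))
    (hint : IntegrableOn (solIntegrand p q φ θ w z) (Ioi 0)) :
    IntegrableOn (ecalleIntegrand k θ g w z) (Ioi 0) ∧
      ecalle k θ g w z = solInt p q φ θ w z := by
  have hp0 : (0 : ℝ) < p := by exact_mod_cast hp
  have hq0 : q ≠ 0 := by omega
  have hqR : (0 : ℝ) < q := by exact_mod_cast Nat.pos_of_ne_zero hq0
  have hqC : (q : ℂ) ≠ 0 := by exact_mod_cast hq0
  have hqp : (0 : ℝ) < q - p := by
    have : (p : ℝ) < q := by exact_mod_cast hpq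
    linarith
  have hT0 : tpow p q w ≠ 0 := Complex.exp_ne_zero _
  have hκ : k / (1 + k) = p / q := by rw [hk]; field_simp; ring
  have hκ' : (k + 1) / k = q / p := by rw [hk]; field_simp; ring
  have hν : (0 : ℝ) < p / q := by positivity
  -- Since k/(1+k) = p/q, the measure ds^{k/(1+k)} becomes the ordinary one under x ↦ x^{p/q}.
  have key : ∀ x ∈ Ioi (0 : ℝ), ((p / q : ℝ) * x ^ ((p / q : ℝ) - 1)) •
      ((1 / q : ℂ) * solIntegrand p q φ θ w z (x ^ (p / q : ℝ))) = ecalleIntegrand k θ g w z x := by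
    intro x hx
    have hx0 : 0 < x := hx
    have h1 : tpow p q (Real.log x + θ * Complex.I) =
        ((x ^ (p / q : ℝ) : ℝ) : ℂ) * Complex.exp (θ * p / q * Complex.I) := by
      rw [tpow, Real.rpow_def_of_pos hx0, Complex.ofReal_exp, ← Complex.exp_add]
      congr 1; push_cast; ring
    have h2 : Complex.exp (((p / q : ℝ) : ℂ) * (Real.log x + θ * Complex.I - w)) =
        ((x ^ (p / q : ℝ) : ℝ) : ℂ) * Complex.exp (θ * p / q * Complex.I) / tpow p q w := by
      rw [← h1, tpow, tpow, ← Complex.exp_sub]; congr 1; push_cast; ring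
    have h3 : Complex.exp (((p / q * θ : ℝ) : ℂ) * Complex.I) =
        Complex.exp (θ * p / q * Complex.I) := by congr 1; push_cast; ring
    rw [ecalleIntegrand, hκ, hκ', hg _ (by simp), h1, h2, h3, solIntegrand, Complex.real_smul]
    ring
  have hi : IntegrableOn (fun x : ℝ => (1 / q : ℂ) * solIntegrand p q φ θ w z x) (Ioi 0) :=
    hint.const_mul _
  rw [← integrableOn_Ioi_comp_rpow_iff _ hν.ne', abs_of_pos hν] at hi
  refine ⟨hi.congr_fun key measurableSet_Ioi, ?_⟩
  rw [ecalle, ← setIntegral_congr_fun measurableSet_Ioi key,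
    integral_comp_rpow_Ioi_of_pos (g := fun x => (1 / q : ℂ) * solIntegrand p q φ θ w z x) hν,
    integral_const_mul, solInt, hκ, Complex.exp_neg]
  have : Complex.exp (((p / q : ℝ) : ℂ) * w) = tpow p q w := by rw [tpow]; push_cast; rfl
  rw [this]
  field_simp

/-! ### The branches are actual solutions. -/

/-- The derivative of a P-periodic function is periodic, but each ∂_t carries a factor e^{-w}, so a
phase accumulates. It is unimodular for the imaginary periods in use. -/
theorem iterate_dtOne_add_period {h : ℂ → ℂ} {P : ℂ} (hP : ∀ w, h (w + P) = h w) (j : ℕ) (w : ℂ) :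
    dtOne^[j] h (w + P) = Complex.exp (-(j * P)) * dtOne^[j] h w := by
  induction j generalizing w with
  | zero => simp [hP]
  | succ j ih =>
    rw [Function.iterate_succ_apply', dtOne, dtOne, ← deriv_comp_add_const (dtOne^[j] h) P w, funext ih, deriv_const_mul_field, ← mul_assoc,
      ← mul_assoc, ← Complex.exp_add, ← Complex.exp_add]
    congr 2
    push_cast
    ring

theorem norm_exp_nat_mul_int_mul_period (j : ℕ) (n : ℤ) (x : ℝ) :
    ‖Complex.exp (-(j * (n * ((x : ℂ) * Complex.I))))‖ = 1 := by
  rw [Complex.norm_exp]; simp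

theorem sum_exp_two_pi_int {p : ℕ} (hp : p ≠ 0) (j : ℕ) (hj : j < p) (n : ℤ) :
    ∑ m ∈ Finset.range p, Complex.exp (2 * Real.pi * Complex.I * j * (m + n) / p) =
      if j = 0 then (p : ℂ) else 0 := by
  have hpC : (p : ℂ) ≠ 0 := by exact_mod_cast hp
  have h1 : ∀ m ∈ Finset.range p, Complex.exp (2 * Real.pi * Complex.I * j * (m + n) / p) =
      Complex.exp (2 * Real.pi * Complex.I * j * n / p) *
        (Complex.exp (2 * Real.pi * Complex.I / p) ^ m) ^ j := by
    intro m _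
    rw [← pow_mul, ← Complex.exp_nat_mul, ← Complex.exp_add]
    congr 1
    push_cast
    ring
  rw [Finset.sum_congr rfl h1, ← Finset.mul_sum, sum_range_root_pow (Complex.isPrimitiveRoot_exp p hp)]
  split_ifs with h2 h3 h3
  · simp [h3]
  · exact absurd (Nat.le_of_dvd (Nat.pos_of_ne_zero h3) h2) (by omega)
  · exact absurd (h3 ▸ dvd_zero p) h2
  · simp

theorem iterate_dt_poleSum {p q : ℕ} (hp : 1 ≤ p) (hpq : p < q) (a z₀ : ℂ) (l : ℤ) (j : ℕ) (w z : ℂ) :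
    dt^[j] (poleSum p q a z₀ l) w z = -(a / p) * ∑ m ∈ Finset.range p,
      dt^[j] (rayTerm (q / p) (poleAngle p q (m - (l - 1))) z₀) w z := by
  have hp0 : (0 : ℝ) < p := by exact_mod_cast hp
  have hσ : 1 < (q / p : ℝ) := by rw [one_lt_div hp0]; exact_mod_cast hpq
  simp only [iterate_dt_eq]
  have h1 : (fun w => poleSum p q a z₀ l w z) = fun w => -(a / p) * ∑ m ∈ Finset.range p,
      rayTerm (q / p) (poleAngle p q (m - (l - 1))) z₀ w z := rfl
  rw [h1, iterate_dtOne_const_mul]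
  simp only
  rw [iterate_dtOne_sum]
  intro m
  exact (differentiable_rayTerm hσ _ z₀).comp (differentiable_id.prodMk (differentiable_const z))

theorem poleSum_pde {p q : ℕ} (hp : 1 ≤ p) (hpq : p < q) (a z₀ : ℂ) (l : ℤ) (w z : ℂ) :
    dt^[p] (poleSum p q a z₀ l) w z = iteratedDeriv q (poleSum p q a z₀ l w) z := by
  have hp0 : (0 : ℝ) < p := by exact_mod_cast hp
  have hσ : 1 < (q / p : ℝ) := by rw [one_lt_div hp0]; exact_mod_cast hpq
  have h1 : poleSum p q a z₀ l w = fun z => -(a / p) * ∑ m ∈ Finset.range p,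
      rayTerm (q / p) (poleAngle p q (m - (l - 1))) z₀ w z := rfl
  have hd : ∀ m : ℕ, Differentiable ℂ (rayTerm (q / p) (poleAngle p q (m - (l - 1))) z₀ w) := fun m =>
    (differentiable_rayTerm hσ _ z₀).comp ((differentiable_const w).prodMk differentiable_id)
  rw [iterate_dt_poleSum hp hpq, h1, iteratedDeriv_const_mul_field,
    iteratedDeriv_fun_sum fun m _ => (hd m).contDiff.contDiffAt]
  congr 1
  exact Finset.sum_congr rfl fun m _ => rayTerm_pde hp hpq (exp_mul_poleAngle (by omega) _) z₀ w z

/-- Each ray has a limit for t → 0. The limits of the j-th derivatives differ by j-th powers of the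
p-th roots of unity: they cancel for 1 ≤ j < p, and for j = 0 they add up to a/(z - z₀). -/
theorem poleSum_limit {p q : ℕ} (hp : 1 ≤ p) (hpq : p < q) (a : ℂ) {z₀ z L : ℂ}
    (hL : Complex.exp L = z₀ - z) (l : ℤ) {j : ℕ} (hj : j < p) {η : ℝ} (hη : 0 < η) :
    ∃ K > 0, ∀ w : ℂ, (∀ m ∈ Finset.range p,
      |(poleAngle p q (m - (l - 1)) - w / ((q / p : ℝ) : ℂ) + L).im| ≤
        Real.pi / 2 * (1 + 1 / (q / p : ℝ)) - η) →
      ‖dt^[j] (poleSum p q a z₀ l) w z - (if j = 0 then a / (z - z₀) else 0)‖ ≤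
        K * Real.exp w.re := by
  have hp0 : (0 : ℝ) < p := by exact_mod_cast hp
  have hpC : (p : ℂ) ≠ 0 := by exact_mod_cast hp0.ne'
  have hqC : (q : ℂ) ≠ 0 := by exact_mod_cast (by omega : q ≠ 0)
  have hσ : 1 < (q / p : ℝ) := by rw [one_lt_div hp0]; exact_mod_cast hpq
  have hlim := fun m : ℕ => rayTerm_limit hσ (poleAngle p q (m - (l - 1))) z₀ z L hL j hη
  choose K hK hle using hlim
  refine ⟨‖a / p‖ * ∑ m ∈ Finset.range p, K m + 1, ?_, fun w hw => ?_⟩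
  · have : 0 ≤ ∑ m ∈ Finset.range p, K m := Finset.sum_nonneg fun m _ => (hK m).le
    positivity
  have hval : -(a / p) * ∑ m ∈ Finset.range p, (-1) ^ j * Complex.exp (-(((q / p : ℝ) : ℂ) * j *
      poleAngle p q (m - (l - 1))) - (((q / p : ℝ) : ℂ) * j + 1) * L) *
      Complex.Gamma (((q / p : ℝ) : ℂ) * j + 1) = if j = 0 then a / (z - z₀) else 0 := by
    have h1 : ∀ m ∈ Finset.range p, (-1) ^ j * Complex.exp (-(((q / p : ℝ) : ℂ) * j *
        poleAngle p q (m - (l - 1))) - (((q / p : ℝ) : ℂ) * j + 1) * L) *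
        Complex.Gamma (((q / p : ℝ) : ℂ) * j + 1) =
        Complex.exp (-((((q / p : ℝ) : ℂ) * j + 1) * L)) * Complex.Gamma (((q / p : ℝ) : ℂ) * j + 1) *
          Complex.exp (2 * Real.pi * Complex.I * j * (m + (1 - l : ℤ)) / p) := by
      intro m _
      have e1 : -(((q / p : ℝ) : ℂ) * j * poleAngle p q (m - (l - 1))) -
          (((q / p : ℝ) : ℂ) * j + 1) * L = -((((q / p : ℝ) : ℂ) * j + 1) * L) +
          (2 * Real.pi * Complex.I * j * (m + (1 - l : ℤ)) / p) - j * (Real.pi * Complex.I) := by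
        rw [poleAngle]; push_cast; field_simp; ring
      have e2 : ((-1 : ℂ) ^ j) * (-1) ^ j = 1 := by rw [← mul_pow]; simp
      have e3 : (-1 : ℂ) ^ j ≠ 0 := left_ne_zero_of_mul_eq_one e2
      rw [e1, Complex.exp_sub, Complex.exp_add, Complex.exp_nat_mul, Complex.exp_pi_mul_I]
      generalize (-1 : ℂ) ^ j = s at e3 ⊢
      generalize Complex.exp (2 * Real.pi * Complex.I * j * (m + (1 - l : ℤ)) / p) = y
      field_simp
    rw [Finset.sum_congr rfl h1, ← Finset.mul_sum, sum_exp_two_pi_int (by omega) j hj]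
    split_ifs with h0
    · subst h0
      have hne : z₀ - z ≠ 0 := by rw [← hL]; exact Complex.exp_ne_zero _
      have hne' : z - z₀ ≠ 0 := by rw [← neg_sub]; exact neg_ne_zero.2 hne
      simp [Complex.exp_neg, hL]
      rw [← neg_sub z z₀]
      field_simp
    · simp
  rw [iterate_dt_poleSum hp hpq, ← hval, ← mul_sub, ← Finset.sum_sub_distrib, norm_mul, norm_neg]
  calc _ ≤ ‖a / p‖ * ∑ m ∈ Finset.range p, K m * Real.exp w.re := by
        gcongr
        exact norm_sum_le_of_le _ fun m hm => hle m w (hw m hm)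
    _ = (‖a / p‖ * ∑ m ∈ Finset.range p, K m) * Real.exp w.re := by
        rw [← Finset.sum_mul]; ring
    _ ≤ _ := by
        have := Real.exp_pos w.re
        nlinarith

/-- Bounds for the angles of the elementary solutions near the bisecting direction of two
consecutive Stokes lines. -/
theorem abs_im_poleAngle_le {p q : ℕ} (hp : 1 ≤ p) (hpq : p < q) {z₀ L w : ℂ} {ε : ℝ}
    (hL : |L.im - Complex.arg z₀| < p / q * (ε / 4)) (l : ℤ)
    (hw : |w.im - (q / p * Complex.arg z₀ + 2 * (l - 1) * Real.pi / p + Real.pi / p)| ≤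
      (2 * Real.pi / p + Real.pi * (q - p) / p - ε) / 2) {m : ℕ} (hm : m ∈ Finset.range p) :
    |(poleAngle p q (m - (l - 1)) - w / ((q / p : ℝ) : ℂ) + L).im| ≤
      Real.pi / 2 * (1 + 1 / (q / p : ℝ)) - p / q * (ε / 4) := by
  have hπ := Real.pi_pos
  have hp0 : (0 : ℝ) < p := by exact_mod_cast hp
  have hq0 : (0 : ℝ) < q := by exact_mod_cast (by omega : 0 < q)
  set x : ℝ := w.im - (q / p * Complex.arg z₀ + 2 * (l - 1) * Real.pi / p + Real.pi / p) with hx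
  have him : (poleAngle p q (m - (l - 1)) - w / ((q / p : ℝ) : ℂ) + L).im =
      Real.pi * (p - 1 - 2 * m) / q - p / q * x + (L.im - Complex.arg z₀) := by
    rw [Complex.add_im, Complex.sub_im, Complex.div_ofReal_im, poleAngle, Complex.im_ofReal_mul,
      Complex.I_im, hx]
    push_cast
    field_simp
    ring
  have hm' : (m : ℝ) + 1 ≤ p := by exact_mod_cast Finset.mem_range.1 hm
  have hm0 : (0 : ℝ) ≤ m := m.cast_nonneg
  have h1 : |Real.pi * (p - 1 - 2 * m) / q| ≤ Real.pi * (p - 1) / q := by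
    rw [abs_div, abs_mul, abs_of_pos hπ, abs_of_pos hq0]
    gcongr
    rw [abs_le]; constructor <;> linarith
  have h2 : |p / q * x| ≤ p / q * ((2 * Real.pi / p + Real.pi * (q - p) / p - ε) / 2) := by
    rw [abs_mul, abs_of_pos (by positivity)]
    gcongr
  rw [him]
  have h3 := abs_add_le (Real.pi * (p - 1 - 2 * m) / q - p / q * x) (L.im - Complex.arg z₀)
  have h4 := abs_sub (Real.pi * (p - 1 - 2 * m) / q) (p / q * x)
  -- Spread of the p angles, half opening of V_l and error of arg(z₀ - z) add up to the admissible
  -- angle of `momentInt_asymptotic` less (p/q)(ε/4). This accounts for the opening 2π/p + π(q-p)/p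
  -- - ε.
  have h5 : Real.pi * (p - 1) / q + p / q * ((2 * Real.pi / p + Real.pi * (q - p) / p - ε) / 2) +
      p / q * (ε / 4) = Real.pi / 2 * (1 + 1 / (q / p : ℝ)) - p / q * (ε / 4) := by
    field_simp; ring
  linarith

theorem entirePart_exp_add_period {p q : ℕ} (hp : 1 ≤ p) (f : ℂ → ℂ) (n : ℤ) (w z : ℂ) :
    entirePart p q f (Complex.exp (w + n * (((2 * Real.pi * (q / p) : ℝ) : ℂ) * Complex.I))) z =
      entirePart p q f (Complex.exp w) z := by
  have hpC : (p : ℂ) ≠ 0 := by exact_mod_cast (by omega : p ≠ 0)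
  have h : (p : ℂ) * (w + n * (((2 * Real.pi * (q / p) : ℝ) : ℂ) * Complex.I)) =
      p * w + (n * q : ℤ) * (2 * Real.pi * Complex.I) := by push_cast; field_simp
  have h' : Complex.exp (w + n * (((2 * Real.pi * (q / p) : ℝ) : ℂ) * Complex.I)) ^ p =
      Complex.exp w ^ p := by
    rw [← Complex.exp_nat_mul, h, Complex.exp_add, Complex.exp_int_mul_two_pi_mul_I, mul_one,
      Complex.exp_nat_mul]
  simp only [entirePart, pow_mul, h']

theorem solBranch_periodic {p q : ℕ} (hp : 1 ≤ p) (hq : 1 ≤ q) (a z₀ : ℂ) (f : ℂ → ℂ) (l n : ℤ)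
    (w z : ℂ) : solBranch p q a z₀ f l (w + n * (((2 * Real.pi * (q / p) : ℝ) : ℂ) * Complex.I)) z =
      solBranch p q a z₀ f l w z := by
  rw [solBranch, solBranch, entirePart_exp_add_period hp, poleSum_periodic hp hq]

theorem differentiable_poleSum_left {p q : ℕ} (hp : 1 ≤ p) (hpq : p < q) (a z₀ : ℂ) (l : ℤ) (z : ℂ) :
    Differentiable ℂ fun w => poleSum p q a z₀ l w z :=
  Differentiable.comp (g := fun x : ℂ × ℂ => poleSum p q a z₀ l x.1 x.2)
    (f := fun w : ℂ => ((w, z) : ℂ × ℂ)) (differentiable_poleSum hp hpq a z₀ l) (by fun_prop)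

theorem differentiable_poleSum_right {p q : ℕ} (hp : 1 ≤ p) (hpq : p < q) (a z₀ : ℂ) (l : ℤ) (w : ℂ) :
    Differentiable ℂ (poleSum p q a z₀ l w) :=
  Differentiable.comp (g := fun x : ℂ × ℂ => poleSum p q a z₀ l x.1 x.2)
    (f := fun z : ℂ => ((w, z) : ℂ × ℂ)) (differentiable_poleSum hp hpq a z₀ l) (by fun_prop)

theorem iterate_dt_solBranch {p q : ℕ} (hp : 1 ≤ p) (hpq : p < q) (a z₀ : ℂ) {f : ℂ → ℂ} {r : ℝ}
    {z : ℂ} (hV : DifferentiableOn ℂ (fun t => entirePart p q f t z) (Metric.ball 0 r))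
    (l : ℤ) (j : ℕ) {w : ℂ} (hw : Complex.exp w ∈ Metric.ball (0 : ℂ) r) :
    dt^[j] (solBranch p q a z₀ f l) w z =
      iteratedDeriv j (fun t => entirePart p q f t z) (Complex.exp w) +
        dt^[j] (poleSum p q a z₀ l) w z := by
  have hop : IsOpen (Complex.exp ⁻¹' Metric.ball (0 : ℂ) r) :=
    Metric.isOpen_ball.preimage Complex.continuous_exp
  have hdpole := differentiable_poleSum_left hp hpq a z₀ l z
  rw [iterate_dt_eq, iterate_dt_eq]
  have hE : DifferentiableOn ℂ (fun w => entirePart p q f (Complex.exp w) z)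
      (Complex.exp ⁻¹' Metric.ball (0 : ℂ) r) :=
    DifferentiableOn.comp (g := fun t => entirePart p q f t z) hV
      Complex.differentiable_exp.differentiableOn (fun w hw => hw)
  have h0 : (fun w => solBranch p q a z₀ f l w z) =
    fun w => entirePart p q f (Complex.exp w) z + poleSum p q a z₀ l w z := rfl
  rw [h0, iterate_dtOne_add hop hE hdpole.differentiableOn j hw]
  beta_reduce
  rw [iterate_dtOne_comp_exp (G := fun t => entirePart p q f t z) Metric.isOpen_ball hV j hw]

theorem poleSum_tendsto {p q : ℕ} (hp : 1 ≤ p) (hpq : p < q) (a : ℂ) {z₀ z L : ℂ}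
    (hL : Complex.exp L = z₀ - z) {ε : ℝ} (hε : 0 < ε)
    (hLim : |L.im - Complex.arg z₀| < p / q * (ε / 4)) (l : ℤ) {S : Set ℂ}
    (hS : ∀ w ∈ S, ∃ n : ℤ, ∃ w' : ℂ,
      w = w' + n * (((2 * Real.pi * (q / p) : ℝ) : ℂ) * Complex.I) ∧
      |w'.im - (q / p * Complex.arg z₀ + 2 * (l - 1) * Real.pi / p + Real.pi / p)| ≤
        (2 * Real.pi / p + Real.pi * (q - p) / p - ε) / 2) {j : ℕ} (hj : j < p) :
    Tendsto (fun w => dt^[j] (poleSum p q a z₀ l) w z)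
      (comap Complex.re atBot ⊓ 𝓟 S) (𝓝 (if j = 0 then a / (z - z₀) else 0)) := by
  have hp0 : (0 : ℝ) < p := by exact_mod_cast hp
  have hqR : (0 : ℝ) < q := by exact_mod_cast (by omega : 0 < q)
  obtain ⟨K, hK, hle⟩ := poleSum_limit hp hpq a hL l hj (η := p / q * (ε / 4)) (by positivity)
  have hle' : ∀ w ∈ S, ‖dt^[j] (poleSum p q a z₀ l) w z - (if j = 0 then a / (z - z₀) else 0)‖ ≤
      K * Real.exp w.re := by
    intro w hw
    obtain ⟨n, w', rfl, hw'⟩ := hS w hw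
    have h1 := hle w' fun m hm => abs_im_poleAngle_le hp hpq hLim l hw' hm
    have h2 := iterate_dtOne_add_period (h := fun w => poleSum p q a z₀ l w z)
      (fun w => poleSum_periodic hp (by omega) a z₀ l n w z) j w'
    rw [iterate_dt_eq, h2, ← iterate_dt_eq]
    have h3 : (w' + n * (((2 * Real.pi * (q / p) : ℝ) : ℂ) * Complex.I)).re = w'.re := by simp
    rw [h3]
    refine le_of_eq_of_le ?_ h1
    -- At j = 0 the phase is 1; for j ≥ 1 the limit is 0 and the phase does no harm.
    split_ifs with h0
    · subst h0; simp
    · rw [sub_zero, sub_zero, norm_mul, norm_exp_nat_mul_int_mul_period, one_mul]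
  rw [tendsto_iff_norm_sub_tendsto_zero]
  have h1 : Tendsto (fun w : ℂ => K * Real.exp w.re) (comap Complex.re atBot ⊓ 𝓟 S) (𝓝 0) := by
    have := (Real.tendsto_exp_atBot.comp (tendsto_comap (f := Complex.re))).const_mul K
    rw [mul_zero] at this
    exact this.mono_left inf_le_left
  refine squeeze_zero' (Eventually.of_forall fun w => norm_nonneg _) ?_ h1
  filter_upwards [mem_inf_of_right (mem_principal_self S)] with w hw using hle' w hw

theorem tendsto_iteratedDeriv_comp_exp {G : ℂ → ℂ} {r : ℝ} (hr : 0 < r)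
    (hG : DifferentiableOn ℂ G (Metric.ball 0 r)) (j : ℕ) (S : Set ℂ) :
    Tendsto (fun w => iteratedDeriv j G (Complex.exp w)) (comap Complex.re atBot ⊓ 𝓟 S)
      (𝓝 (iteratedDeriv j G 0)) := by
  have h1 : ∀ j, DifferentiableOn ℂ (iteratedDeriv j G) (Metric.ball 0 r) := by
    intro j
    induction j with
    | zero => simpa using hG
    | succ j ih => rw [iteratedDeriv_succ]; exact ih.deriv Metric.isOpen_ball
  have hc := ((h1 j).differentiableAt
    (Metric.isOpen_ball.mem_nhds (Metric.mem_ball_self hr))).continuousAt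
  exact hc.tendsto.comp (Complex.tendsto_exp_comap_re_atBot.mono_left inf_le_left)

/-- Holomorphy and the equation hold for every arg t; only the initial conditions confine t to a
sector. Hence r is chosen before ε, and only the radius in z depends on ε. -/
theorem solBranch_spec {p q : ℕ} (hp : 1 ≤ p) (hpq : p < q) {a z₀ : ℂ} (hz₀ : z₀ ≠ 0)
    {f φ : ℂ → ℂ} (hf : EntireExpGrowth (q / (q - p)) f)
    (hφ : ∀ z, z ≠ z₀ → φ z = a / (z - z₀) + f z) :
    ∃ r > 0, (∀ l : ℤ, DifferentiableOn ℂ (fun x : ℂ × ℂ => solBranch p q a z₀ f l x.1 x.2)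
        ({w | Real.exp w.re < r} ×ˢ Metric.ball 0 1)) ∧
      (∀ l : ℤ, ∀ w : ℂ, Real.exp w.re < r → ∀ z ∈ Metric.ball (0 : ℂ) 1,
        dt^[p] (solBranch p q a z₀ f l) w z = iteratedDeriv q (solBranch p q a z₀ f l w) z) ∧
      ∀ ε > 0, ∃ ρ > 0, ∀ l : ℤ, ∀ S : Set ℂ, (∀ w ∈ S, Real.exp w.re < r) →
        (∀ w ∈ S, ∃ n : ℤ, ∃ w' : ℂ,
          w = w' + n * (((2 * Real.pi * (q / p) : ℝ) : ℂ) * Complex.I) ∧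
          |w'.im - (q / p * Complex.arg z₀ + 2 * (l - 1) * Real.pi / p + Real.pi / p)| ≤
            (2 * Real.pi / p + Real.pi * (q - p) / p - ε) / 2) →
        ∀ j < p, ∀ z ∈ Metric.ball (0 : ℂ) ρ,
          Tendsto (fun w => dt^[j] (solBranch p q a z₀ f l) w z) (comap Complex.re atBot ⊓ 𝓟 S)
            (𝓝 (if j = 0 then φ z else 0)) := by
  have hp0 : (0 : ℝ) < p := by exact_mod_cast hp
  have hqR : (0 : ℝ) < q := by exact_mod_cast (by omega : 0 < q)
  obtain ⟨r, hr, -, hV1, hV2, hV3⟩ := entirePart_spec hp hpq hf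
  have hexp : ∀ w : ℂ, Real.exp w.re < r → Complex.exp w ∈ Metric.ball (0 : ℂ) r := fun w hw => by
    rwa [mem_ball_zero_iff, Complex.norm_exp]
  have hVt : ∀ z ∈ Metric.ball (0 : ℂ) 1,
      DifferentiableOn ℂ (fun t => entirePart p q f t z) (Metric.ball 0 r) := fun z hz =>
    DifferentiableOn.comp (g := fun x : ℂ × ℂ => entirePart p q f x.1 x.2)
      (f := fun t : ℂ => ((t, z) : ℂ × ℂ)) hV1 (by fun_prop) (fun t ht => ⟨ht, hz⟩)
  refine ⟨r, hr, fun l => ?_, fun l w hw z hz => ?_, fun ε hε => ?_⟩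
  · have h1 : DifferentiableOn ℂ (fun x : ℂ × ℂ => entirePart p q f (Complex.exp x.1) x.2)
        ({w | Real.exp w.re < r} ×ˢ Metric.ball 0 1) :=
      DifferentiableOn.comp (g := fun x : ℂ × ℂ => entirePart p q f x.1 x.2)
        (f := fun x : ℂ × ℂ => (Complex.exp x.1, x.2)) hV1 (by fun_prop)
        (fun x hx => ⟨hexp x.1 hx.1, hx.2⟩)
    exact h1.add (differentiable_poleSum hp hpq a z₀ l).differentiableOn
  · rw [iterate_dt_solBranch hp hpq a z₀ (hVt z hz) l p (hexp w hw), hV2 _ (hexp w hw) z hz,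
      poleSum_pde hp hpq]
    have h1 : DifferentiableOn ℂ (entirePart p q f (Complex.exp w)) (Metric.ball 0 1) :=
      DifferentiableOn.comp (g := fun x : ℂ × ℂ => entirePart p q f x.1 x.2)
        (f := fun z : ℂ => ((Complex.exp w, z) : ℂ × ℂ)) hV1 (by fun_prop)
        (fun z hz => ⟨hexp w hw, hz⟩)
    have h2 := differentiable_poleSum_right hp hpq a z₀ l w
    have h3 : solBranch p q a z₀ f l w =
      fun z => entirePart p q f (Complex.exp w) z + poleSum p q a z₀ l w z := rfl
    rw [h3, iteratedDeriv_fun_add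
      ((h1.contDiffOn Metric.isOpen_ball).contDiffAt (Metric.isOpen_ball.mem_nhds hz))
      h2.contDiff.contDiffAt]
  · obtain ⟨ρ, hρ, hlog⟩ := exists_exp_eq_sub hz₀ (κ := p / q * (ε / 4)) (by positivity)
    refine ⟨min ρ 1, by positivity, fun l S hSr hS j hj z hz => ?_⟩
    have hz1 : z ∈ Metric.ball (0 : ℂ) 1 := Metric.ball_subset_ball (min_le_right _ _) hz
    obtain ⟨L, hL, hLim⟩ := hlog z (Metric.ball_subset_ball (min_le_left _ _) hz)
    have hzne : z ≠ z₀ := by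
      rintro rfl
      rw [sub_self] at hL
      exact Complex.exp_ne_zero _ hL
    have hV := tendsto_iteratedDeriv_comp_exp hr (hVt z hz1) j S
    rw [hV3 j hj z hz1] at hV
    have hfin := hV.add (poleSum_tendsto hp hpq a hL hε hLim l hS hj)
    have hval : ((if j = 0 then f z else 0) + if j = 0 then a / (z - z₀) else 0) =
        if j = 0 then φ z else 0 := by
      split_ifs
      · rw [hφ z hzne, add_comm]
      · rw [add_zero]
    rw [hval] at hfin
    refine hfin.congr' ?_
    filter_upwards [mem_inf_of_right (mem_principal_self S)] with w hw
    exact (iterate_dt_solBranch hp hpq a z₀ (hVt z hz1) l j (hexp w (hSr w hw))).symm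

/-! ### The formal solution, its Gevrey order and its modified Borel transform. -/

theorem formalSolution_coeff {p q : ℕ} (hp : 1 ≤ p) {φ : ℂ → ℂ} {ρ : ℝ} {uh : ℕ → ℂ → ℂ}
    (h : IsFormalSolution p q φ (Metric.ball 0 ρ) uh) (n : ℕ) :
    ∀ z ∈ Metric.ball (0 : ℂ) ρ, uh n z =
      if p ∣ n then iteratedDeriv (q * (n / p)) φ z / (n.factorial : ℂ) else 0 := by
  induction n using Nat.strong_induction_on with
  | _ n ih =>
    intro z hz
    rcases lt_or_ge n p with hn | hn
    · rcases Nat.eq_zero_or_pos n with rfl | hn0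
      · simp [h.init z hz]
      · rw [h.init_deriv n hn0 hn z hz, if_neg]
        exact fun hd => absurd (Nat.le_of_dvd hn0 hd) (by omega)
    · obtain ⟨m, rfl⟩ : ∃ m, n = m + p := ⟨n - p, by omega⟩
      have h1 := h.eqn m z hz
      have h2 : uh m =ᶠ[𝓝 z] fun z =>
          if p ∣ m then iteratedDeriv (q * (m / p)) φ z / (m.factorial : ℂ) else 0 := by
        filter_upwards [Metric.isOpen_ball.mem_nhds hz] with y hy using ih m (by omega) y hy
      rw [h2.iteratedDeriv_eq] at h1
      have f1 : (m.factorial : ℂ) ≠ 0 := by exact_mod_cast Nat.factorial_ne_zero _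
      have f2 : ((m + p).factorial : ℂ) ≠ 0 := by exact_mod_cast Nat.factorial_ne_zero _
      have hdiv : (m + p) / p = m / p + 1 := Nat.add_div_right m (by omega)
      by_cases hd : p ∣ m
      · rw [if_pos (Nat.dvd_add hd dvd_rfl)]
        simp only [if_pos hd] at h1
        have h3 : (fun z => iteratedDeriv (q * (m / p)) φ z / (m.factorial : ℂ)) =
            fun z => (m.factorial : ℂ)⁻¹ * iteratedDeriv (q * (m / p)) φ z := by
          funext z; ring
        rw [h3, iteratedDeriv_const_mul_field, iteratedDeriv_eq_iterate,
          iteratedDeriv_eq_iterate, ← Function.iterate_add_apply, ← iteratedDeriv_eq_iterate] at h1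
        rw [hdiv, mul_add, mul_one, add_comm _ q, eq_div_iff f2]
        field_simp at h1
        linear_combination h1
      · have hd' : ¬ p ∣ m + p := by rwa [Nat.dvd_add_self_right]
        rw [if_neg hd']
        simp only [if_neg hd] at h1
        have h0 : iteratedDeriv q (fun _ : ℂ => (0 : ℂ)) z = 0 := by
          have := iteratedDeriv_const_mul_field (x := z) (n := q) (0 : ℂ) (fun _ : ℂ => (0 : ℂ))
          simpa only [zero_mul] using this
        rw [h0] at h1
        exact (mul_eq_zero.1 h1).resolve_left (div_ne_zero f2 f1)

/-- Bound (qm)! by (qm)^{qm}, write this as a power of (pm)^{pm}, and use N^N ≤ e^N N!. -/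
theorem factorial_mul_le_rpow {p q : ℕ} (hp : 1 ≤ p) (hq : 1 ≤ q) (m : ℕ) :
    ((q * m).factorial : ℝ) ≤
      ((q / p * Real.exp 1 : ℝ) ^ q) ^ m * ((p * m).factorial : ℝ) ^ (q / p : ℝ) := by
  have hp0 : (0 : ℝ) < p := by exact_mod_cast hp
  have hq0 : (0 : ℝ) < q := by exact_mod_cast hq
  rcases Nat.eq_zero_or_pos m with rfl | hm
  · simp
  have hpm : (0 : ℝ) < (p * m : ℕ) := by
    have : 0 < p * m := Nat.mul_pos (by omega) hm
    exact_mod_cast this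
  have h1 : ((p * m : ℕ) : ℝ) ^ (p * m) ≤ Real.exp 1 ^ (p * m) * (p * m).factorial := by
    have := Real.pow_div_factorial_le_exp ((p * m : ℕ) : ℝ) hpm.le (p * m)
    rw [div_le_iff₀ (by exact_mod_cast Nat.factorial_pos _)] at this
    rwa [← Real.exp_nat_mul, mul_one]
  have h2 : ((q * m).factorial : ℝ) ≤ ((q * m : ℕ) : ℝ) ^ (q * m) := by
    exact_mod_cast Nat.factorial_le_pow (q * m)
  have h3 : ((q * m : ℕ) : ℝ) = q / p * (p * m : ℕ) := by push_cast; field_simp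
  have h4 : ((p * m : ℕ) : ℝ) ^ (q * m) = (((p * m : ℕ) : ℝ) ^ (p * m)) ^ (q / p : ℝ) := by
    rw [← Real.rpow_natCast, ← Real.rpow_natCast, ← Real.rpow_mul hpm.le]
    congr 1; push_cast; field_simp
  have h5 : (Real.exp 1 ^ (p * m)) ^ (q / p : ℝ) = Real.exp 1 ^ (q * m) := by
    rw [← Real.rpow_natCast, ← Real.rpow_natCast, ← Real.rpow_mul (Real.exp_pos 1).le]
    congr 1; push_cast; field_simp
  calc ((q * m).factorial : ℝ) ≤ ((q * m : ℕ) : ℝ) ^ (q * m) := h2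
    _ = (q / p : ℝ) ^ (q * m) * (((p * m : ℕ) : ℝ) ^ (p * m)) ^ (q / p : ℝ) := by
        rw [h3, mul_pow, h4]
    _ ≤ (q / p : ℝ) ^ (q * m) * (Real.exp 1 ^ (p * m) * (p * m).factorial) ^ (q / p : ℝ) := by
        gcongr
    _ = _ := by
        rw [Real.mul_rpow (by positivity) (by positivity), h5, ← pow_mul, mul_pow, mul_assoc]

theorem differentiableOn_initial {a z₀ : ℂ} {f φ : ℂ → ℂ} (hf : Differentiable ℂ f)
    (hφ : ∀ z, z ≠ z₀ → φ z = a / (z - z₀) + f z) : DifferentiableOn ℂ φ {z₀}ᶜ := by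
  refine DifferentiableOn.congr (f := fun z => a / (z - z₀) + f z) ?_ fun z hz => hφ z hz
  refine DifferentiableOn.add (DifferentiableOn.div (by fun_prop) (by fun_prop) ?_)
    hf.differentiableOn
  exact fun z hz => sub_ne_zero.2 hz

/-- Cauchy's estimates bound the derivative of order qm by (qm)!, which is of the size of ((pm)!)^{1
+ 1/k}. Division by (pm)! leaves the exponent 1/k. -/
theorem formalSolution_isGevrey {p q : ℕ} (hp : 1 ≤ p) (hpq : p < q) {a z₀ : ℂ} (hz₀ : z₀ ≠ 0)
    {f φ : ℂ → ℂ} (hf : Differentiable ℂ f) (hφ : ∀ z, z ≠ z₀ → φ z = a / (z - z₀) + f z)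
    {ρ : ℝ} (hρ : 0 < ρ) {uh : ℕ → ℂ → ℂ} (h : IsFormalSolution p q φ (Metric.ball 0 ρ) uh)
    {k : ℝ} (hk : k = p / (q - p)) : IsGevrey (1 / k) uh := by
  have hp0 : (0 : ℝ) < p := by exact_mod_cast hp
  have hq0 : (0 : ℝ) < q := by exact_mod_cast (by omega : 0 < q)
  have hqp : (0 : ℝ) < q - p := by
    have : (p : ℝ) < q := by exact_mod_cast hpq
    linarith
  have hz0 : 0 < ‖z₀‖ := norm_pos_iff.2 hz₀
  -- Circles of radius R about points with |z| ≤ R stay in |y| ≤ 2R < |z₀|, away from the pole.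
  set R : ℝ := ‖z₀‖ / 4 with hR
  have hR0 : 0 < R := by positivity
  have hφd := differentiableOn_initial hf hφ
  obtain ⟨M, hM⟩ := (isCompact_closedBall (0 : ℂ) (2 * R)).exists_bound_of_continuousOn
    (hφd.continuousOn.mono fun z hz => by
      rintro rfl
      have : ‖z‖ ≤ 2 * R := by simpa using hz
      rw [hR] at this; linarith)
  have hM0 : 0 ≤ M := (norm_nonneg _).trans (hM 0 (by simp [hR0.le]))
  set Cq : ℝ := (1 / R) ^ q * (q / p * Real.exp 1 : ℝ) ^ q with hCq
  refine ⟨min ρ R, by positivity, M + 1, by positivity, max 1 Cq, by positivity, fun n z hz => ?_⟩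
  have hzρ : z ∈ Metric.ball (0 : ℂ) ρ := Metric.ball_subset_ball (min_le_left _ _) hz
  have hzR : ‖z‖ ≤ R := by
    have : ‖z‖ < min ρ R := by simpa using hz
    exact (this.trans_le (min_le_right _ _)).le
  have hfn : (0 : ℝ) < n.factorial := by exact_mod_cast Nat.factorial_pos _
  have hrhs : 0 ≤ (M + 1) * max 1 Cq ^ n * (n.factorial : ℝ) ^ (1 / k) := by positivity
  rw [formalSolution_coeff hp h n z hzρ]
  split_ifs with hd
  swap
  · simpa using hrhs
  obtain ⟨m, rfl⟩ := hd
  rw [Nat.mul_div_cancel_left m (by omega), norm_div, Complex.norm_natCast]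
  have hdc : DiffContOnCl ℂ φ (Metric.ball z R) := by
    refine DifferentiableOn.diffContOnCl (hφd.mono fun y hy => ?_)
    rintro rfl
    rw [closure_ball z hR0.ne', mem_closedBall_iff_norm] at hy
    have := norm_le_norm_add_norm_sub z y
    rw [norm_sub_rev] at this
    rw [hR] at hzR hy; linarith
  have hC := Complex.norm_iteratedDeriv_le_of_forall_mem_sphere_norm_le (q * m) hR0 hdc (C := M)
    fun y hy => hM y (by
      have h1 : ‖y - z‖ = R := by simpa [dist_eq_norm] using hy
      have := norm_le_norm_add_norm_sub z y
      rw [norm_sub_rev] at this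
      simp only [mem_closedBall_zero_iff]; linarith)
  have hfac := factorial_mul_le_rpow hp (by omega : 1 ≤ q) m
  have hexp : (q / p : ℝ) = 1 + 1 / k := by rw [hk]; field_simp; ring
  rw [hexp, Real.rpow_add hfn, Real.rpow_one] at hfac
  rw [← hexp] at hfac
  rw [div_le_iff₀ hfn]
  calc ‖iteratedDeriv (q * m) φ z‖ ≤ (q * m).factorial * M / R ^ (q * m) := hC
    _ ≤ (((q / p * Real.exp 1 : ℝ) ^ q) ^ m * ((p * m).factorial *
          ((p * m).factorial : ℝ) ^ (1 / k))) * M / R ^ (q * m) := by gcongr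
    _ = M * Cq ^ m * ((p * m).factorial : ℝ) ^ (1 / k) * (p * m).factorial := by
        rw [hCq, mul_pow ((1 / R) ^ q), ← pow_mul (1 / R), one_div_pow]; ring
    _ ≤ (M + 1) * max 1 Cq ^ (p * m) * ((p * m).factorial : ℝ) ^ (1 / k) * (p * m).factorial := by
        have h6 : Cq ^ m ≤ max 1 Cq ^ (p * m) := by
          calc Cq ^ m ≤ max 1 Cq ^ m := by gcongr; exact le_max_right _ _
            _ ≤ max 1 Cq ^ (p * m) := pow_le_pow_right₀ (le_max_left _ _) (by nlinarith)
        have h7 : 0 ≤ Cq := by positivity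
        gcongr
        linarith

/-- The sum of the modified Borel transform of the formal solution. -/
def borelSum (p q : ℕ) (φ : ℂ → ℂ) (w z : ℂ) : ℂ :=
  1 / q * ∑ j ∈ Finset.range q, φ (z + Complex.exp (2 * j * Real.pi * Complex.I / q) * tpow p q w)

theorem norm_tpow (p q : ℕ) (w : ℂ) : ‖tpow p q w‖ = Real.exp (p / q * w.re) := by
  rw [tpow, Complex.norm_exp]
  congr 1
  have : (p / q : ℂ) = ((p / q : ℝ) : ℂ) := by push_cast; rfl
  rw [this, Complex.re_ofReal_mul]

/-- For n = pm the Gamma factor is (qm)!, so the transform turns iteratedDeriv/(pm)! into Taylor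
coefficients of φ at z; the exponents qm are those selected by the roots of unity. -/
theorem hasSum_borelSum {p q : ℕ} (hp : 1 ≤ p) (hpq : p < q) {a z₀ : ℂ}
    {f φ : ℂ → ℂ} (hf : Differentiable ℂ f) (hφ : ∀ z, z ≠ z₀ → φ z = a / (z - z₀) + f z)
    {ρ : ℝ} {uh : ℕ → ℂ → ℂ} (h : IsFormalSolution p q φ (Metric.ball 0 ρ) uh)
    {k : ℝ} (hk : k = p / (q - p)) {w z : ℂ} (hzρ : z ∈ Metric.ball (0 : ℂ) ρ)
    (hz : ‖z‖ < ‖z₀‖ / 2) (hw : Real.exp (p / q * w.re) < ‖z₀‖ / 2) :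
    HasSum (fun n : ℕ => uh n z * Complex.exp w ^ n *
      ((n.factorial : ℝ) / Real.Gamma (1 + n * (1 + 1 / k)) : ℝ)) (borelSum p q φ w z) := by
  have hp0 : (0 : ℝ) < p := by exact_mod_cast hp
  have hq0 : (0 : ℝ) < q := by exact_mod_cast (by omega : 0 < q)
  have hqC : (q : ℂ) ≠ 0 := by exact_mod_cast hq0.ne'
  have hqp : (0 : ℝ) < q - p := by
    have : (p : ℝ) < q := by exact_mod_cast hpq
    linarith
  have hd : DifferentiableOn ℂ φ (Metric.ball z (‖z₀‖ / 2)) :=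
    (differentiableOn_initial hf hφ).mono fun y hy => by
      rintro rfl
      rw [mem_ball_iff_norm] at hy
      have := norm_le_norm_add_norm_sub z y
      rw [norm_sub_rev] at this
      linarith
  have h1 := (hasSum_sum_roots (by omega : q ≠ 0) hd (y := tpow p q w)
    (by rw [norm_tpow]; exact hw)).mul_left (1 / q : ℂ)
  have hinj : Function.Injective fun m : ℕ => p * m := fun a b h => Nat.eq_of_mul_eq_mul_left hp h
  have hk1 : 1 + 1 / k = q / p := by rw [hk]; field_simp; ring
  rw [← hinj.hasSum_iff]
  · rw [borelSum]
    convert! h1 using 1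
    funext m
    simp only [Function.comp_apply]
    rw [formalSolution_coeff hp h _ z hzρ, if_pos (dvd_mul_right p m),
      Nat.mul_div_cancel_left m (by omega), hk1, tpow_pow (by omega)]
    have h2 : (1 : ℝ) + (p * m : ℕ) * (q / p : ℝ) = (q * m : ℕ) + 1 := by
      push_cast; field_simp; ring
    rw [h2, Real.Gamma_nat_eq_factorial]
    have f1 : ((p * m).factorial : ℂ) ≠ 0 := by exact_mod_cast Nat.factorial_ne_zero _
    have f2 : ((q * m).factorial : ℂ) ≠ 0 := by exact_mod_cast Nat.factorial_ne_zero _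
    push_cast
    field_simp
  · intro n hn
    rw [formalSolution_coeff hp h n z hzρ, if_neg, zero_mul, zero_mul]
    rintro ⟨m, rfl⟩
    exact hn ⟨m, rfl⟩

/-- If cos γ ≤ C with 0 ≤ C < 1, then 1 - 2X cos γ + X² ≥ 1 - C² for all X ≥ 0. The bound is uniform
in γ away from the multiples of 2π. -/
theorem exists_le_norm_one_sub_mul_exp {κ : ℝ} (hκ : 0 < κ) :
    ∃ c > 0, ∀ γ : ℝ, (∀ n : ℤ, κ ≤ |γ - 2 * Real.pi * n|) → ∀ X : ℝ, 0 ≤ X →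
      c ≤ ‖1 - X * Complex.exp (γ * Complex.I)‖ := by
  have hπ := Real.pi_pos
  set κ' := min κ (Real.pi / 2) with hκ'
  have hκ'0 : 0 < κ' := by positivity
  set C := Real.cos κ' with hC
  have hC1 : C < 1 := by
    have := Real.cos_lt_cos_of_nonneg_of_le_pi_div_two le_rfl (min_le_right κ _) hκ'0
    simpa using this
  have hC0 : 0 ≤ C := Real.cos_nonneg_of_neg_pi_div_two_le_of_le (by linarith) (min_le_right _ _)
  refine ⟨Real.sqrt (1 - C ^ 2), Real.sqrt_pos.2 (by nlinarith), fun γ hγ X hX => ?_⟩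
  set n := round (γ / (2 * Real.pi)) with hn
  have h1 : |γ - 2 * Real.pi * n| ≤ Real.pi := by
    have := abs_sub_round (γ / (2 * Real.pi))
    have h2 : γ - 2 * Real.pi * n = 2 * Real.pi * (γ / (2 * Real.pi) - n) := by field_simp
    rw [h2, abs_mul, abs_of_pos (by positivity)]
    nlinarith
  have h3 : Real.cos γ ≤ C := by
    have h4 : Real.cos γ = Real.cos |γ - 2 * Real.pi * n| := by
      rw [Real.cos_abs, (by ring : γ - 2 * Real.pi * n = γ - n * (2 * Real.pi)),
        Real.cos_sub_int_mul_two_pi]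
    rw [h4]
    exact Real.cos_le_cos_of_nonneg_of_le_pi hκ'0.le h1 ((min_le_left _ _).trans (hγ n))
  refine Real.sqrt_le_iff.2 ⟨norm_nonneg _, ?_⟩
  have h5 : ‖1 - X * Complex.exp (γ * Complex.I)‖ ^ 2 = 1 - 2 * X * Real.cos γ + X ^ 2 := by
    rw [← Complex.normSq_eq_norm_sq, Complex.normSq_apply]
    simp [Complex.exp_ofReal_mul_I_re, Complex.exp_ofReal_mul_I_im]
    have := Real.sin_sq_add_cos_sq γ
    linear_combination X ^ 2 * this
  rw [h5]
  nlinarith [mul_le_mul_of_nonneg_left h3 hX, sq_nonneg (X - C)]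

/-- The directions `δ_l`, for an arbitrary integer index. -/
def poleDir (p q : ℕ) (z₀ : ℂ) (l : ℤ) : ℝ :=
  q / p * Complex.arg z₀ + 2 * ((l : ℝ) - 1) * Real.pi / p

/-- A rotation of t^{p/q} by a q-th root of unity can have the argument of z₀ only if arg t is one
of the `poleDir`; away from these the distance is bounded below uniformly in |t|. -/
theorem exists_le_norm_sub_pole {p q : ℕ} (hp : 1 ≤ p) (hq : 1 ≤ q) {z₀ : ℂ} (hz₀ : z₀ ≠ 0) {m : ℝ}
    (hm : 0 < m) : ∃ c > 0, ∀ w : ℂ, (∀ l : ℤ, m ≤ |w.im - poleDir p q z₀ l|) → ∀ j : ℕ,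
      c ≤ ‖Complex.exp (2 * j * Real.pi * Complex.I / q) * tpow p q w - z₀‖ := by
  have hp0 : (0 : ℝ) < p := by exact_mod_cast hp
  have hq0 : (0 : ℝ) < q := by exact_mod_cast hq
  have hqC : (q : ℂ) ≠ 0 := by exact_mod_cast hq0.ne'
  obtain ⟨c, hc, h⟩ := exists_le_norm_one_sub_mul_exp (κ := p / q * m) (by positivity)
  have hz0 : 0 < ‖z₀‖ := norm_pos_iff.2 hz₀
  have hz0C : (‖z₀‖ : ℂ) ≠ 0 := by exact_mod_cast hz0.ne'
  refine ⟨‖z₀‖ * c, by positivity, fun w hw j => ?_⟩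
  set γ : ℝ := p / q * w.im + 2 * j * Real.pi / q - Complex.arg z₀ with hγ
  have h1 := h γ (fun n => by
    -- The rotation by e^{2jπi/q} lowers the index by j, n full turns raise it by qn, and 1 is the
    -- offset in `poleDir`.
    have h2 := hw (q * n - j + 1)
    have h3 : γ - 2 * Real.pi * n = p / q * (w.im - poleDir p q z₀ (q * n - j + 1)) := by
      rw [hγ, poleDir]; push_cast; field_simp; ring
    rw [h3, abs_mul, abs_of_pos (by positivity)]
    gcongr) (Real.exp (p / q * w.re) / ‖z₀‖) (by positivity)
  have h4 : Complex.exp (2 * j * Real.pi * Complex.I / q) * tpow p q w - z₀ =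
      -z₀ * (1 - ((Real.exp (p / q * w.re) / ‖z₀‖ : ℝ) : ℂ) * Complex.exp (γ * Complex.I)) := by
    have h5 : z₀ * (((Real.exp (p / q * w.re) / ‖z₀‖ : ℝ) : ℂ) * Complex.exp (γ * Complex.I)) =
        Complex.exp (2 * j * Real.pi * Complex.I / q) * tpow p q w := by
      nth_rewrite 1 [← Complex.norm_mul_exp_arg_mul_I z₀]
      rw [tpow, ← Complex.exp_add]
      push_cast
      field_simp
      rw [← Complex.exp_add, ← Complex.exp_add]
      congr 1
      apply Complex.ext
      · simp [Complex.div_natCast_re]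
      · simp [hγ, Complex.div_natCast_im]; ring
    linear_combination -h5
  rw [h4, norm_mul, norm_neg]
  gcongr

theorem isOpen_sectorInf (d ε : ℝ) : IsOpen (sectorInf d ε) :=
  isOpen_lt (by fun_prop) continuous_const

theorem convex_sectorInf (d ε : ℝ) : Convex ℝ (sectorInf d ε) := by
  have h : sectorInf d ε = Complex.imLm ⁻¹' Metric.ball d (ε / 2) := by
    ext w; simp [sectorInf, Real.dist_eq]
  rw [h]
  exact (convex_ball d (ε / 2)).linear_preimage _

/-- On the sector all points z + e^{2jπi/q} t^{p/q} keep a fixed distance from z₀, so the pole part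
is bounded. The entire part grows with |t^{p/q}|^{q/(q-p)} = |t|^k, the order required. -/
theorem isBorelCont_borelSum {p q : ℕ} (hp : 1 ≤ p) (hpq : p < q) {a z₀ : ℂ} (hz₀ : z₀ ≠ 0)
    {f φ : ℂ → ℂ} (hf : EntireExpGrowth (q / (q - p)) f)
    (hφ : ∀ z, z ≠ z₀ → φ z = a / (z - z₀) + f z)
    {ρ : ℝ} (hρ : 0 < ρ) {uh : ℕ → ℂ → ℂ} (h : IsFormalSolution p q φ (Metric.ball 0 ρ) uh)
    {k : ℝ} (hk : k = p / (q - p)) {d m : ℝ} (hm : 0 < m)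
    (hd : ∀ l : ℤ, m ≤ |d - poleDir p q z₀ l|) :
    ∃ ρ' > 0, IsBorelCont k uh d m ρ' (borelSum p q φ) := by
  have hp0 : (0 : ℝ) < p := by exact_mod_cast hp
  have hq0 : (0 : ℝ) < q := by exact_mod_cast (by omega : 0 < q)
  have hqp : (0 : ℝ) < q - p := by
    have : (p : ℝ) < q := by exact_mod_cast hpq
    linarith
  have hz0 : 0 < ‖z₀‖ := norm_pos_iff.2 hz₀
  obtain ⟨c, hc, hcw⟩ := exists_le_norm_sub_pole hp (by omega : 1 ≤ q) hz₀ (half_pos hm)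
  have hdist : ∀ w ∈ sectorInf d m, ∀ l : ℤ, m / 2 ≤ |w.im - poleDir p q z₀ l| := by
    intro w hw l
    have h1 : |w.im - d| < m / 2 := hw
    have h2 := hd l
    have h3 := abs_sub_abs_le_abs_sub (d - poleDir p q z₀ l) (d - w.im)
    rw [sub_sub_sub_cancel_left, abs_sub_comm d w.im] at h3
    linarith
  set ρ' := min ρ (min (‖z₀‖ / 2) (c / 2)) with hρ'
  have hfar : ∀ w ∈ sectorInf d m, ∀ z ∈ Metric.ball (0 : ℂ) ρ', ∀ j : ℕ, c / 2 ≤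
      ‖z + Complex.exp (2 * j * Real.pi * Complex.I / q) * tpow p q w - z₀‖ := by
    intro w hw z hz j
    have h1 := hcw w (hdist w hw) j
    have h2 : ‖z‖ < c / 2 := by
      have : ‖z‖ < ρ' := by simpa using hz
      exact this.trans_le ((min_le_right _ _).trans (min_le_right _ _))
    have h3 := norm_sub_le (z + Complex.exp (2 * j * Real.pi * Complex.I / q) * tpow p q w - z₀) z
    have h4 : z + Complex.exp (2 * j * Real.pi * Complex.I / q) * tpow p q w - z₀ - z =
      Complex.exp (2 * j * Real.pi * Complex.I / q) * tpow p q w - z₀ := by ring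
    rw [h4] at h3
    linarith
  have hne : ∀ w ∈ sectorInf d m, ∀ z ∈ Metric.ball (0 : ℂ) ρ', ∀ j : ℕ,
      z + Complex.exp (2 * j * Real.pi * Complex.I / q) * tpow p q w ≠ z₀ := by
    intro w hw z hz j h
    have := hfar w hw z hz j
    rw [h, sub_self, norm_zero] at this
    linarith
  have hφd := differentiableOn_initial hf.1 hφ
  obtain ⟨hfd, C₁, hC₁, C₂, hC₂, hfb⟩ := hf
  set s : ℝ := q / (q - p) with hs
  have hs0 : 0 < s := by positivity
  refine ⟨ρ', by positivity, ?_, ?_, ?_⟩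
  · refine DifferentiableOn.const_mul (DifferentiableOn.fun_sum fun j _ => ?_) _
    refine DifferentiableOn.comp (g := φ) (f := fun x : ℂ × ℂ =>
      x.2 + Complex.exp (2 * j * Real.pi * Complex.I / q) * tpow p q x.1) hφd ?_
      (fun x hx => hne x.1 hx.1 x.2 hx.2 j)
    unfold tpow
    fun_prop
  · refine ⟨(‖z₀‖ / 2) ^ (q / p : ℝ), by positivity, fun w hw z hz => ?_⟩
    have hz' : ‖z‖ < ρ' := by simpa using hz
    refine hasSum_borelSum hp hpq hfd hφ h hk ?_ ?_ ?_
    · exact Metric.ball_subset_ball (min_le_left _ _) hz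
    · exact hz'.trans_le ((min_le_right _ _).trans (min_le_left _ _))
    · have h1 := Real.rpow_lt_rpow (Real.exp_pos _).le hw.1 (by positivity : (0 : ℝ) < p / q)
      rw [← Real.exp_mul, ← Real.rpow_mul (by positivity),
        (by field_simp : (q / p : ℝ) * (p / q) = 1), Real.rpow_one, mul_comm] at h1
      exact h1
  · intro η hη hηm
    refine ⟨‖a‖ / (c / 2) + C₁ * Real.exp (C₂ * (2 * ρ') ^ s), by positivity, C₂ * 2 ^ s,
      by positivity, fun w hw z hz => ?_⟩
    have hw' : w ∈ sectorInf d m := lt_of_lt_of_le (show |w.im - d| < η / 2 from hw) (by linarith)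
    have hz' : ‖z‖ < ρ' := by simpa using hz
    set Y := Real.exp (p / q * w.re) with hY
    have hY0 : 0 < Y := Real.exp_pos _
    have hYs : Y ^ s = Real.exp w.re ^ k := by
      rw [hY, ← Real.exp_mul, ← Real.exp_mul]
      congr 1
      rw [hs, hk]; field_simp
    have hρ'0 : 0 < ρ' := (norm_nonneg z).trans_lt hz'
    have hterm : ∀ j ∈ Finset.range q,
        ‖φ (z + Complex.exp (2 * j * Real.pi * Complex.I / q) * tpow p q w)‖ ≤
        (‖a‖ / (c / 2) + C₁ * Real.exp (C₂ * (2 * ρ') ^ s)) *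
          Real.exp (C₂ * 2 ^ s * Real.exp w.re ^ k) := by
      intro j _
      rw [hφ _ (hne w hw' z hz j)]
      refine (norm_add_le _ _).trans ?_
      rw [add_mul]
      refine add_le_add ?_ ?_
      · rw [norm_div]
        calc _ ≤ ‖a‖ / (c / 2) := by gcongr; exact hfar w hw' z hz j
          _ ≤ ‖a‖ / (c / 2) * Real.exp (C₂ * 2 ^ s * Real.exp w.re ^ k) :=
            le_mul_of_one_le_right (by positivity) (Real.one_le_exp (by positivity))
      · refine (hfb _).trans ?_
        rw [mul_assoc C₁, ← Real.exp_add]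
        gcongr
        have h1 : ‖z + Complex.exp (2 * j * Real.pi * Complex.I / q) * tpow p q w‖ ≤ ρ' + Y := by
          refine (norm_add_le _ _).trans ?_
          rw [norm_mul, norm_exp_two_mul_pi, one_mul, norm_tpow]
          linarith
        have h2 : ‖z + Complex.exp (2 * j * Real.pi * Complex.I / q) * tpow p q w‖ ^ s ≤
            (2 * ρ') ^ s + (2 * Y) ^ s := by
          rcases le_total ρ' Y with h | h
          · calc _ ≤ (2 * Y) ^ s := by gcongr; linarith
              _ ≤ _ := by have : 0 ≤ (2 * ρ') ^ s := by positivity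
                          linarith
          · calc _ ≤ (2 * ρ') ^ s := by gcongr; linarith
              _ ≤ _ := by have : 0 ≤ (2 * Y) ^ s := by positivity
                          linarith
        rw [Real.mul_rpow (x := 2) (by norm_num) hY0.le, hYs] at h2
        calc _ ≤ C₂ * ((2 * ρ') ^ s + 2 ^ s * Real.exp w.re ^ k) := by gcongr
          _ = _ := by ring
    rw [borelSum, norm_mul, norm_div, norm_one, Complex.norm_natCast]
    calc 1 / (q : ℝ) * ‖_‖ ≤ 1 / q * ∑ j ∈ Finset.range q, _ := by
          gcongr; exact norm_sum_le_of_le _ hterm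
      _ = _ := by rw [Finset.sum_const, Finset.card_range, nsmul_eq_mul]; field_simp

/-! ### The singular directions and the identity theorem on sectors. -/

theorem poleDir_add_one {p q : ℕ} (z₀ : ℂ) (l : ℤ) :
    poleDir p q z₀ (l + 1) = poleDir p q z₀ l + 2 * Real.pi / p := by
  rw [poleDir, poleDir]; push_cast; ring

theorem poleDir_add_mul {p q : ℕ} (z₀ : ℂ) (l n : ℤ) :
    poleDir p q z₀ (l + q * n) = poleDir p q z₀ l + 2 * Real.pi * (q / p) * n := by
  rw [poleDir, poleDir]; push_cast; ring

theorem poleDir_add_mul' {p q : ℕ} (hp : 1 ≤ p) (z₀ : ℂ) (l n : ℤ) :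
    poleDir p q z₀ (l + p * n) = poleDir p q z₀ l + 2 * Real.pi * n := by
  have hp0 : (p : ℝ) ≠ 0 := by exact_mod_cast (by omega : p ≠ 0)
  rw [poleDir, poleDir]; push_cast; field_simp; ring

theorem poleDir_strictMono {p q : ℕ} (hp : 1 ≤ p) (z₀ : ℂ) : StrictMono (poleDir p q z₀) := by
  have hp0 : (0 : ℝ) < p := by exact_mod_cast hp
  intro l l' h
  have h' : (l : ℝ) < l' := by exact_mod_cast h
  have hπ := Real.pi_pos
  rw [poleDir, poleDir]
  gcongr

theorem exists_poleDir_le {p q : ℕ} (hp : 1 ≤ p) (z₀ : ℂ) (d : ℝ) :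
    ∃ l : ℤ, poleDir p q z₀ l ≤ d ∧ d < poleDir p q z₀ (l + 1) := by
  have hp0 : (0 : ℝ) < p := by exact_mod_cast hp
  have hπ := Real.pi_pos
  set x := (d - q / p * Complex.arg z₀) / (2 * Real.pi / p) with hx
  have hxd : d = q / p * Complex.arg z₀ + 2 * Real.pi / p * x := by rw [hx]; field_simp; ring
  have hpos : 0 < 2 * Real.pi / p := by positivity
  refine ⟨⌊x⌋ + 1, ?_, ?_⟩
  · have h1 := mul_le_mul_of_nonneg_left (Int.floor_le x) hpos.le
    have h2 : poleDir p q z₀ (⌊x⌋ + 1) = q / p * Complex.arg z₀ + 2 * Real.pi / p * ⌊x⌋ := by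
      rw [poleDir]; push_cast; ring
    rw [h2, hxd]; linarith
  · have h1 := mul_lt_mul_of_pos_left (Int.lt_floor_add_one x) hpos
    have h2 : poleDir p q z₀ (⌊x⌋ + 1 + 1) = q / p * Complex.arg z₀ + 2 * Real.pi / p * (⌊x⌋ + 1) := by
      rw [poleDir]; push_cast; ring
    rw [h2, hxd]; linarith

theorem le_abs_sub_poleDir {p q : ℕ} (hp : 1 ≤ p) (z₀ : ℂ) {d : ℝ} {l : ℤ} (l' : ℤ) :
    min (d - poleDir p q z₀ l) (poleDir p q z₀ (l + 1) - d) ≤ |d - poleDir p q z₀ l'| := by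
  rcases lt_or_ge l l' with h | h
  · have := (poleDir_strictMono (q := q) hp z₀).monotone (by omega : l + 1 ≤ l')
    refine (min_le_right _ _).trans ?_
    rw [abs_sub_comm]
    exact (by linarith : _ ≤ poleDir p q z₀ l' - d).trans (le_abs_self _)
  · have := (poleDir_strictMono (q := q) hp z₀).monotone h
    refine (min_le_left _ _).trans ?_
    exact (by linarith : _ ≤ d - poleDir p q z₀ l').trans (le_abs_self _)

theorem HoloOn.left {S D : Set ℂ} {f : ℂ → ℂ → ℂ} (h : HoloOn S D f) {z : ℂ} (hz : z ∈ D) :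
    DifferentiableOn ℂ (fun w => f w z) S :=
  DifferentiableOn.comp (g := fun x : ℂ × ℂ => f x.1 x.2) (f := fun w : ℂ => ((w, z) : ℂ × ℂ)) h
    (by fun_prop) (fun _ hw => ⟨hw, hz⟩)

theorem HoloOn.right {S D : Set ℂ} {f : ℂ → ℂ → ℂ} (h : HoloOn S D f) {w : ℂ} (hw : w ∈ S) :
    DifferentiableOn ℂ (f w) D :=
  DifferentiableOn.comp (g := fun x : ℂ × ℂ => f x.1 x.2) (f := fun z : ℂ => ((w, z) : ℂ × ℂ)) h
    (by fun_prop) (fun _ hz => ⟨hw, hz⟩)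

theorem eqOn_of_eqOn_open {U V : Set ℂ} (hU : IsOpen U) (hc : Convex ℝ U) {f g : ℂ → ℂ}
    (hf : DifferentiableOn ℂ f U) (hg : DifferentiableOn ℂ g U) (hV : IsOpen V) {w₀ : ℂ}
    (hU₀ : w₀ ∈ U) (hV₀ : w₀ ∈ V) (h : ∀ w ∈ U ∩ V, f w = g w) : EqOn f g U := by
  refine (hf.analyticOnNhd hU).eqOn_of_preconnected_of_eventuallyEq (hg.analyticOnNhd hU)
    hc.isPreconnected hU₀ ?_
  filter_upwards [(hU.inter hV).mem_nhds ⟨hU₀, hV₀⟩] with w hw using h w hw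

theorem isOpen_exp_re_lt (r : ℝ) : IsOpen {w : ℂ | Real.exp w.re < r} :=
  isOpen_lt (by fun_prop) continuous_const

theorem convex_exp_re_lt (r : ℝ) : Convex ℝ {w : ℂ | Real.exp w.re < r} := by
  rcases le_or_gt r 0 with hr | hr
  · have : {w : ℂ | Real.exp w.re < r} = ∅ := by
      ext w; simp only [mem_ofPred_eq, mem_empty_iff_false, iff_false, not_lt]
      exact hr.trans (Real.exp_pos _).le
    rw [this]; exact convex_empty
  · have : {w : ℂ | Real.exp w.re < r} = Complex.reLm ⁻¹' Iio (Real.log r) := by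
      ext w; simp [Real.lt_log_iff_exp_lt hr]
    rw [this]; exact (convex_Iio _).linear_preimage _

theorem isOpen_sector (d α R : ℝ) : IsOpen (sector d α R) :=
  (isOpen_exp_re_lt R).inter (isOpen_sectorInf d α)

theorem convex_sector (d α R : ℝ) : Convex ℝ (sector d α R) :=
  (convex_exp_re_lt R).inter (convex_sectorInf d α)

theorem exists_mem_line {r : ℝ} (hr : 0 < r) (d : ℝ) :
    ∃ w : ℂ, Real.exp w.re < r ∧ w.im = d := by
  refine ⟨(Real.log (r / 2) : ℝ) + (d : ℝ) * Complex.I, ?_, by simp⟩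
  simp [Real.exp_log (half_pos hr)]
  linarith

theorem hasSum_borelSum_of_small {p q : ℕ} (hp : 1 ≤ p) (hpq : p < q) {a z₀ : ℂ} (hz₀ : z₀ ≠ 0)
    {f φ : ℂ → ℂ} (hf : Differentiable ℂ f) (hφ : ∀ z, z ≠ z₀ → φ z = a / (z - z₀) + f z)
    {ρ : ℝ} (hρ : 0 < ρ) {uh : ℕ → ℂ → ℂ} (h : IsFormalSolution p q φ (Metric.ball 0 ρ) uh)
    {k : ℝ} (hk : k = p / (q - p)) : ∃ r > 0, ∃ ρ' > 0, ∀ w : ℂ, Real.exp w.re < r →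
    Real.exp (p / q * w.re) < ‖z₀‖ / 2 ∧ ∀ z ∈ Metric.ball (0 : ℂ) ρ',
    HasSum (fun n : ℕ => uh n z * Complex.exp w ^ n *
      ((n.factorial : ℝ) / Real.Gamma (1 + n * (1 + 1 / k)) : ℝ)) (borelSum p q φ w z) := by
  have hp0 : (0 : ℝ) < p := by exact_mod_cast hp
  have hq0 : (0 : ℝ) < q := by exact_mod_cast (by omega : 0 < q)
  have hz0 : 0 < ‖z₀‖ := norm_pos_iff.2 hz₀
  refine ⟨(‖z₀‖ / 2) ^ (q / p : ℝ), by positivity, min ρ (‖z₀‖ / 2), by positivity, fun w hw => ?_⟩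
  have h1 := Real.rpow_lt_rpow (Real.exp_pos _).le hw (by positivity : (0 : ℝ) < p / q)
  rw [← Real.exp_mul, ← Real.rpow_mul (by positivity),
    (by field_simp : (q / p : ℝ) * (p / q) = 1), Real.rpow_one, mul_comm] at h1
  refine ⟨h1, fun z hz => ?_⟩
  have hz' : ‖z‖ < min ρ (‖z₀‖ / 2) := by simpa using hz
  exact hasSum_borelSum hp hpq hf hφ h hk (Metric.ball_subset_ball (min_le_left _ _) hz)
    (hz'.trans_le (min_le_right _ _)) h1

theorem differentiable_tpow (p q : ℕ) : Differentiable ℂ (tpow p q) := by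
  unfold tpow; fun_prop

/-! ### Summability and Stokes directions. -/

/-- At z = 0, multiplying a continuation of the Borel sum by 1 - (t^{p/q}/z₀)^q must give the entire
function H, by the identity theorem. At the pole on the line arg t = δ_l the product vanishes,
whereas H = -a/z₀ ≠ 0 there. -/
theorem not_isSummableIn_poleDir {p q : ℕ} (hp : 1 ≤ p) (hpq : p < q) {a z₀ : ℂ} (ha : a ≠ 0)
    (hz₀ : z₀ ≠ 0) {f φ : ℂ → ℂ} (hf : Differentiable ℂ f)
    (hφ : ∀ z, z ≠ z₀ → φ z = a / (z - z₀) + f z)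
    {ρ : ℝ} (hρ : 0 < ρ) {uh : ℕ → ℂ → ℂ} (h : IsFormalSolution p q φ (Metric.ball 0 ρ) uh)
    {k : ℝ} (hk : k = p / (q - p)) (l : ℤ) : ¬ IsSummableIn k uh (poleDir p q z₀ l) := by
  rintro ⟨-, ε, hε, ρ₁, hρ₁, g, hg⟩
  have hp0 : (0 : ℝ) < p := by exact_mod_cast hp
  have hq0 : (0 : ℝ) < q := by exact_mod_cast (by omega : 0 < q)
  have hqC : (q : ℂ) ≠ 0 := by exact_mod_cast hq0.ne'
  have hpC : (p : ℂ) ≠ 0 := by exact_mod_cast hp0.ne'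
  have hz0 : 0 < ‖z₀‖ := norm_pos_iff.2 hz₀
  have hT := differentiable_tpow p q
  set d := poleDir p q z₀ l with hd
  obtain ⟨r₁, hr₁, hsum₁⟩ := hg.eq_borel
  obtain ⟨r₂, hr₂, ρ₂, hρ₂, hsum₂⟩ := hasSum_borelSum_of_small hp hpq hz₀ hf hφ hρ h hk
  set H : ℂ → ℂ := fun w => (1 - (tpow p q w / z₀) ^ q) * (1 / q * ∑ j ∈ Finset.range q,
    f (Complex.exp (2 * j * Real.pi * Complex.I / q) * tpow p q w)) - a / z₀ with hH
  have hHd : Differentiable ℂ H := by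
    rw [hH]
    refine Differentiable.sub_const (Differentiable.mul ?_ (Differentiable.const_mul ?_ _)) _
    · simp only [div_eq_mul_inv]; fun_prop
    · exact Differentiable.fun_sum fun j _ => hf.comp (hT.const_mul _)
  have hG : DifferentiableOn ℂ (fun w => (1 - (tpow p q w / z₀) ^ q) * g w 0) (sectorInf d ε) := by
    refine DifferentiableOn.mul (Differentiable.differentiableOn ?_)
      (hg.holo.left (Metric.mem_ball_self hρ₁))
    simp only [div_eq_mul_inv]; fun_prop
  obtain ⟨w₀, hw₀, hw₀d⟩ := exists_mem_line (lt_min hr₁ hr₂) d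
  have hmem : ∀ w : ℂ, w.im = d → w ∈ sectorInf d ε := fun w hw => by
    simp [sectorInf, hw, hε]
  have heq : EqOn (fun w => (1 - (tpow p q w / z₀) ^ q) * g w 0) H (sectorInf d ε) := by
    refine eqOn_of_eqOn_open (isOpen_sectorInf d ε) (convex_sectorInf d ε) hG hHd.differentiableOn
      (isOpen_exp_re_lt (min r₁ r₂)) (hmem _ hw₀d) hw₀ ?_
    rintro w ⟨hw1, hw2⟩
    have hw2' : Real.exp w.re < min r₁ r₂ := hw2
    have h1 := hsum₁ w ⟨hw2'.trans_le (min_le_left _ _), hw1⟩ 0 (Metric.mem_ball_self hρ₁)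
    obtain ⟨h2, h3⟩ := hsum₂ w (hw2'.trans_le (min_le_right _ _))
    rw [h1.unique (h3 0 (Metric.mem_ball_self hρ₂))]
    have hXn : ‖tpow p q w / z₀‖ < 1 := by
      rw [norm_div, norm_tpow, div_lt_one hz0]; linarith
    have hX1 : (tpow p q w / z₀) ^ q ≠ 1 := fun h1 => by
      have := congrArg norm h1
      rw [norm_pow, norm_one] at this
      exact absurd this (pow_lt_one₀ (norm_nonneg _) hXn (by omega)).ne
    have h0 : 1 - (tpow p q w / z₀) ^ q ≠ 0 := sub_ne_zero.2 hX1.symm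
    have hroots := sum_one_div_one_sub_root (by omega : q ≠ 0) hX1
    have hterm : ∀ j ∈ Finset.range q,
        φ (0 + Complex.exp (2 * j * Real.pi * Complex.I / q) * tpow p q w) =
        -(a / z₀) * (1 / (1 - Complex.exp (2 * j * Real.pi * Complex.I / q) * (tpow p q w / z₀))) +
          f (Complex.exp (2 * j * Real.pi * Complex.I / q) * tpow p q w) := by
      intro j _
      have hlt : ‖Complex.exp (2 * j * Real.pi * Complex.I / q) * tpow p q w‖ < ‖z₀‖ := by
        rw [norm_mul, norm_exp_two_mul_pi, one_mul, norm_tpow]; linarith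
      rw [zero_add, hφ _ (fun h => by rw [h] at hlt; exact lt_irrefl _ hlt)]
      congr 1
      have h4 : Complex.exp (2 * j * Real.pi * Complex.I / q) * tpow p q w - z₀ =
          -z₀ * (1 - Complex.exp (2 * j * Real.pi * Complex.I / q) * (tpow p q w / z₀)) := by
        field_simp; ring
      rw [h4, ← neg_div_neg_eq a, neg_mul, neg_neg, ← neg_div, div_mul_div_comm, mul_one]
    rw [borelSum, Finset.sum_congr rfl hterm, Finset.sum_add_distrib, ← Finset.mul_sum, hroots, hH]
    beta_reduce
    generalize ∑ j ∈ Finset.range q, f (Complex.exp (2 * j * Real.pi * Complex.I / q) *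
      tpow p q w) = Sf
    generalize (tpow p q w / z₀) ^ q = X at h0 ⊢
    field_simp
    ring
  -- The point of the line with |t^{p/q}| = |z₀|; there t^{p/q}/z₀ is a q-th root of unity.
  set w₁ : ℂ := ((q / p * Real.log ‖z₀‖ : ℝ) : ℂ) + (d : ℂ) * Complex.I with hw₁
  have h5 := heq (hmem w₁ (by rw [hw₁]; simp))
  have h6 : (tpow p q w₁ / z₀) ^ q = 1 := by
    have h7 : tpow p q w₁ / z₀ = Complex.exp ((l - 1 : ℤ) * (2 * Real.pi * Complex.I) / q) := by
      rw [div_eq_iff hz₀]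
      nth_rewrite 1 [← Complex.exp_log hz₀]
      rw [tpow, ← Complex.exp_add, hw₁, hd, poleDir]
      congr 1
      rw [Complex.log]
      push_cast
      field_simp
      ring
    rw [h7, ← Complex.exp_nat_mul, mul_div_cancel₀ _ hqC, Complex.exp_int_mul_two_pi_mul_I]
  simp only [hH, h6, sub_self, zero_mul, zero_sub] at h5
  exact div_ne_zero ha hz₀ (neg_eq_zero.1 h5.symm)

theorem isSummableIn_of_between {p q : ℕ} (hp : 1 ≤ p) (hpq : p < q) {a z₀ : ℂ} (hz₀ : z₀ ≠ 0)
    {f φ : ℂ → ℂ} (hf : EntireExpGrowth (q / (q - p)) f)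
    (hφ : ∀ z, z ≠ z₀ → φ z = a / (z - z₀) + f z)
    {ρ : ℝ} (hρ : 0 < ρ) {uh : ℕ → ℂ → ℂ} (h : IsFormalSolution p q φ (Metric.ball 0 ρ) uh)
    {k : ℝ} (hk : k = p / (q - p)) {d : ℝ} (hd : ∀ l : ℤ, d ≠ poleDir p q z₀ l) :
    IsSummableIn k uh d := by
  obtain ⟨l, h1, h2⟩ := exists_poleDir_le (q := q) hp z₀ d
  have hm : 0 < min (d - poleDir p q z₀ l) (poleDir p q z₀ (l + 1) - d) :=
    lt_min (sub_pos.2 (lt_of_le_of_ne h1 (hd l).symm)) (by linarith)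
  obtain ⟨ρ', hρ', hb⟩ := isBorelCont_borelSum hp hpq hz₀ hf hφ hρ h hk hm
    (fun l' => le_abs_sub_poleDir hp z₀ l')
  exact ⟨formalSolution_isGevrey hp hpq hz₀ hf.1 hφ hρ h hk, _, hm, ρ', hρ', _, hb⟩

theorem isStokesDirection_iff {p q : ℕ} (hp : 1 ≤ p) (hpq : p < q) {a z₀ : ℂ} (ha : a ≠ 0)
    (hz₀ : z₀ ≠ 0) {f φ : ℂ → ℂ} (hf : EntireExpGrowth (q / (q - p)) f)
    (hφ : ∀ z, z ≠ z₀ → φ z = a / (z - z₀) + f z)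
    {ρ : ℝ} (hρ : 0 < ρ) {uh : ℕ → ℂ → ℂ} (h : IsFormalSolution p q φ (Metric.ball 0 ρ) uh)
    {k : ℝ} (hk : k = p / (q - p)) (d : ℝ) :
    IsStokesDirection k uh d ↔ ∃ l : ℤ, d = poleDir p q z₀ l := by
  have hp0 : (0 : ℝ) < p := by exact_mod_cast hp
  constructor
  · rintro ⟨h1, -⟩
    by_contra! hne
    exact h1 (isSummableIn_of_between hp hpq hz₀ hf hφ hρ h hk hne)
  · rintro ⟨l, rfl⟩
    refine ⟨not_isSummableIn_poleDir hp hpq ha hz₀ hf.1 hφ hρ h hk l, 2 * Real.pi / p,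
      by positivity, fun d hd1 hd2 => isSummableIn_of_between hp hpq hz₀ hf hφ hρ h hk ?_⟩
    rintro l' rfl
    rcases lt_trichotomy l l' with hl | rfl | hl
    · have h1 := (poleDir_strictMono (q := q) hp z₀).monotone (by omega : l + 1 ≤ l')
      rw [poleDir_add_one] at h1
      have := le_abs_self (poleDir p q z₀ l' - poleDir p q z₀ l)
      linarith
    · exact hd1 rfl
    · have h1 := (poleDir_strictMono (q := q) hp z₀).monotone (by omega : l' + 1 ≤ l)
      rw [poleDir_add_one] at h1
      have := neg_le_abs (poleDir p q z₀ l' - poleDir p q z₀ l)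
      linarith

theorem isKSummable_formalSolution {p q : ℕ} (hp : 1 ≤ p) (hpq : p < q) {a z₀ : ℂ} (hz₀ : z₀ ≠ 0)
    {f φ : ℂ → ℂ} (hf : EntireExpGrowth (q / (q - p)) f)
    (hφ : ∀ z, z ≠ z₀ → φ z = a / (z - z₀) + f z)
    {ρ : ℝ} (hρ : 0 < ρ) {uh : ℕ → ℂ → ℂ} (h : IsFormalSolution p q φ (Metric.ball 0 ρ) uh)
    {k : ℝ} (hk : k = p / (q - p)) : IsKSummable k uh := by
  classical
  -- Raising the index by p adds 2π to the direction, so p representatives cover all singular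
  -- directions modulo 2π.
  refine ⟨(Finset.range p).image fun n : ℕ => poleDir p q z₀ n, fun d hd =>
    isSummableIn_of_between hp hpq hz₀ hf hφ hρ h hk ?_⟩
  rintro l rfl
  have hpz : (p : ℤ) ≠ 0 := by exact_mod_cast (by omega : p ≠ 0)
  have h0 := Int.emod_nonneg l hpz
  have h1 := Int.emod_lt_of_pos l (by exact_mod_cast hp : (0 : ℤ) < p)
  refine hd (poleDir p q z₀ (l % p).toNat) ?_ (l / p) ?_
  · refine Finset.mem_image_of_mem (fun n : ℕ => poleDir p q z₀ n) (Finset.mem_range.2 ?_)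
    omega
  · rw [Int.toNat_of_nonneg h0, ← poleDir_add_mul' hp, Int.emod_add_mul_ediv]

theorem pi_div_eq {p q : ℕ} (hp : 1 ≤ p) {k : ℝ} (hk : k = p / (q - p)) :
    Real.pi / k = Real.pi * (q - p) / p := by
  have hp0 : (p : ℝ) ≠ 0 := by exact_mod_cast (by omega : p ≠ 0)
  rw [hk, div_div_eq_mul_div]

/-! ### The k-sums are the branches. -/

/-- With ε equal to the distance from d to the nearest singular direction, all rays θ used by the
k-sum stay in the gap of d, and they all give the same branch. -/
theorem isKSum_solBranch {p q : ℕ} (hp : 1 ≤ p) (hpq : p < q) {a z₀ : ℂ} (hz₀ : z₀ ≠ 0)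
    {f φ : ℂ → ℂ} (hf : EntireExpGrowth (q / (q - p)) f)
    (hφ : ∀ z, z ≠ z₀ → φ z = a / (z - z₀) + f z)
    {ρ : ℝ} (hρ : 0 < ρ) {uh : ℕ → ℂ → ℂ} (h : IsFormalSolution p q φ (Metric.ball 0 ρ) uh)
    {k : ℝ} (hk : k = p / (q - p)) {l : ℤ} {d : ℝ} (h1 : poleDir p q z₀ l < d)
    (h2 : d < poleDir p q z₀ (l + 1)) :
    IsKSum k uh d (sectorInf d (Real.pi / k)) (solBranch p q a z₀ f l) := by
  set m := min (d - poleDir p q z₀ l) (poleDir p q z₀ (l + 1) - d) with hm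
  have hm0 : 0 < m := lt_min (by linarith) (by linarith)
  obtain ⟨ρ₁, hρ₁, hb⟩ := isBorelCont_borelSum hp hpq hz₀ hf hφ hρ h hk hm0
    (fun l' => le_abs_sub_poleDir hp z₀ l')
  refine ⟨formalSolution_isGevrey hp hpq hz₀ hf.1 hφ hρ h hk, m, hm0, ρ₁, hρ₁, _, hb, ?_, ?_⟩
  · intro w hw
    have hw' : |w.im - d| < Real.pi / k / 2 := hw
    change |w.im - d| < (Real.pi / k + m) / 2
    linarith
  · intro θ hθ α _ hα
    have hθ' := abs_lt.1 hθ
    have m1 : m ≤ d - poleDir p q z₀ l := min_le_left _ _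
    have m2 : m ≤ poleDir p q z₀ (l + 1) - d := min_le_right _ _
    rw [pi_div_eq hp hk] at hα
    have e1 : poleDir p q z₀ l = q / p * Complex.arg z₀ + 2 * (l - 1) * Real.pi / p := rfl
    have e2 : poleDir p q z₀ (l + 1) = q / p * Complex.arg z₀ + 2 * l * Real.pi / p := by
      rw [poleDir]; push_cast; ring
    obtain ⟨r, hr, ρ', hρ', hsol⟩ := solInt_eq_solBranch hp hpq (a := a) hz₀ hf hφ (l := l) (θ := θ)
      (by linarith) (by linarith) hα
    refine ⟨r, hr, ρ', hρ', fun w hw z hz => ?_⟩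
    obtain ⟨h3, h4⟩ := hsol w hw.2 z hz
    obtain ⟨h5, h6⟩ := ecalle_eq_solInt hp hpq hk (g := borelSum p q φ) (θ := θ)
      (fun s _ => rfl) h3
    exact ⟨h5, by rw [h6, h4]⟩

/-- Any `k`-sum in a direction between `δ_l` and `δ_{l+1}` is the corresponding branch. -/
theorem IsKSum.eq_solBranch {p q : ℕ} (hp : 1 ≤ p) (hpq : p < q) {a z₀ : ℂ} (hz₀ : z₀ ≠ 0)
    {f φ : ℂ → ℂ} (hf : EntireExpGrowth (q / (q - p)) f)
    (hφ : ∀ z, z ≠ z₀ → φ z = a / (z - z₀) + f z)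
    {ρ : ℝ} (hρ : 0 < ρ) {uh : ℕ → ℂ → ℂ} (h : IsFormalSolution p q φ (Metric.ball 0 ρ) uh)
    {k : ℝ} (hk : k = p / (q - p)) {l : ℤ} {d : ℝ} (h1 : poleDir p q z₀ l < d)
    (h2 : d < poleDir p q z₀ (l + 1)) {S : Set ℂ} {v : ℂ → ℂ → ℂ} (hv : IsKSum k uh d S v) :
    ∃ α > 0, ∃ r > 0, ∃ ρ' > 0, ∀ w ∈ S ∩ sector d α r, ∀ z ∈ Metric.ball (0 : ℂ) ρ',
      v w z = solBranch p q a z₀ f l w z := by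
  have hp0 : (0 : ℝ) < p := by exact_mod_cast hp
  have hqp : (0 : ℝ) < q - p := by
    have : (p : ℝ) < q := by exact_mod_cast hpq
    linarith
  have hk0 : 0 < k := by rw [hk]; positivity
  obtain ⟨-, ε, hε, ρ₁, hρ₁, g, hg, -, hval⟩ := hv
  set m := min (d - poleDir p q z₀ l) (poleDir p q z₀ (l + 1) - d) with hm
  have hm0 : 0 < m := lt_min (by linarith) (by linarith)
  obtain ⟨ρ₂, hρ₂, hb⟩ := isBorelCont_borelSum hp hpq hz₀ hf hφ hρ h hk hm0
    (fun l' => le_abs_sub_poleDir hp z₀ l')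
  obtain ⟨r₁, hr₁, hsum₁⟩ := hg.eq_borel
  obtain ⟨r₂, hr₂, hsum₂⟩ := hb.eq_borel
  have hπk : 0 < Real.pi / k := by positivity
  obtain ⟨r₃, hr₃, ρ₃, hρ₃, hval⟩ := hval d (by simpa using half_pos hε) (Real.pi / k / 2)
    (by positivity) (by linarith)
  have e1 : poleDir p q z₀ l = q / p * Complex.arg z₀ + 2 * (l - 1) * Real.pi / p := rfl
  have e2 : poleDir p q z₀ (l + 1) = q / p * Complex.arg z₀ + 2 * l * Real.pi / p := by
    rw [poleDir]; push_cast; ring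
  obtain ⟨r₄, hr₄, ρ₄, hρ₄, hsol⟩ := solInt_eq_solBranch hp hpq (a := a) hz₀ hf hφ (l := l) (θ := d)
    (α := Real.pi / k / 2) (by linarith) (by linarith) (by rw [← pi_div_eq hp hk]; linarith)
  set ε' := min ε m with hε'
  have hε'0 : 0 < ε' := lt_min hε hm0
  have hs1 : sectorInf d ε' ⊆ sectorInf d ε := fun w hw =>
    lt_of_lt_of_le (show |w.im - d| < ε' / 2 from hw) (by linarith [min_le_left ε m])
  have hs2 : sectorInf d ε' ⊆ sectorInf d m := fun w hw =>
    lt_of_lt_of_le (show |w.im - d| < ε' / 2 from hw) (by linarith [min_le_right ε m])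
  -- Any two continuations sum the same series near t = 0, so they agree along the ray; the k-sum
  -- does not depend on the choice of g.
  have hgb : ∀ z ∈ Metric.ball (0 : ℂ) (min ρ₁ ρ₂), ∀ s : ℂ, s.im = d →
      g s z = borelSum p q φ s z := by
    intro z hz s hs
    have hz1 := Metric.ball_subset_ball (min_le_left ρ₁ ρ₂) hz
    have hz2 := Metric.ball_subset_ball (min_le_right ρ₁ ρ₂) hz
    obtain ⟨w₀, hw₀, hw₀d⟩ := exists_mem_line (lt_min hr₁ hr₂) d
    have hmem : ∀ w : ℂ, w.im = d → w ∈ sectorInf d ε' := fun w hw => by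
      change |w.im - d| < ε' / 2
      rw [hw, sub_self, abs_zero]; positivity
    refine eqOn_of_eqOn_open (isOpen_sectorInf d ε') (convex_sectorInf d ε')
      ((hg.holo.left hz1).mono hs1) ((hb.holo.left hz2).mono hs2) (isOpen_exp_re_lt (min r₁ r₂))
      (hmem _ hw₀d) hw₀ ?_ (hmem s hs)
    rintro w ⟨hw1, hw2⟩
    have hw2' : Real.exp w.re < min r₁ r₂ := hw2
    exact (hsum₁ w ⟨hw2'.trans_le (min_le_left _ _), hs1 hw1⟩ z hz1).unique
      (hsum₂ w ⟨hw2'.trans_le (min_le_right _ _), hs2 hw1⟩ z hz2)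
  refine ⟨Real.pi / k / 2, by positivity, min r₃ r₄, lt_min hr₃ hr₄, min (min ρ₁ ρ₂) (min ρ₃ ρ₄),
    by positivity, fun w hw z hz => ?_⟩
  have hz12 := Metric.ball_subset_ball (min_le_left _ _) hz
  have hz3 := Metric.ball_subset_ball ((min_le_right _ _).trans (min_le_left _ _)) hz
  have hz4 := Metric.ball_subset_ball ((min_le_right _ _).trans (min_le_right _ _)) hz
  have hw3 : w ∈ sector d (Real.pi / k / 2) r₃ := ⟨hw.2.1.trans_le (min_le_left _ _), hw.2.2⟩
  have hw4 : w ∈ sector d (Real.pi / k / 2) r₄ := ⟨hw.2.1.trans_le (min_le_right _ _), hw.2.2⟩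
  obtain ⟨-, h3⟩ := hval w ⟨hw.1, hw3⟩ z hz3
  obtain ⟨h4, h5⟩ := hsol w hw4 z hz4
  obtain ⟨-, h6⟩ := ecalle_eq_solInt hp hpq hk (g := g) (θ := d) (fun s hs => hgb z hz12 s hs) h4
  rw [h3, h6, h5]

/-! ### The Riemann surface of t^{p/q}, representatives modulo q, and the jumps. -/

theorem proj_eq_proj_iff {σ : ℝ} {w w' : ℂ} :
    proj σ w = proj σ w' ↔ ∃ n : ℤ, w' = w + n * (((2 * Real.pi * σ : ℝ) : ℂ) * Complex.I) := by
  rw [proj, proj, QuotientAddGroup.eq, AddSubgroup.mem_zmultiples_iff]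
  refine exists_congr fun n => ?_
  rw [zsmul_eq_mul, eq_neg_add_iff_add_eq, eq_comm]

theorem re_add_period (w : ℂ) (n : ℤ) (x : ℝ) : (w + n * ((x : ℂ) * Complex.I)).re = w.re := by simp

theorem im_add_period (w : ℂ) (n : ℤ) (x : ℝ) :
    (w + n * ((x : ℂ) * Complex.I)).im = w.im + n * x := by simp

theorem mem_preimage_proj_image {σ : ℝ} {S : Set ℂ} {w : ℂ} (h : w ∈ proj σ ⁻¹' (proj σ '' S)) :
    ∃ n : ℤ, ∃ w' ∈ S, w = w' + n * (((2 * Real.pi * σ : ℝ) : ℂ) * Complex.I) := by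
  obtain ⟨w', hw', h⟩ := h
  obtain ⟨n, hn⟩ := proj_eq_proj_iff.1 h
  exact ⟨n, w', hw', hn⟩

theorem isOpen_preimage_proj_image {σ : ℝ} {S : Set ℂ} (hS : IsOpen S) :
    IsOpen (proj σ ⁻¹' (proj σ '' S)) :=
  (QuotientAddGroup.isOpenMap_coe _ hS).preimage QuotientAddGroup.continuous_mk

theorem argLine_add (σ φ : ℝ) (n : ℤ) : argLine σ (φ + 2 * Real.pi * σ * n) = argLine σ φ := by
  ext x
  constructor
  · rintro ⟨w, hw, rfl⟩
    have hw' : w.im = φ + 2 * Real.pi * σ * n := hw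
    refine ⟨w + (-n : ℤ) * (((2 * Real.pi * σ : ℝ) : ℂ) * Complex.I), ?_,
      (proj_eq_proj_iff.2 ⟨-n, rfl⟩).symm⟩
    change (w + (-n : ℤ) * (((2 * Real.pi * σ : ℝ) : ℂ) * Complex.I)).im = φ
    rw [im_add_period, hw']; push_cast; ring
  · rintro ⟨w, hw, rfl⟩
    have hw' : w.im = φ := hw
    refine ⟨w + n * (((2 * Real.pi * σ : ℝ) : ℂ) * Complex.I), ?_,
      (proj_eq_proj_iff.2 ⟨n, rfl⟩).symm⟩
    change (w + n * (((2 * Real.pi * σ : ℝ) : ℂ) * Complex.I)).im = φ + 2 * Real.pi * σ * n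
    rw [im_add_period, hw']; ring

theorem exists_mem_Icc_add_mul {q : ℕ} (hq : 1 ≤ q) (L : ℤ) :
    ∃ l ∈ Finset.Icc 1 q, ∃ n : ℤ, L = (l : ℤ) + q * n := by
  have hqz : (q : ℤ) ≠ 0 := by exact_mod_cast (by omega : q ≠ 0)
  have h0 := Int.emod_nonneg (L - 1) hqz
  have h1 := Int.emod_lt_of_pos (L - 1) (by exact_mod_cast hq : (0 : ℤ) < q)
  have h2 := Int.emod_add_mul_ediv (L - 1) q
  refine ⟨((L - 1) % q).toNat + 1, Finset.mem_Icc.2 ⟨by omega, by omega⟩, (L - 1) / q, ?_⟩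
  push_cast
  rw [Int.toNat_of_nonneg h0]
  omega

theorem stokesDelta_eq (p q : ℕ) (z₀ : ℂ) (l : ℕ) : stokesDelta p q z₀ l = poleDir p q z₀ l := by
  rw [stokesDelta, poleDir]; push_cast; rfl

theorem stokesJump_eq (p q : ℕ) (a z₀ : ℂ) (l : ℕ) :
    stokesJump p q a z₀ l = poleJump p q a z₀ l := by
  funext w z
  rw [stokesJump, poleJump]; push_cast; rfl

theorem solBranch_add {p q : ℕ} (hq : 1 ≤ q) (a z₀ : ℂ) (f : ℂ → ℂ) (l n : ℤ) :
    solBranch p q a z₀ f (l + q * n) = solBranch p q a z₀ f l := by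
  funext w z
  rw [solBranch, solBranch, poleSum_add hq]

theorem solBranch_sub {p q : ℕ} (hp : 1 ≤ p) (hpq : p < q) (a z₀ : ℂ) (f : ℂ → ℂ) (l : ℤ) (w z : ℂ) :
    solBranch p q a z₀ f l w z - solBranch p q a z₀ f (l - 1) w z = poleJump p q a z₀ l w z := by
  rw [solBranch, solBranch, add_sub_add_left_eq_sub, poleSum_sub hp hpq]

theorem isJump_formalSolution {p q : ℕ} (hp : 1 ≤ p) (hpq : p < q) {a z₀ : ℂ} (hz₀ : z₀ ≠ 0)
    {f φ : ℂ → ℂ} (hf : EntireExpGrowth (q / (q - p)) f)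
    (hφ : ∀ z, z ≠ z₀ → φ z = a / (z - z₀) + f z)
    {ρ : ℝ} (hρ : 0 < ρ) {uh : ℕ → ℂ → ℂ} (h : IsFormalSolution p q φ (Metric.ball 0 ρ) uh)
    {k : ℝ} (hk : k = p / (q - p)) (l : ℤ) :
    IsJump k uh (poleDir p q z₀ l) (poleJump p q a z₀ l) := by
  have hp0 : (0 : ℝ) < p := by exact_mod_cast hp
  have hqp : (0 : ℝ) < q - p := by
    have : (p : ℝ) < q := by exact_mod_cast hpq
    linarith
  have hk0 : 0 < k := by rw [hk]; positivity
  have hπk : 0 < Real.pi / k := by positivity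
  -- The first bound keeps d₁ and d₂ in the gaps adjacent to δ_l, the second makes both sectors
  -- contain a common sector around δ_l.
  set ε := min (2 * Real.pi / p) (Real.pi / k / 4) with hε
  have hε0 : 0 < ε := by positivity
  have hε1 : ε ≤ 2 * Real.pi / p := min_le_left _ _
  have hε2 : ε ≤ Real.pi / k / 4 := min_le_right _ _
  have e1 := poleDir_add_one (p := p) (q := q) z₀ l
  have e2 := poleDir_add_one (p := p) (q := q) z₀ (l - 1)
  rw [sub_add_cancel] at e2
  refine ⟨ε, hε0, fun d₁ hd₁ d₂ hd₂ => ⟨solBranch p q a z₀ f l, solBranch p q a z₀ f (l - 1),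
    isKSum_solBranch hp hpq hz₀ hf hφ hρ h hk hd₁.1 (by linarith [hd₁.2]),
    isKSum_solBranch hp hpq hz₀ hf hφ hρ h hk (by linarith [hd₂.1])
      (by rw [sub_add_cancel]; exact hd₂.2), Real.pi / k / 2, by positivity, ?_, 1, one_pos, 1, one_pos,
    fun w _ z _ => solBranch_sub hp hpq a z₀ f l w z⟩⟩
  intro w hw
  have hw' : |w.im - poleDir p q z₀ l| < Real.pi / k / 2 / 2 := hw
  rw [abs_lt] at hw'
  refine ⟨?_, ?_⟩
  · change |w.im - d₁| < Real.pi / k / 2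
    rw [abs_lt]
    constructor <;> linarith [hd₁.1, hd₁.2]
  · change |w.im - d₂| < Real.pi / k / 2
    rw [abs_lt]
    constructor <;> linarith [hd₂.1, hd₂.2]

/-! ### The branches are pairwise distinct. -/

/-- The value is 1/Γ(1 - 1/σ), and 1 - 1/σ > 0. -/
theorem kernelC_zero_ne_zero {σ : ℝ} (hσ : 1 < σ) : kernelC σ 0 ≠ 0 := by
  have hσ0 : 0 < σ := by linarith
  rw [kernelC, tsum_eq_single 0]
  · have h : Complex.Gamma (1 - (((0 : ℕ) : ℂ) + 1) / (σ : ℂ)) ≠ 0 := by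
      refine Complex.Gamma_ne_zero_of_re_pos ?_
      have : (1 - (((0 : ℕ) : ℂ) + 1) / (σ : ℂ)) = ((1 - 1 / σ : ℝ) : ℂ) := by push_cast; ring
      rw [this, Complex.ofReal_re, sub_pos, div_lt_one hσ0]
      exact hσ
    simpa using h
  · intro n hn
    simp [hn]

/-- The difference is a sum of n consecutive jumps. In y = t^{-p/q}, after division by a nonzero
multiple of y, this sum is an entire function G. If it vanished for y ≠ 0, its value at y = 0 would
vanish too; but that is C_σ(0) times a unit times 1 + ω + ⋯ + ω^{n-1}, nonzero for 0 < n < q. -/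
theorem poleSum_ne {p q : ℕ} (hp : 1 ≤ p) (hpq : p < q) {a z₀ : ℂ} (ha : a ≠ 0) (i : ℤ) {n : ℕ}
    (hn : 0 < n) (hnq : n < q) : ∃ w, poleSum p q a z₀ (i + n) w 0 ≠ poleSum p q a z₀ i w 0 := by
  by_contra! hall
  have hp0 : (0 : ℝ) < p := by exact_mod_cast hp
  have hpC : (p : ℂ) ≠ 0 := by exact_mod_cast hp0.ne'
  have hqC : (q : ℂ) ≠ 0 := by exact_mod_cast (by omega : q ≠ 0)
  have hπC : (Real.pi : ℂ) ≠ 0 := by exact_mod_cast Real.pi_ne_zero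
  have hI := Complex.I_ne_zero
  have hσ : 1 < (q / p : ℝ) := by rw [one_lt_div hp0]; exact_mod_cast hpq
  set e : ℕ → ℂ := fun m => Complex.exp (2 * (((i + m + 1 : ℤ) : ℂ) - 1) * Real.pi * Complex.I / q)
    with he
  have htel : ∀ (n : ℕ) (w : ℂ), poleSum p q a z₀ (i + n) w 0 - poleSum p q a z₀ i w 0 =
      ∑ m ∈ Finset.range n, poleJump p q a z₀ (i + m + 1) w 0 := by
    intro n w
    induction n with
    | zero => simp
    | succ n ih =>
      rw [Finset.sum_range_succ, ← ih, ← poleSum_sub hp hpq]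
      push_cast
      rw [← add_assoc, add_sub_cancel_right]
      ring
  set G : ℂ → ℂ := fun y => ∑ m ∈ Finset.range n, e m * kernelC (q / p) (z₀ * e m * y) with hG
  have hGc : Continuous G := by
    rw [hG]
    refine continuous_finsetSum _ fun m _ => continuous_const.mul ?_
    exact (differentiable_kernelC hσ).continuous.comp (by fun_prop)
  have hG0 : ∀ y ∈ ({0}ᶜ : Set ℂ), G y = 0 := by
    intro y hy
    have hy0 : y ≠ 0 := hy
    set w : ℂ := -(q / p * Complex.log y) with hw
    have hT : tpow p q w = y⁻¹ := by
      rw [tpow, hw, ← Complex.exp_log hy0, ← Complex.exp_neg, Complex.exp_log hy0]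
      congr 1
      field_simp
    have h1 := htel n w
    rw [hall w, sub_self] at h1
    have h2 : ∀ m ∈ Finset.range n, poleJump p q a z₀ (i + m + 1) w 0 =
        -(2 * Real.pi * Complex.I / q * y) * a * (e m * kernelC (q / p) (z₀ * e m * y)) := by
      intro m _
      rw [poleJump, hT, sub_zero, div_inv_eq_mul, he]
      field_simp
    rw [Finset.sum_congr rfl h2, ← Finset.mul_sum] at h1
    refine (mul_eq_zero.1 h1.symm).resolve_left (mul_ne_zero (neg_ne_zero.2 ?_) ha)
    exact mul_ne_zero (div_ne_zero (mul_ne_zero (mul_ne_zero two_ne_zero hπC) hI) hqC) hy0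
  have hGz : G 0 = 0 := by
    have := Continuous.ext_on (dense_compl_singleton (0 : ℂ)) hGc continuous_const hG0
    exact congrFun this 0
  have hω := Complex.isPrimitiveRoot_exp q (by omega)
  set ω := Complex.exp (2 * Real.pi * Complex.I / q) with hωd
  have hem : ∀ m ∈ Finset.range n, e m * kernelC (q / p) (z₀ * e m * 0) =
      (Complex.exp (2 * i * Real.pi * Complex.I / q) * kernelC (q / p) 0) * ω ^ m := by
    intro m _
    rw [mul_zero, he, hωd, ← Complex.exp_nat_mul, mul_right_comm, ← Complex.exp_add]
    congr 2
    push_cast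
    ring_nf
  simp only [hG] at hGz
  rw [Finset.sum_congr rfl hem, ← Finset.mul_sum] at hGz
  have hs := (mul_eq_zero.1 hGz).resolve_left
    (mul_ne_zero (Complex.exp_ne_zero _) (kernelC_zero_ne_zero hσ))
  have h3 := mul_neg_geom_sum ω n
  rw [hs, mul_zero] at h3
  exact hω.pow_ne_one_of_pos_of_lt hn.ne' hnq (sub_eq_zero.1 h3.symm).symm

theorem exists_poleSum_ne_of_isOpen {p q : ℕ} (hp : 1 ≤ p) (hpq : p < q) {a z₀ : ℂ} (ha : a ≠ 0)
    {i j : ℕ} (hi : i ∈ Finset.Icc 1 q) (hj : j ∈ Finset.Icc 1 q) (hij : i ≠ j) {N : Set ℂ}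
    (hN : IsOpen N) (hne : N.Nonempty) :
    ∃ w ∈ N, poleSum p q a z₀ i w 0 ≠ poleSum p q a z₀ j w 0 := by
  wlog hlt : i < j generalizing i j
  · obtain ⟨w, hw, h⟩ := this hj hi hij.symm (by omega)
    exact ⟨w, hw, h.symm⟩
  rw [Finset.mem_Icc] at hi hj
  by_contra! hall
  obtain ⟨w₀, hw₀⟩ := hne
  obtain ⟨w, hw⟩ := poleSum_ne hp hpq (z₀ := z₀) ha i (n := j - i) (by omega) (by omega)
  have hcast : (i : ℤ) + ((j - i : ℕ) : ℤ) = j := by omega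
  rw [hcast] at hw
  refine hw (eqOn_of_eqOn_open isOpen_univ convex_univ
    (differentiable_poleSum_left hp hpq a z₀ j 0).differentiableOn
    (differentiable_poleSum_left hp hpq a z₀ i 0).differentiableOn hN (mem_univ w₀) hw₀
    (fun w hw => (hall w hw.2).symm) (mem_univ w))

/-! ### Descent to the Riemann surface and the maximal family. -/

/-- The branches of the actual solutions, on the Riemann surface of `t ^ (p / q)`. -/
def branchFun (p q : ℕ) (a z₀ : ℂ) (f : ℂ → ℂ) (l : ℕ) : RSurf (q / p) → ℂ → ℂ :=
  fun x z => solBranch p q a z₀ f l (Quotient.out x) z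

theorem branchFun_proj {p q : ℕ} (hp : 1 ≤ p) (hq : 1 ≤ q) (a z₀ : ℂ) (f : ℂ → ℂ) (l : ℕ) (w z : ℂ) :
    branchFun p q a z₀ f l (proj (q / p) w) z = solBranch p q a z₀ f l w z := by
  have h : proj (q / p) (Quotient.out (proj (q / p : ℝ) w)) = proj (q / p) w :=
    Quotient.out_eq (proj (q / p : ℝ) w)
  obtain ⟨n, hn⟩ := proj_eq_proj_iff.1 h
  rw [branchFun]
  conv_rhs => rw [hn]
  exact (solBranch_periodic hp hq a z₀ f l n _ z).symm

theorem pull_branchFun {p q : ℕ} (hp : 1 ≤ p) (hq : 1 ≤ q) (a z₀ : ℂ) (f : ℂ → ℂ) (l : ℕ) :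
    pull (branchFun p q a z₀ f l) = solBranch p q a z₀ f l := by
  funext w z
  exact branchFun_proj hp hq a z₀ f l w z

theorem surfDisc_eq {σ : ℝ} (hσ : 0 < σ) (r : ℝ) {α : ℝ} (hα : 4 * Real.pi * σ ≤ α) :
    surfDisc σ r = proj σ '' sector 0 α r := by
  have hπ := Real.pi_pos
  apply Subset.antisymm
  · rintro x ⟨w, hw, rfl⟩
    have hP : 0 < 2 * Real.pi * σ := by positivity
    -- Rounding brings arg t into [-πσ, πσ]; an opening of 4πσ contains this closed interval with
    -- room to spare.
    set n := round (w.im / (2 * Real.pi * σ)) with hn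
    refine ⟨w + (-n : ℤ) * (((2 * Real.pi * σ : ℝ) : ℂ) * Complex.I), ⟨?_, ?_⟩,
      (proj_eq_proj_iff.2 ⟨-n, rfl⟩).symm⟩
    · rw [re_add_period]; exact hw
    · rw [im_add_period]
      have h1 := abs_sub_round (w.im / (2 * Real.pi * σ))
      have h2 : w.im + ((-n : ℤ) : ℝ) * (2 * Real.pi * σ) - 0 =
          2 * Real.pi * σ * (w.im / (2 * Real.pi * σ) - n) := by
        push_cast; field_simp; ring
      rw [h2, abs_mul, abs_of_pos hP]
      have h3 := mul_le_mul_of_nonneg_left h1 hP.le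
      linarith
  · exact image_mono fun w hw => hw.1

theorem exp_re_lt_of_image_subset_surfDisc {σ r : ℝ} {S : Set ℂ} (h : proj σ '' S ⊆ surfDisc σ r)
    {w : ℂ} (hw : w ∈ S) : Real.exp w.re < r := by
  obtain ⟨w', hw', he⟩ := h ⟨w, hw, rfl⟩
  obtain ⟨n, rfl⟩ := proj_eq_proj_iff.1 he
  rw [re_add_period]
  exact hw'

theorem isMaximalFamily_branchFun {p q : ℕ} (hp : 1 ≤ p) (hpq : p < q) {a z₀ : ℂ} (ha : a ≠ 0)
    (hz₀ : z₀ ≠ 0) {f φ : ℂ → ℂ} (hf : EntireExpGrowth (q / (q - p)) f)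
    (hφ : ∀ z, z ≠ z₀ → φ z = a / (z - z₀) + f z)
    {ρ₀ : ℝ} (hρ₀ : 0 < ρ₀) {uh : ℕ → ℂ → ℂ} (huh : IsFormalSolution p q φ (Metric.ball 0 ρ₀) uh)
    {k : ℝ} (hk : k = p / (q - p)) {ε : ℝ} (hε : 0 < ε) (hε1 : ε < 2 * Real.pi / p)
    (hε2 : ε < Real.pi * (q - p) / p) :
    ∃ r > 0, ∃ ρ > 0, IsMaximalFamily p q φ uh k (surfDisc (q / p) r) (Metric.ball 0 ρ)
      (Finset.Icc 1 q) (fun l => proj (q / p) '' sector (poleDir p q z₀ l + Real.pi / p)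
        (2 * Real.pi / p + Real.pi * (q - p) / p - ε) r) (branchFun p q a z₀ f) := by
  have hπ := Real.pi_pos
  have hp0 : (0 : ℝ) < p := by exact_mod_cast hp
  have hq1 : 1 ≤ q := by omega
  have hq0 : (0 : ℝ) < q := by exact_mod_cast hq1
  have hσ0 : (0 : ℝ) < q / p := by positivity
  have hpi2 : Real.pi / p = 2 * Real.pi / p / 2 := by ring
  obtain ⟨r, hr, hholo, hpde, hlim⟩ := solBranch_spec hp hpq (a := a) hz₀ hf hφ
  obtain ⟨ρ, hρ, hlim⟩ := hlim ε hε
  have hball : Metric.ball (0 : ℂ) (min ρ 1) ⊆ Metric.ball 0 1 :=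
    Metric.ball_subset_ball (min_le_right _ _)
  set A : ℝ := 2 * Real.pi / p + Real.pi * (q - p) / p - ε with hA
  have hpull := fun l : ℕ => pull_branchFun hp hq1 a z₀ f l
  have hpre : ∀ {S : Set ℂ} {w : ℂ}, (∀ w ∈ S, Real.exp w.re < r) →
      w ∈ proj (q / p) ⁻¹' (proj (q / p) '' S) → Real.exp w.re < r := by
    intro S w hS hw
    obtain ⟨n, w', hw', rfl⟩ := mem_preimage_proj_image hw
    rw [re_add_period]
    exact hS w' hw'
  -- The closed gap from δ_l to δ_{l+1} lies in V_l because ε < π(q-p)/p makes the half opening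
  -- exceed π/p. The gaps cover all arguments, so the V_l cover the disc.
  have hinV : ∀ {l : ℕ} {n : ℤ} {w : ℂ}, Real.exp w.re < r → poleDir p q z₀ (l + q * n) ≤ w.im →
      w.im ≤ poleDir p q z₀ (l + q * n + 1) →
      proj (q / p) w ∈ proj (q / p) '' sector (poleDir p q z₀ l + Real.pi / p) A r := by
    intro l n w hw h1 h2
    refine ⟨w + (-n : ℤ) * (((2 * Real.pi * (q / p : ℝ) : ℝ) : ℂ) * Complex.I), ⟨?_, ?_⟩,
      (proj_eq_proj_iff.2 ⟨-n, rfl⟩).symm⟩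
    · rw [re_add_period]; exact hw
    · rw [poleDir_add_one] at h2
      rw [poleDir_add_mul] at h1 h2
      rw [im_add_period, abs_lt]
      push_cast
      constructor <;> linarith
  refine ⟨r, hr, min ρ 1, by positivity, ?_⟩
  refine
    { summable := isKSummable_formalSolution hp hpq hz₀ hf hφ hρ₀ huh hk
      sector_base := ?_
      sector := ?_
      cover := ?_
      solution := ?_
      distinct := ?_
      maximal := ?_ }
  · exact ⟨0, max (4 * Real.pi * (q / p)) (Real.pi / k + 1), r,
      lt_of_lt_of_le (by linarith) (le_max_right _ _), hr, surfDisc_eq hσ0 r (le_max_left _ _)⟩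
  · intro l _
    refine ⟨image_mono fun w hw => hw.1, _, A, r, ?_, hr, rfl⟩
    -- The opening exceeds π/k because ε < 2π/p.
    rw [pi_div_eq hp hk, hA]; linarith
  · rintro x ⟨w, hw, rfl⟩
    obtain ⟨L, hL1, hL2⟩ := exists_poleDir_le (q := q) hp z₀ w.im
    obtain ⟨l, hl, n, rfl⟩ := exists_mem_Icc_add_mul hq1 L
    exact mem_biUnion (x := l) (by exact_mod_cast hl) (hinV hw hL1 hL2.le)
  · intro l _
    have hS : ∀ w ∈ proj (q / p) ⁻¹' (proj (q / p) '' sector (poleDir p q z₀ l + Real.pi / p) A r),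
        Real.exp w.re < r := fun w hw => hpre (fun w hw => hw.1) hw
    refine ⟨?_, ?_, ?_⟩
    · rw [hpull]
      exact (hholo l).mono (prod_mono hS hball)
    · intro w hw z hz
      rw [hpull]
      exact hpde l w (hS w hw) z (hball hz)
    · intro j hj z hz
      rw [hpull]
      refine hlim l _ hS (fun w hw => ?_) j hj z (Metric.ball_subset_ball (min_le_left _ _) hz)
      obtain ⟨n, w', hw', rfl⟩ := mem_preimage_proj_image hw
      refine ⟨n, w', rfl, ?_⟩
      have := hw'.2.le
      rwa [poleDir, Int.cast_natCast] at this
  · intro i hi j hj hij hne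
    set N := proj (q / p : ℝ) ⁻¹' (proj (q / p) '' sector (poleDir p q z₀ i + Real.pi / p) A r) ∩
      proj (q / p : ℝ) ⁻¹' (proj (q / p) '' sector (poleDir p q z₀ j + Real.pi / p) A r) with hN
    have hNo : IsOpen N := (isOpen_preimage_proj_image (isOpen_sector _ _ _)).inter
      (isOpen_preimage_proj_image (isOpen_sector _ _ _))
    obtain ⟨x, hx⟩ := hne
    obtain ⟨w, hw, rfl⟩ := hx.1
    -- The entire parts cancel at z = 0, and the pole parts are entire in log t, so they already
    -- differ somewhere on the nonempty open overlap.
    obtain ⟨w', hw', h⟩ := exists_poleSum_ne_of_isOpen hp hpq (z₀ := z₀) ha hi hj hij hNo ⟨w, hx⟩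
    refine ⟨proj (q / p) w', hw', 0, Metric.mem_ball_self (by positivity), ?_⟩
    rw [branchFun_proj hp hq1, branchFun_proj hp hq1, solBranch, solBranch]
    exact fun h' => h (add_left_cancel h')
  · intro d' α R hα hR hsub v hv d hd hsum hkv
    have hdne : ∀ l : ℤ, d ≠ poleDir p q z₀ l := by
      rintro l rfl
      exact not_isSummableIn_poleDir hp hpq ha hz₀ hf.1 hφ hρ₀ huh hk l hsum
    obtain ⟨L, hL1, hL2⟩ := exists_poleDir_le (q := q) hp z₀ d
    obtain ⟨l, hl, n, rfl⟩ := exists_mem_Icc_add_mul hq1 L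
    obtain ⟨α₁, hα₁, r₁, hr₁, ρ₁, hρ₁, heq⟩ := hkv.eq_solBranch hp hpq hz₀ hf hφ hρ₀ huh hk
      (lt_of_le_of_ne hL1 (hdne _).symm) hL2
    rw [solBranch_add hq1] at heq
    have hSr : ∀ w ∈ sector d' α R, Real.exp w.re < r := fun w hw =>
      exp_re_lt_of_image_subset_surfDisc hsub hw
    obtain ⟨w₀, hw₀, hw₀d⟩ := exists_mem_line (lt_min hR hr₁) d
    have hw₀S : w₀ ∈ sector d' α R := ⟨hw₀.trans_le (min_le_left _ _), by rwa [hw₀d]⟩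
    have hw₀1 : w₀ ∈ sector d α₁ r₁ := ⟨hw₀.trans_le (min_le_right _ _), by
      rw [hw₀d, sub_self, abs_zero]; positivity⟩
    have hvh : HoloOn (sector d' α R) (Metric.ball 0 (min ρ 1)) (pull v) :=
      hv.holo.mono (prod_mono (fun w hw => ⟨w, hw, rfl⟩) Subset.rfl)
    have huh' : HoloOn (sector d' α R) (Metric.ball 0 (min ρ 1)) (solBranch p q a z₀ f l) :=
      (hholo l).mono (prod_mono hSr hball)
    have h0 : (0 : ℂ) ∈ Metric.ball (0 : ℂ) (min ρ 1) := Metric.mem_ball_self (by positivity)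
    -- The given k-sum and the branch agree only for small t and z at first. The identity theorem
    -- extends the equality in t for fixed small z, and then in z to the whole disc.
    have hstep : ∀ z ∈ Metric.ball (0 : ℂ) (min ρ 1) ∩ Metric.ball 0 ρ₁,
        EqOn (fun w => pull v w z) (fun w => solBranch p q a z₀ f l w z) (sector d' α R) :=
      fun z hz => eqOn_of_eqOn_open (isOpen_sector _ _ _) (convex_sector _ _ _) (hvh.left hz.1)
        (huh'.left hz.1) (isOpen_sector d α₁ r₁) hw₀S hw₀1 fun w hw => heq w hw z hz.2
    have hall : ∀ w ∈ sector d' α R, ∀ z ∈ Metric.ball (0 : ℂ) (min ρ 1),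
        pull v w z = solBranch p q a z₀ f l w z := fun w hw =>
      eqOn_of_eqOn_open Metric.isOpen_ball (convex_ball _ _) (hvh.right hw) (huh'.right hw)
        Metric.isOpen_ball h0 (Metric.mem_ball_self hρ₁) fun z hz => hstep z hz hw
    refine ⟨l, hl, ⟨proj (q / p) w₀, ⟨w₀, hw₀S, rfl⟩,
      hinV (n := n) (hSr w₀ hw₀S) (by rwa [hw₀d]) (by rw [hw₀d]; exact hL2.le)⟩, ?_⟩
    rintro x ⟨⟨w, hw, rfl⟩, -⟩ z hz
    rw [branchFun_proj hp hq1]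
    exact hall w hw z hz

end

/-! ### Assembly of the theorem. -/

theorem theorem6p2 (p q : ℕ) (hp : 1 ≤ p) (hpq : p < q) (a z₀ : ℂ) (ha : a ≠ 0) (hz₀ : z₀ ≠ 0)
    (φt : ℂ → ℂ) (hφt : EntireExpGrowth (q / (q - p)) φt)
    (φ : ℂ → ℂ) (hφ : ∀ z, z ≠ z₀ → φ z = a / (z - z₀) + φt z)
    (ρ₀ : ℝ) (hρ₀ : 0 < ρ₀) (uh : ℕ → ℂ → ℂ)
    (huh : IsFormalSolution p q φ (Metric.ball 0 ρ₀) uh)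
    (k σ : ℝ) (hk : k = p / (q - p)) (hσ : σ = q / p)
    (δ : ℕ → ℝ) (hδ : δ = stokesDelta p q z₀) :
    IsKSummable k uh ∧
    stokesLines k σ uh = {L | ∃ l ∈ Finset.Icc 1 q, L = argLine σ (δ l)} ∧
    antiStokesLines k σ uh = {L | ∃ l ∈ Finset.Icc 1 q,
      L = argLine σ (δ l + Real.pi * (q - p) / (2 * p)) ∨
      L = argLine σ (δ l - Real.pi * (q - p) / (2 * p))} ∧
    (∀ l ∈ Finset.Icc 1 q, IsJump k uh (δ l) (stokesJump p q a z₀ l)) ∧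
    ∃ u : ℕ → RSurf σ → ℂ → ℂ, u 0 = u q ∧
      -- `u_l` is the `k`-sum `u^θ` for `θ ∈ (δ_l, δ_{l+1})` modulo `2πq/p`
      (∀ l ∈ Finset.Icc 1 q, ∀ m : ℤ, ∀ θ : ℝ,
        δ l + 2 * Real.pi * σ * m < θ → θ < δ (l + 1) + 2 * Real.pi * σ * m →
        IsKSum k uh θ (sectorInf θ (Real.pi / k)) (pull (u l)) ∧
        ∀ α, 0 < α → α < Real.pi / k → ∃ r > 0, ∃ ρ > 0,
          ∀ w ∈ sector θ α r, ∀ z ∈ Metric.ball (0 : ℂ) ρ,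
            MeasureTheory.IntegrableOn (solIntegrand p q φ θ w z) (Set.Ioi 0) ∧
            pull (u l) w z = solInt p q φ θ w z) ∧
      ∀ ε, 0 < ε → ε < 2 * Real.pi / p → ε < Real.pi * (q - p) / p → ∃ r > 0, ∃ ρ > 0,
        IsMaximalFamily p q φ uh k (surfDisc σ r) (Metric.ball 0 ρ) (Finset.Icc 1 q)
          (fun l => proj σ '' sector (δ l + Real.pi / p)
            (2 * Real.pi / p + Real.pi * (q - p) / p - ε) r) u ∧
        ∀ l ∈ Finset.Icc 1 q, ∀ w ∈ sector (δ l) (Real.pi * (q - p) / p - ε) r,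
          ∀ z ∈ Metric.ball (0 : ℂ) ρ,
            pull (u l) w z - pull (u (l - 1)) w z = stokesJump p q a z₀ l w z := by
  subst hσ hδ
  have hp0 : (0 : ℝ) < p := by exact_mod_cast hp
  have hpne : (p : ℝ) ≠ 0 := hp0.ne'
  have hq1 : 1 ≤ q := by omega
  have hqp : (q : ℝ) - p ≠ 0 := by
    have : (p : ℝ) < q := by exact_mod_cast hpq
    linarith
  have hπk : Real.pi / (2 * k) = Real.pi * (q - p) / (2 * p) := by
    rw [hk]; field_simp
  have hstokes := isStokesDirection_iff hp hpq ha hz₀ hφt hφ hρ₀ huh hk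
  -- Singular directions whose indices differ by a multiple of q lie on the same line of the
  -- surface, so the indices 1 to q suffice.
  have hline : ∀ (l n : ℤ) (x : ℝ), argLine (q / p : ℝ) (poleDir p q z₀ (l + q * n) + x) =
      argLine (q / p) (poleDir p q z₀ l + x) := by
    intro l n x
    rw [poleDir_add_mul, add_right_comm, argLine_add]
  refine ⟨isKSummable_formalSolution hp hpq hz₀ hφt hφ hρ₀ huh hk, ?_, ?_, ?_,
    branchFun p q a z₀ φt, ?_, ?_, ?_⟩
  · ext L
    constructor
    · rintro ⟨d, hd, rfl⟩
      obtain ⟨j, rfl⟩ := (hstokes d).1 hd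
      obtain ⟨l, hl, n, rfl⟩ := exists_mem_Icc_add_mul hq1 j
      refine ⟨l, hl, ?_⟩
      simpa [stokesDelta_eq] using hline l n 0
    · rintro ⟨l, -, rfl⟩
      exact ⟨_, (hstokes _).2 ⟨l, stokesDelta_eq p q z₀ l⟩, rfl⟩
  · ext L
    constructor
    · rintro ⟨d, hd, h⟩
      obtain ⟨j, rfl⟩ := (hstokes d).1 hd
      obtain ⟨l, hl, n, rfl⟩ := exists_mem_Icc_add_mul hq1 j
      refine ⟨l, hl, ?_⟩
      rwa [sub_eq_add_neg, hline, hline, ← sub_eq_add_neg, hπk, ← stokesDelta_eq] at h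
    · rintro ⟨l, -, h⟩
      refine ⟨_, (hstokes _).2 ⟨l, stokesDelta_eq p q z₀ l⟩, ?_⟩
      rwa [hπk]
  · intro l _
    rw [stokesDelta_eq, stokesJump_eq]
    exact isJump_formalSolution hp hpq hz₀ hφt hφ hρ₀ huh hk l
  · funext x z
    -- The convention u_0 = u_q is the q-periodicity of the branches, from index 0 to index q.
    have h := solBranch_add (p := p) hq1 a z₀ φt 0 1
    rw [zero_add, mul_one] at h
    rw [branchFun, branchFun, h]
    rfl
  · intro l _ m θ h1 h2
    -- A direction in the m-th translate of the gap belongs to the index l + qm, whose branch is the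
    -- same function.
    rw [stokesDelta_eq, ← poleDir_add_mul] at h1
    rw [stokesDelta_eq, ← poleDir_add_mul, Nat.cast_add, Nat.cast_one, add_right_comm] at h2
    rw [pull_branchFun hp hq1, ← solBranch_add hq1 a z₀ φt l m]
    refine ⟨isKSum_solBranch hp hpq hz₀ hφt hφ hρ₀ huh hk h1 h2, fun α _ hα => ?_⟩
    rw [pi_div_eq hp hk] at hα
    have e2 : poleDir p q z₀ (l + q * m + 1) =
        q / p * Complex.arg z₀ + 2 * ((l + q * m : ℤ) : ℝ) * Real.pi / p := by
      rw [poleDir]; push_cast; ring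
    obtain ⟨r, hr, ρ, hρ, h⟩ := solInt_eq_solBranch hp hpq hz₀ hφt hφ h1 (by rwa [← e2]) hα
    exact ⟨r, hr, ρ, hρ, fun w hw z hz => ⟨(h w hw z hz).1, (h w hw z hz).2.symm⟩⟩
  · intro ε hε hε1 hε2
    obtain ⟨r, hr, ρ, hρ, h⟩ := isMaximalFamily_branchFun hp hpq ha hz₀ hφt hφ hρ₀ huh hk hε hε1 hε2
    refine ⟨r, hr, ρ, hρ, ?_, fun l hl w _ z _ => ?_⟩
    · simpa only [stokesDelta_eq] using h
    · have hl1 : ((l - 1 : ℕ) : ℤ) = (l : ℤ) - 1 := by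
        rw [Nat.cast_sub (Finset.mem_Icc.1 hl).1, Nat.cast_one]
      rw [pull_branchFun hp hq1, pull_branchFun hp hq1, hl1, solBranch_sub hp hpq, stokesJump_eq]
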